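/- Let $K\ge 1$. A state vector $\theta=(\theta_1,\dots,\theta_K)'\sim\mathcal N(\mu^0,V^0)$, with $V^0$ positive definite, is unknown and persistent. There are $K$ sources; an observation of source $k$ is $X_k=\langle c_k,\theta\rangle+\epsilon_k$ with $\epsilon_k\sim\mathcal N(0,\sigma_k^2)$, $\sigma_k>0$, the errors being independent of $\theta$ and independent across observations and sources. Let $C$ be the matrix with rows $c_k'$, and assume that $C$ is invertible and that all entries of the first row of $C^{-1}$ are nonzero. For a division $q=(q_1,\dots,q_K)\in\mathbb Z_+^K$ let $f(q)$ be the posterior variance of $\theta_1$ after $q_k$ observations of each source $k$ (it does not depend on $\mu^0$), extended to $(\mathbb Z_+\cup\{\infty\})^K$ by limits. Assume that every source always has strictly positive marginal value: $f(q_k+1,q_{-k})<f(q)$ for every $q\in(\mathbb Z_+\cup\{\infty\})^K$ and every $k$ with $q_k<\infty$ (for fixed $V^0$ and $\sigma_1,\dots,\sigma_K$ this holds for generic $C$). A division $q$ with $\sum_k q_k=t$ is called $t$-optimal if it minimizes $f$ among all divisions of $t$ observations. Let $$\lambda_i=\frac{|[C^{-1}]_{1i}|\,\sigma_i}{\sum_{j=1}^K|[C^{-1}]_{1j}|\,\sigma_j}.$$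 In each period $t=1,2,\dots$ the decision maker chooses one source, as a measurable function of the realizations observed so far, observes it, and then chooses an action $a_t$ from a set $A_t$, as a measurable function of the realizations observed so far. A decision problem is given by action sets (measurable spaces) $A_1,A_2,\dots$ and an arbitrary measurable payoff function $U(a_1,a_2,\dots;\theta_1)$. A strategy is optimal if its payoff is integrable and no strategy has a larger expected payoff. Let $d(t)$ be the (random) vector of the numbers of observations of each source in the first $t$ periods. Suppose that $\lambda_i/\lambda_j$ is irrational for all $i\neq j$. Then there is a set $\mathcal A$ of times with natural density $1$, depending only on $(V^0,C,\sigma_1,\dots,\sigma_K)$, such that for every $t\in\mathcal A$ the $t$-optimal division $n(t)$ is unique, and such that for every $\mu^0$ and every decision problem that has an optimal strategy there is an optimal strategy with $d(t)=n(t)$ almost surely for every $t\in\mathcal A$. In particular, this strategy induces a deterministic division at such times. -/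

import Mathlib

open MeasureTheory ProbabilityTheory Filter Topology

noncomputable section

/-- An informational environment with `K` states and `K` sources: the prior covariance matrix
`V` of the state vector `θ`, the coefficient matrix `C` (its `k`-th row is the coefficient vector
of source `k`) and the standard deviations `σ k` of the observation errors. -/
structure Environment (K : ℕ) where
  V : Matrix (Fin K) (Fin K) ℝ
  C : Matrix (Fin K) (Fin K) ℝ
  σ : Fin K → ℝ
  posDef_V : V.PosDef
  σ_pos : ∀ k, 0 < σ k

/-- A sample point: the state vector `θ`, and the errors `ε (k, n)` of the potential
observations `n = 0, 1, 2, …` of every source `k`. -/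
abbrev Sample (K : ℕ) : Type := EuclideanSpace ℝ (Fin K) × (Fin K × ℕ → ℝ)

namespace Environment

variable {K : ℕ}

/-- The law of the sample point: `θ ∼ N(μ, V)`, and, independently, independent errors
`ε (k, n) ∼ N(0, σ k ^ 2)`. -/
def law (E : Environment K) (μ : EuclideanSpace ℝ (Fin K)) : Measure (Sample K) :=
  (multivariateGaussian μ E.V).prod
    (Measure.infinitePi fun p : Fin K × ℕ => gaussianReal 0 (Real.toNNReal (E.σ p.1 ^ 2)))

/-- The `n`-th potential observation `⟨c_k, θ⟩ + ε (k, n)` of source `k`. -/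
def signal (E : Environment K) (k : Fin K) (n : ℕ) (ω : Sample K) : ℝ :=
  ∑ j, E.C k j * ω.1 j + ω.2 (k, n)

/-- The σ-algebra generated by `q k` observations of each source `k`. -/
@[reducible] def obsAlgebra (E : Environment K) (q : Fin K → ℕ) : MeasurableSpace (Sample K) :=
  MeasurableSpace.comap (fun ω (p : Σ k, Fin (q k)) => E.signal p.1 p.2 ω) inferInstance

/-- The posterior variance of the payoff-relevant state (coordinate `0`), under the prior
`N(μ, V)`, after `q k` observations of each source `k`. The conditional variance of a Gaussian
vector is almost surely constant; the integral picks out this constant. -/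
def posteriorVarianceAt [NeZero K] (E : Environment K) (μ : EuclideanSpace ℝ (Fin K))
    (q : Fin K → ℕ) : ℝ :=
  ∫ ω, (Var[fun ω : Sample K => ω.1 0; E.law μ | E.obsAlgebra q]) ω ∂(E.law μ)

/-- The posterior variance function `f` of the environment. It does not depend on the prior mean
(see `posteriorVarianceAt_eq`), which is therefore taken to be `0`. -/
def posteriorVariance [NeZero K] (E : Environment K) (q : Fin K → ℕ) : ℝ :=
  E.posteriorVarianceAt 0 q

theorem measurable_signal (E : Environment K) (k : Fin K) (n : ℕ) :
    Measurable (E.signal k n) := by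
  unfold signal; fun_prop

instance (E : Environment K) (μ : EuclideanSpace ℝ (Fin K)) : IsProbabilityMeasure (E.law μ) := by
  unfold law; infer_instance

theorem obsAlgebra_le (E : Environment K) (q : Fin K → ℕ) :
    E.obsAlgebra q ≤ (inferInstance : MeasurableSpace (Sample K)) := by
  unfold obsAlgebra
  exact Measurable.comap_le (measurable_pi_lambda _ fun p => E.measurable_signal p.1 p.2)

/-- Translation of the state vector. -/
def shift (a : EuclideanSpace ℝ (Fin K)) (ω : Sample K) : Sample K := (a + ω.1, ω.2)

theorem measurable_shift (a : EuclideanSpace ℝ (Fin K)) : Measurable (shift a) := by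
  unfold shift; fun_prop

theorem law_eq_map (E : Environment K) (μ : EuclideanSpace ℝ (Fin K)) :
    E.law μ = (E.law 0).map (shift μ) := by
  have h1 : multivariateGaussian μ E.V = (multivariateGaussian 0 E.V).map (fun x => μ + x) := by
    unfold multivariateGaussian
    rw [Measure.map_map (by fun_prop) (by fun_prop)]
    congr 1
    ext x
    simp
  unfold law
  rw [h1]
  conv_lhs => rw [← Measure.map_id (μ := Measure.infinitePi fun p : Fin K × ℕ =>
    gaussianReal 0 (Real.toNNReal (E.σ p.1 ^ 2)))]
  rw [Measure.map_prod_map _ _ (by fun_prop) measurable_id]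
  rfl

theorem comap_shift_obsAlgebra (E : Environment K) (a : EuclideanSpace ℝ (Fin K))
    (q : Fin K → ℕ) : (E.obsAlgebra q).comap (shift a) = E.obsAlgebra q := by
  let F : Sample K → (Σ k, Fin (q k)) → ℝ := fun ω p => E.signal p.1 p.2 ω
  let c : (Σ k, Fin (q k)) → ℝ := fun p => ∑ j, E.C p.1 j * a j
  have hF : F ∘ shift a = fun ω => c + F ω := by
    ext ω p
    simp only [F, c, shift, signal, Function.comp, Pi.add_apply, PiLp.add_apply, mul_add,
      Finset.sum_add_distrib]
    ring
  have hF' : F = (fun x => -c + x) ∘ (F ∘ shift a) := by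
    rw [hF]; ext ω p; simp
  have e1 : (E.obsAlgebra q).comap (shift a) = MeasurableSpace.comap (F ∘ shift a) inferInstance :=
    MeasurableSpace.comap_comp
  have e2 : E.obsAlgebra q = MeasurableSpace.comap F inferInstance := rfl
  rw [e1, e2]
  apply le_antisymm
  · rw [hF]
    change MeasurableSpace.comap ((fun x => c + x) ∘ F) _ ≤ _
    rw [← MeasurableSpace.comap_comp]
    exact MeasurableSpace.comap_mono (Measurable.comap_le (by fun_prop))
  · conv_lhs => rw [hF', ← MeasurableSpace.comap_comp]
    exact MeasurableSpace.comap_mono (Measurable.comap_le (by fun_prop))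

theorem memLp_state [NeZero K] (E : Environment K) (μ : EuclideanSpace ℝ (Fin K)) :
    MemLp (fun ω : Sample K => ω.1 0) 2 (E.law μ) := by
  have h : MemLp (fun x : EuclideanSpace ℝ (Fin K) => x 0) 2 (multivariateGaussian μ E.V) :=
    IsGaussian.memLp_dual _ (EuclideanSpace.proj (0 : Fin K)) 2 (by simp)
  exact h.comp_measurePreserving measurePreserving_fst

/-- The posterior variance does not depend on the prior mean. -/
theorem posteriorVarianceAt_eq [NeZero K] (E : Environment K) (μ : EuclideanSpace ℝ (Fin K))
    (q : Fin K → ℕ) : E.posteriorVarianceAt μ q = E.posteriorVariance q := by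
  have hm := E.obsAlgebra_le q
  have key : ∀ ν, E.posteriorVarianceAt ν q = ∫ ω, (ω.1 0 -
      ((E.law ν)[fun ω : Sample K => ω.1 0 | E.obsAlgebra q]) ω) ^ 2 ∂(E.law ν) := by
    intro ν
    unfold posteriorVarianceAt condVar
    rw [integral_condExp hm]
    rfl
  unfold posteriorVariance
  rw [key, key]
  set g := (E.law μ)[fun ω : Sample K => ω.1 0 | E.obsAlgebra q] with hg
  have hgm : StronglyMeasurable[E.obsAlgebra q] g := stronglyMeasurable_condExp
  have hS := measurable_shift μ
  have hXi : ∀ ν, Integrable (fun ω : Sample K => ω.1 0) (E.law ν) := fun ν =>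
    (E.memLp_state ν).integrable (by norm_num)
  have hgi : Integrable (fun ω => g (shift μ ω)) (E.law 0) := by
    refine Integrable.comp_measurable (g := g) ?_ hS
    rw [← law_eq_map]; exact integrable_condExp
  have hcond : (fun ω => g (shift μ ω) - μ 0) =ᵐ[E.law 0]
      (E.law 0)[fun ω : Sample K => ω.1 0 | E.obsAlgebra q] := by
    refine ae_eq_condExp_of_forall_setIntegral_eq hm (hXi 0)
      (fun s _ _ => (hgi.sub (integrable_const _)).integrableOn) ?_ ?_
    · intro s hs _
      rw [← comap_shift_obsAlgebra E μ q] at hs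
      obtain ⟨t, ht, rfl⟩ := hs
      have h1 : ∫ ω in t, g ω ∂(E.law μ) = ∫ ω in t, ω.1 0 ∂(E.law μ) :=
        setIntegral_condExp hm (hXi μ) ht
      have htm := hm t ht
      rw [E.law_eq_map μ, setIntegral_map htm _ hS.aemeasurable,
        setIntegral_map htm _ hS.aemeasurable] at h1
      · have h2 : ∀ ω : Sample K, (shift μ ω).1 0 = μ 0 + ω.1 0 := fun ω => by simp [shift]
        simp only [h2] at h1
        rw [integral_add (integrable_const _) (hXi 0).integrableOn] at h1
        rw [integral_sub hgi.integrableOn (integrable_const _)]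
        linarith
      · exact Measurable.aestronglyMeasurable (by fun_prop)
      · exact (hgm.mono hm).aestronglyMeasurable
    · have h3 : StronglyMeasurable[E.obsAlgebra q] (g ∘ shift μ) := by
        refine hgm.comp_measurable ?_
        rw [measurable_iff_comap_le, comap_shift_obsAlgebra]
      exact (h3.sub stronglyMeasurable_const).aestronglyMeasurable
  have h4 : Measurable fun ω : Sample K => (ω.1 0 - g ω) ^ 2 :=
    ((by fun_prop : Measurable fun ω : Sample K => ω.1 0).sub (hgm.mono hm).measurable).pow_const 2
  rw [show ∫ ω, (ω.1 0 - g ω) ^ 2 ∂(E.law μ) = ∫ ω, ((shift μ ω).1 0 - g (shift μ ω)) ^ 2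
      ∂(E.law 0) from by
    rw [E.law_eq_map μ]; exact integral_map hS.aemeasurable h4.aestronglyMeasurable]
  refine integral_congr_ae ?_
  filter_upwards [hcond] with ω hω
  rw [← hω]
  simp only [shift, PiLp.add_apply]
  ring

/-- The posterior variance function extended to divisions with infinite entries. It is nonincreasing
in every entry, so its limit at an infinite division is an infimum over finite divisions. -/
def extPosteriorVariance [NeZero K] (E : Environment K) (q : Fin K → ℕ∞) : ℝ :=
  ⨅ p : {p : Fin K → ℕ // ∀ k, (p k : ℕ∞) ≤ q k}, E.posteriorVariance p

/-- No redundant sources: `C` is invertible and the first row of `C⁻¹` has nonzero entries. -/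
def NonRedundant [NeZero K] (E : Environment K) : Prop :=
  IsUnit E.C ∧ ∀ i, E.C⁻¹ 0 i ≠ 0

/-- Every source has strictly positive marginal value: at every division, finite or infinite,
one more observation of a source observed finitely often lowers the posterior variance. -/
def PositiveMarginalValue [NeZero K] (E : Environment K) : Prop :=
  ∀ (q : Fin K → ℕ∞) (k : Fin K), q k ≠ ⊤ →
    E.extPosteriorVariance (Function.update q k (q k + 1)) < E.extPosteriorVariance q

/-- The limiting frequency `λ i` of source `i`. -/
def freq [NeZero K] (E : Environment K) (i : Fin K) : ℝ :=
  |E.C⁻¹ 0 i| * E.σ i / ∑ j, |E.C⁻¹ 0 j| * E.σ j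

/-- `q` is a `t`-optimal division: it minimizes the posterior variance among all divisions of
`t` observations. -/
def IsTOptimal [NeZero K] (E : Environment K) (t : ℕ) (q : Fin K → ℕ) : Prop :=
  ∑ k, q k = t ∧ ∀ p : Fin K → ℕ, ∑ k, p k = t → E.posteriorVariance q ≤ E.posteriorVariance p

end Environment

/-- A strategy for the action sets `𝒜 0, 𝒜 1, …`. In period `t = 0, 1, …` the decision maker chooses
a source as a measurable function of the `t` realizations observed so far, observes it, and then
chooses an action as a measurable function of the `t + 1` realizations observed so far. (The sources
chosen so far are determined by the realizations.) -/
structure Strategy (K : ℕ) (𝒜 : ℕ → Type*) [∀ t, MeasurableSpace (𝒜 t)] where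
  source : ∀ t : ℕ, (Fin t → ℝ) → Fin K
  measurable_source : ∀ t, Measurable (source t)
  action : ∀ t : ℕ, (Fin (t + 1) → ℝ) → 𝒜 t
  measurable_action : ∀ t, Measurable (action t)

namespace Strategy

variable {K : ℕ} {𝒜 : ℕ → Type*} [∀ t, MeasurableSpace (𝒜 t)]

/-- The first `t` realizations observed under the strategy. If source `k` is chosen in period `t`,
the potential observation number `t` of source `k` is observed. -/
def history (s : Strategy K 𝒜) (E : Environment K) (ω : Sample K) : ∀ t : ℕ, Fin t → ℝ
  | 0 => Fin.elim0
  | t + 1 => Fin.snoc (α := fun _ => ℝ) (history s E ω t)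
      (E.signal (s.source t (history s E ω t)) t ω)

/-- The division `d(t)`: how often each source was chosen in the first `t` periods. -/
def division (s : Strategy K 𝒜) (E : Environment K) (ω : Sample K) (t : ℕ) (k : Fin K) : ℕ :=
  ((Finset.range t).filter fun r => s.source r (s.history E ω r) = k).card

/-- The payoff `U (a₀, a₁, …; θ₁)` realized at a sample point. -/
def payoff [NeZero K] (s : Strategy K 𝒜) (E : Environment K) (U : (∀ t, 𝒜 t) → ℝ → ℝ)
    (ω : Sample K) : ℝ :=
  U (fun t => s.action t (s.history E ω (t + 1))) (ω.1 0)

/-- The expected payoff, as an extended real number: the expectation of the positive part minus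
that of the negative part, with the convention `∞ - ∞ = -∞`. -/
def expectedPayoff [NeZero K] (s : Strategy K 𝒜) (E : Environment K)
    (μ : EuclideanSpace ℝ (Fin K)) (U : (∀ t, 𝒜 t) → ℝ → ℝ) : EReal :=
  ((∫⁻ ω, ENNReal.ofReal (s.payoff E U ω) ∂(E.law μ) : ENNReal) : EReal) -
    ((∫⁻ ω, ENNReal.ofReal (-s.payoff E U ω) ∂(E.law μ) : ENNReal) : EReal)

/-- An optimal strategy: its payoff is integrable, and no strategy has a larger expected payoff. -/
def IsOptimal [NeZero K] (s : Strategy K 𝒜) (E : Environment K)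
    (μ : EuclideanSpace ℝ (Fin K)) (U : (∀ t, 𝒜 t) → ℝ → ℝ) : Prop :=
  Integrable (s.payoff E U) (E.law μ) ∧
    ∀ s' : Strategy K 𝒜, s'.expectedPayoff E μ U ≤ s.expectedPayoff E μ U

end Strategy

/-- The set `A` of positive integers has natural density `d` (elements `0` are ignored). -/
def HasNaturalDensity (A : Set ℕ) (d : ℝ) : Prop :=
  Tendsto (fun N : ℕ => ((A ∩ Set.Icc 1 N).ncard : ℝ) / N) atTop (𝓝 d)

end

/-!
If the normalized counts `q k / freq k` differ by a bounded amount, then the marginal value of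
observation number `m` of source `k` is nearly proportional to `rank ^ (-2)`, where
`rank = (m + offset k) / freq k` and the offset cancels the terms of first order. This suggests to
take the observations in the order of their ranks. At a time when the ranks of the observations
taken are smaller than all other ranks by at least `ε`, exchanging observations shows that these
observations are the unique optimal division. Times without an `ε`-gap are due to pairs of
observations of different sources with nearly equal ranks. As the ratios of frequencies are
irrational, for small `ε` such coincidences of a given pair of sources are far apart, so that the
good times have density one.

Between two successive good times, clamping a division between two divisions of the path gives a
division with a posterior variance of `θ₁` that is at most as large. Successive divisions go to
successive divisions, so that this is a way of replacing the sources of a strategy, and at good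
times the result is the optimal division. A decision maker who observes the replacing sources knows
`θ₁` at least as precisely. Adding independent Gaussian noise, she can simulate the realizations of
the original strategy so that they have the same joint law with `θ₁`, hence the same expected
payoff. If the original strategy is optimal, then so is the new one for almost every value of the
noise, and fixing one such value leaves a strategy that does not randomize.
-/

noncomputable section

/-! ### Divisions along a path -/

section Divisions

variable {ι : Type*}

/-- The element `a` of a lattice, truncated from above by `hi` and then from below by `lo`. -/
def clamp {α : Type*} [Lattice α] (lo hi a : α) : α := a ⊓ hi ⊔ lo

theorem clamp_mono {α : Type*} [Lattice α] {lo lo' hi hi' a a' : α} (hlo : lo ≤ lo')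
    (hhi : hi ≤ hi') (ha : a ≤ a') : clamp lo hi a ≤ clamp lo' hi' a' :=
  sup_le_sup (inf_le_inf ha hhi) hlo

@[simp] theorem clamp_self {α : Type*} [Lattice α] (b a : α) : clamp b b a = b :=
  sup_eq_right.2 inf_le_right

theorem clamp_apply (lo hi q : ι → ℕ) (k : ι) :
    clamp lo hi q k = max (min (q k) (hi k)) (lo k) := rfl

section Fintype

variable [Fintype ι]

theorem eq_of_le_of_sum_le {p q : ι → ℕ} (h : p ≤ q) (hsum : ∑ k, q k ≤ ∑ k, p k) : p = q :=
  h.eq_of_not_lt fun hlt => (Fintype.sum_strictMono hlt).not_ge hsum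

theorem exists_lt_of_sum_le_of_ne {p q : ι → ℕ} (hsum : ∑ k, q k ≤ ∑ k, p k) (hne : p ≠ q) :
    ∃ k, q k < p k := by
  by_contra! h
  exact hne (eq_of_le_of_sum_le h hsum)

variable [DecidableEq ι]

theorem sum_add_single (q : ι → ℕ) (k : ι) :
    ∑ i, (q + Pi.single k 1 : ι → ℕ) i = ∑ i, q i + 1 := by
  simp [Finset.sum_add_distrib]

theorem exists_eq_add_single {p q : ι → ℕ} (h : p ≤ q) (hsum : ∑ k, q k = ∑ k, p k + 1) :
    ∃ j, q = p + Pi.single j 1 := by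
  obtain ⟨j, hj⟩ := exists_lt_of_sum_le_of_ne (p := q) (q := p) (by omega) (by rintro rfl; omega)
  refine ⟨j, (eq_of_le_of_sum_le (fun k => ?_) (by rw [sum_add_single, hsum])).symm⟩
  obtain rfl | hk := eq_or_ne k j
  · simpa using hj
  · simpa [hk] using h k

end Fintype

section Clamp

variable [DecidableEq ι] {lo hi q : ι → ℕ} {i m : ι}

theorem eq_sub_single_add_single (h : 0 < q i) : q = q - Pi.single i 1 + Pi.single i 1 := by
  ext k
  obtain rfl | hk := eq_or_ne k i
  · simp only [Pi.add_apply, Pi.sub_apply, Pi.single_eq_same]; omega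
  · simp [hk]

theorem clamp_add_single_of_lt (h : q m < lo m) :
    clamp lo hi (q + Pi.single m 1) = clamp lo hi q := by
  ext k
  obtain rfl | hk := eq_or_ne k m
  · simp only [clamp_apply, Pi.add_apply, Pi.single_eq_same]; omega
  · simp [clamp_apply, hk]

theorem clamp_add_single_of_le (h : hi i ≤ q i) :
    clamp lo hi (q + Pi.single i 1) = clamp lo hi q := by
  ext k
  obtain rfl | hk := eq_or_ne k i
  · simp only [clamp_apply, Pi.add_apply, Pi.single_eq_same]; omega
  · simp [clamp_apply, hk]

theorem clamp_add_single_le (lo hi q : ι → ℕ) (k : ι) :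
    clamp lo hi (q + Pi.single k 1) ≤ clamp lo hi q + Pi.single k 1 := by
  intro i
  simp only [clamp_apply, Pi.add_apply]
  omega

variable [Fintype ι]

theorem sum_add_single_tsub_of_lt (h : q m < hi m) :
    ∑ k, ((q + Pi.single m 1 : ι → ℕ) k - hi k) = ∑ k, (q k - hi k) := by
  refine Finset.sum_congr rfl fun k _ => ?_
  obtain rfl | hk := eq_or_ne k m
  · simp only [Pi.add_apply, Pi.single_eq_same]; omega
  · simp [hk]

theorem sum_tsub_lt_sum_add_single_tsub (h : hi i ≤ q i) :
    ∑ k, (q k - hi k) < ∑ k, ((q + Pi.single i 1 : ι → ℕ) k - hi k) := by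
  refine Finset.sum_lt_sum (fun k _ => by simp only [Pi.add_apply]; omega)
    ⟨i, Finset.mem_univ i, ?_⟩
  simp only [Pi.add_apply, Pi.single_eq_same]
  omega

/-- Each observation of `q` beyond `hi` is replaced by one that is missing from `lo`. -/
theorem clamp_lt_of_exchange {β : Type*} [Preorder β] {f : (ι → ℕ) → β} {r : ℕ} (hle : lo ≤ hi)
    (hexch : ∀ (p : ι → ℕ) (i j : ι), ∑ k, p k < r → hi i ≤ p i → p j < lo j →
      ∃ m, p m < lo m ∧ f (p + Pi.single m 1) < f (p + Pi.single i 1))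
    (hq : ∑ k, q k = r) (hclamp : ∑ k, clamp lo hi q k = r) (hne : clamp lo hi q ≠ q) :
    f (clamp lo hi q) < f q := by
  induction hn : ∑ k, (q k - hi k) using Nat.strong_induction_on generalizing q with
  | _ n ih =>
    obtain ⟨i, hi_lt⟩ : ∃ i, clamp lo hi q i < q i :=
      exists_lt_of_sum_le_of_ne (hclamp.trans hq.symm).le hne.symm
    obtain ⟨j, hj_lt⟩ : ∃ j, q j < clamp lo hi q j :=
      exists_lt_of_sum_le_of_ne (hq.trans hclamp.symm).le hne
    rw [clamp_apply] at hi_lt hj_lt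
    have hij : j ≠ i := by rintro rfl; omega
    have hpos : 0 < q i := by omega
    obtain ⟨p, rfl⟩ : ∃ p, q = p + Pi.single i 1 :=
      ⟨q - Pi.single i 1, eq_sub_single_add_single hpos⟩
    simp only [Pi.add_apply, Pi.single_eq_same, Pi.single_eq_of_ne hij] at hi_lt hj_lt
    rw [sum_add_single] at hq
    have hip : hi i ≤ p i := by omega
    obtain ⟨m, hm, hlt⟩ := hexch p i j (by omega) hip (by omega)
    rw [clamp_add_single_of_le hip, ← clamp_add_single_of_lt hm] at hclamp ⊢
    obtain heq | hne' := eq_or_ne (clamp lo hi (p + Pi.single m 1)) (p + Pi.single m 1)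
    · rwa [heq]
    · refine (ih _ ?_ (by rw [sum_add_single, hq]) hclamp hne' rfl).trans hlt
      rw [← hn, sum_add_single_tsub_of_lt (hm.trans_le (hle m))]
      exact sum_tsub_lt_sum_add_single_tsub hip

theorem clamp_le_of_exchange {β : Type*} [Preorder β] {f : (ι → ℕ) → β} {r : ℕ} (hle : lo ≤ hi)
    (hexch : ∀ (p : ι → ℕ) (i j : ι), ∑ k, p k < r → hi i ≤ p i → p j < lo j →
      ∃ m, p m < lo m ∧ f (p + Pi.single m 1) < f (p + Pi.single i 1))
    (hq : ∑ k, q k = r) (hclamp : ∑ k, clamp lo hi q k = r) : f (clamp lo hi q) ≤ f q := by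
  obtain heq | hne := eq_or_ne (clamp lo hi q) q
  · rw [heq]
  · exact (clamp_lt_of_exchange hle hexch hq hclamp hne).le

end Clamp

/-- A path of divisions starting at `0`, along which one observation is added in each period. -/
structure IsDivisionPath [Fintype ι] (g : ℕ → ι → ℕ) : Prop where
  mono : Monotone g
  sum_eq (t : ℕ) : ∑ k, g t k = t

/-- The clamp of `q` between two divisions of the path `g`. As `l` increases from `0` to
`2 * (t₂ - t₁)`, first the upper bound increases from `g t₁` to `g t₂`, and then the lower one. -/
def pathClamp (g : ℕ → ι → ℕ) (t₁ t₂ l : ℕ) (q : ι → ℕ) : ι → ℕ :=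
  clamp (g (t₁ + (l - (t₂ - t₁)))) (g (min (t₁ + l) t₂)) q

theorem pathClamp_zero (g : ℕ → ι → ℕ) {t₁ t₂ : ℕ} (h : t₁ ≤ t₂) (q : ι → ℕ) :
    pathClamp g t₁ t₂ 0 q = g t₁ := by
  simp [pathClamp, h]

theorem pathClamp_last (g : ℕ → ι → ℕ) {t₁ t₂ : ℕ} (h : t₁ ≤ t₂) (q : ι → ℕ) :
    pathClamp g t₁ t₂ (2 * (t₂ - t₁)) q = g t₂ := by
  have hlo : t₁ + (2 * (t₂ - t₁) - (t₂ - t₁)) = t₂ := by omega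
  have hhi : min (t₁ + 2 * (t₂ - t₁)) t₂ = t₂ := by omega
  rw [pathClamp, hlo, hhi, clamp_self]

variable [Fintype ι]

/-- The first clamp of `q` between divisions of the path `g` which contains `r` observations. -/
def pathDivision (g : ℕ → ι → ℕ) (t₁ t₂ r : ℕ) (q : ι → ℕ) : ι → ℕ :=
  pathClamp g t₁ t₂ (sInf {l | r ≤ ∑ k, pathClamp g t₁ t₂ l q k}) q

namespace IsDivisionPath

variable {g : ℕ → ι → ℕ} {t₁ t₂ r l : ℕ} {q : ι → ℕ}

theorem map_zero (hg : IsDivisionPath g) : g 0 = 0 :=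
  funext fun k => (Finset.sum_eq_zero_iff.1 (hg.sum_eq 0)) k (Finset.mem_univ k)

theorem pathClamp_mono (hg : IsDivisionPath g) {l' : ℕ} {q' : ι → ℕ} (hl : l ≤ l') (hq : q ≤ q') :
    pathClamp g t₁ t₂ l q ≤ pathClamp g t₁ t₂ l' q' :=
  clamp_mono (hg.mono (by omega)) (hg.mono (by omega)) hq

theorem exists_succ_eq [DecidableEq ι] (hg : IsDivisionPath g) (t : ℕ) :
    ∃ j, g (t + 1) = g t + Pi.single j 1 :=
  exists_eq_add_single (hg.mono t.le_succ) (by rw [hg.sum_eq, hg.sum_eq])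

theorem sum_pathClamp_succ_le (hg : IsDivisionPath g) :
    ∑ k, pathClamp g t₁ t₂ (l + 1) q k ≤ ∑ k, pathClamp g t₁ t₂ l q k + 1 := by
  classical
  suffices ∃ j, pathClamp g t₁ t₂ (l + 1) q ≤ pathClamp g t₁ t₂ l q + Pi.single j 1 by
    obtain ⟨j, hj⟩ := this
    exact (sum_add_single (pathClamp g t₁ t₂ l q) j).symm ▸ Finset.sum_le_sum fun k _ => hj k
  rcases lt_or_ge l (t₂ - t₁) with h | h
  · obtain ⟨j, hj⟩ := hg.exists_succ_eq (min (t₁ + l) t₂)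
    have hlo : l + 1 - (t₂ - t₁) = l - (t₂ - t₁) := by omega
    have hhi : min (t₁ + (l + 1)) t₂ = min (t₁ + l) t₂ + 1 := by omega
    refine ⟨j, fun k => ?_⟩
    simp only [pathClamp, hlo, hhi, hj, clamp_apply, Pi.add_apply]
    omega
  · obtain ⟨j, hj⟩ := hg.exists_succ_eq (t₁ + (l - (t₂ - t₁)))
    have hlo : t₁ + (l + 1 - (t₂ - t₁)) = t₁ + (l - (t₂ - t₁)) + 1 := by omega
    have hhi : min (t₁ + (l + 1)) t₂ = min (t₁ + l) t₂ := by omega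
    refine ⟨j, fun k => ?_⟩
    simp only [pathClamp, hlo, hhi, hj, clamp_apply, Pi.add_apply]
    omega

theorem last_mem (hg : IsDivisionPath g) (h : t₁ ≤ t₂) (hr : r ≤ t₂) :
    2 * (t₂ - t₁) ∈ {l | r ≤ ∑ k, pathClamp g t₁ t₂ l q k} := by
  rwa [Set.mem_ofPred_eq, pathClamp_last g h, hg.sum_eq]

theorem sum_pathDivision (hg : IsDivisionPath g) (h₁ : t₁ ≤ r) (h₂ : r ≤ t₂) (q : ι → ℕ) :
    ∑ k, pathDivision g t₁ t₂ r q k = r := by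
  rw [pathDivision]
  set S := {l | r ≤ ∑ k, pathClamp g t₁ t₂ l q k}
  refine le_antisymm ?_ (Nat.sInf_mem (s := S) ⟨_, hg.last_mem (h₁.trans h₂) h₂⟩)
  rcases Nat.eq_zero_or_pos (sInf S) with h | h
  · rwa [h, pathClamp_zero g (h₁.trans h₂), hg.sum_eq]
  · have hpred : ¬ r ≤ ∑ k, pathClamp g t₁ t₂ (sInf S - 1) q k :=
      Nat.notMem_of_lt_sInf (s := S) (by omega)
    have hstep := hg.sum_pathClamp_succ_le (t₁ := t₁) (t₂ := t₂) (l := sInf S - 1) (q := q)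
    rw [Nat.sub_add_cancel h] at hstep
    omega

theorem pathDivision_left (hg : IsDivisionPath g) (h : t₁ ≤ t₂) (q : ι → ℕ) :
    pathDivision g t₁ t₂ t₁ q = g t₁ := by
  refine (eq_of_le_of_sum_le ?_ (by rw [hg.sum_pathDivision le_rfl h, hg.sum_eq])).symm
  rw [← pathClamp_zero g h q]
  exact hg.pathClamp_mono (Nat.zero_le _) le_rfl

theorem pathDivision_right (hg : IsDivisionPath g) (h : t₁ ≤ t₂) (q : ι → ℕ) :
    pathDivision g t₁ t₂ t₂ q = g t₂ := by
  refine eq_of_le_of_sum_le ?_ (by rw [hg.sum_pathDivision h le_rfl, hg.sum_eq])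
  rw [← pathClamp_last g h q]
  exact hg.pathClamp_mono (Nat.sInf_le (hg.last_mem h le_rfl)) le_rfl

variable [DecidableEq ι]

theorem pathDivision_le_succ (hg : IsDivisionPath g) (h₁ : t₁ ≤ r) (h₂ : r + 1 ≤ t₂) (q : ι → ℕ)
    (k : ι) :
    pathDivision g t₁ t₂ r q ≤ pathDivision g t₁ t₂ (r + 1) (q + Pi.single k 1) := by
  have hsum := hg.sum_pathDivision h₁ (Nat.le_of_succ_le h₂) q
  have hsum' := hg.sum_pathDivision (Nat.le_succ_of_le h₁) h₂ (q + Pi.single k 1)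
  have hq : q ≤ q + Pi.single k 1 := le_self_add
  unfold pathDivision at *
  set l := sInf {l | r ≤ ∑ k, pathClamp g t₁ t₂ l q k}
  set l' := sInf {l | r + 1 ≤ ∑ i, pathClamp g t₁ t₂ l (q + Pi.single k 1) i}
  rcases le_total l l' with h | h
  · exact hg.pathClamp_mono h hq
  · have hle := Finset.sum_le_sum fun i (_ : i ∈ Finset.univ) =>
      clamp_add_single_le (g (t₁ + (l - (t₂ - t₁)))) (g (min (t₁ + l) t₂)) q k i
    rw [sum_add_single] at hle
    rw [eq_of_le_of_sum_le (hg.pathClamp_mono h (le_refl (q + Pi.single k 1)))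
      (hle.trans (by rw [hsum']; exact Nat.succ_le_succ hsum.le))]
    exact hg.pathClamp_mono le_rfl hq

theorem exists_pathDivision_succ_eq (hg : IsDivisionPath g) (h₁ : t₁ ≤ r) (h₂ : r + 1 ≤ t₂)
    (q : ι → ℕ) (k : ι) :
    ∃ j, pathDivision g t₁ t₂ (r + 1) (q + Pi.single k 1) =
      pathDivision g t₁ t₂ r q + Pi.single j 1 :=
  exists_eq_add_single (hg.pathDivision_le_succ h₁ h₂ q k) (by
    rw [hg.sum_pathDivision h₁ (by omega), hg.sum_pathDivision (by omega) h₂])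

end IsDivisionPath

section GoodTimes

variable [DecidableEq ι] {β : Type*} [Preorder β]

/-- `t` is a good time of the path `g` for the minimization of `f`: in divisions of at most `t + B`
observations, replacing an observation beyond `g t` by a suitable one that is missing from
`g s`, `s ≤ t`, lowers `f`. -/
def IsGoodTime (g : ℕ → ι → ℕ) (f : (ι → ℕ) → β) (B t : ℕ) : Prop :=
  ∀ (q : ι → ℕ) (i j : ι) (s : ℕ), ∑ k, q k < t + B → g t i ≤ q i → s ≤ t → q j < g s j →
    ∃ m, q m < g s m ∧ f (q + Pi.single m 1) < f (q + Pi.single i 1)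

variable {g : ℕ → ι → ℕ} {f : (ι → ℕ) → β} {B : ℕ}

theorem IsGoodTime.path_lt {t : ℕ} (h : IsGoodTime g f B t) (hg : IsDivisionPath g) {q : ι → ℕ}
    (hq : ∑ k, q k = t) (hne : q ≠ g t) : f (g t) < f q := by
  have := clamp_lt_of_exchange (f := f) (le_refl (g t))
    (fun p i j hp hi hj => h p i j t (by omega) hi le_rfl hj) hq
    (by rw [clamp_self, hg.sum_eq]) (by rw [clamp_self]; exact hne.symm)
  rwa [clamp_self] at this

theorem IsDivisionPath.isGoodTime_zero (hg : IsDivisionPath g) : IsGoodTime g f B 0 := by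
  intro q i j s _ _ hs hj
  rw [Nat.le_zero.1 hs, hg.map_zero] at hj
  exact absurd hj (Nat.not_lt_zero _)

theorem IsDivisionPath.map_pathDivision_le (hg : IsDivisionPath g) {t₁ t₂ r : ℕ} (h₁ : t₁ ≤ r)
    (h₂ : r ≤ t₂) (hgood₁ : IsGoodTime g f (r - t₁) t₁) (hgood₂ : IsGoodTime g f B t₂)
    {q : ι → ℕ} (hq : ∑ k, q k = r) : f (pathDivision g t₁ t₂ r q) ≤ f q := by
  have hsum := hg.sum_pathDivision h₁ h₂ q
  have hlast := Nat.sInf_le (hg.last_mem (q := q) (h₁.trans h₂) h₂)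
  simp only [pathDivision, pathClamp] at hsum ⊢
  set l := sInf {l | r ≤ ∑ k, clamp (g (t₁ + (l - (t₂ - t₁)))) (g (min (t₁ + l) t₂)) q k}
  simp only [pathClamp] at hlast
  change l ≤ _ at hlast
  refine clamp_le_of_exchange (hg.mono (by omega)) (fun p i j hp hi hj => ?_) hq hsum
  rcases le_total l (t₂ - t₁) with hl | hl
  · rw [Nat.sub_eq_zero_of_le hl, add_zero] at hj ⊢
    exact hgood₁ p i j t₁ (by omega) ((hg.mono (by omega) i).trans hi) le_rfl hj
  · rw [min_eq_right (by omega)] at hi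
    exact hgood₂ p i j _ (by omega) hi (by omega) hj

end GoodTimes

/-- `a` and `b` are the elements of `A` next to `r`, with `a ≤ r < b`. -/
structure IsBracket (A : Set ℕ) (r a b : ℕ) : Prop where
  left_mem : a ∈ A
  right_mem : b ∈ A
  left_le : a ≤ r
  lt_right : r < b
  le_or_le (t : ℕ) (ht : t ∈ A) : t ≤ a ∨ b ≤ t

namespace IsBracket

variable {A : Set ℕ} {r a b a' b' : ℕ}

theorem unique (h : IsBracket A r a b) (h' : IsBracket A r a' b') : a = a' ∧ b = b' := by
  have := h.le_or_le a' h'.left_mem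
  have := h.le_or_le b' h'.right_mem
  have := h'.le_or_le a h.left_mem
  have := h'.le_or_le b h.right_mem
  have := h.left_le
  have := h.lt_right
  have := h'.left_le
  have := h'.lt_right
  omega

theorem left_eq (h : IsBracket A r a b) (hr : r ∈ A) : a = r := by
  have := h.le_or_le r hr
  have := h.left_le
  have := h.lt_right
  omega

theorem right_eq (h : IsBracket A r a b) (hr : r + 1 ∈ A) : b = r + 1 := by
  have := h.le_or_le (r + 1) hr
  have := h.left_le
  have := h.lt_right
  omega

theorem succ (h : IsBracket A r a b) (hr : r + 1 ∉ A) : IsBracket A (r + 1) a b where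
  __ := h
  left_le := h.left_le.trans r.le_succ
  lt_right := lt_of_le_of_ne h.lt_right fun heq => hr (heq ▸ h.right_mem)

end IsBracket

theorem exists_isBracket {A : Set ℕ} (h0 : 0 ∈ A) (hA : ∀ r, ∃ t ∈ A, r < t) (r : ℕ) :
    ∃ a b, IsBracket A r a b := by
  classical
  refine ⟨Nat.findGreatest (· ∈ A) r, Nat.find (hA r),
    Nat.findGreatest_spec (P := (· ∈ A)) (Nat.zero_le r) h0, (Nat.find_spec (hA r)).1,
    Nat.findGreatest_le r, (Nat.find_spec (hA r)).2, fun t ht => ?_⟩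
  rcases le_or_gt t r with h | h
  · exact Or.inl (Nat.le_findGreatest h ht)
  · exact Or.inr (Nat.find_min' (hA r) ⟨ht, h⟩)

/-- `G` maps each division `q` of `r` observations to a division `G r q` which is no worse for the
minimization of `f`, in such a way that successive divisions go to successive divisions. -/
structure IsReduction [DecidableEq ι] {β : Type*} [Preorder β] (f : (ι → ℕ) → β)
    (G : ℕ → (ι → ℕ) → ι → ℕ) : Prop where
  map_zero : G 0 0 = 0
  map_le (r : ℕ) (q : ι → ℕ) : ∑ k, q k = r → f (G r q) ≤ f q
  exists_map_succ (r : ℕ) (q : ι → ℕ) (k : ι) :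
    ∃ j, G (r + 1) (q + Pi.single k 1) = G r q + Pi.single j 1

theorem isReduction_id [DecidableEq ι] {β : Type*} [Preorder β] (f : (ι → ℕ) → β) :
    IsReduction f fun _ q => q :=
  ⟨rfl, fun _ _ _ => le_rfl, fun _ _ k => ⟨k, rfl⟩⟩

/-- Between neighbouring good times, `G` moves a division into the interval of the path between
these times. -/
theorem IsDivisionPath.exists_isReduction [DecidableEq ι] {β : Type*} [Preorder β]
    {g : ℕ → ι → ℕ} (hg : IsDivisionPath g) {f : (ι → ℕ) → β} {B : ℕ} {A : Set ℕ}
    (hgood : ∀ t ∈ A, IsGoodTime g f B t) (h0 : 0 ∈ A) (hA : ∃ t ∈ A, 0 < t)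
    (hgap : ∀ t ∈ A, 0 < t → ∃ t' ∈ A, t < t' ∧ t' ≤ t + B) :
    ∃ G, IsReduction f G ∧ ∀ t ∈ A, ∀ q, G t q = g t := by
  have hunbounded : ∀ r, ∃ t ∈ A, r < t := by
    intro r
    induction r with
    | zero => exact hA
    | succ r ih =>
      obtain ⟨t, ht, hrt⟩ := ih
      obtain ⟨t', ht', htt', -⟩ := hgap t ht (by omega)
      exact ⟨t', ht', by omega⟩
  choose a b hab using exists_isBracket h0 hunbounded
  have ha_le : ∀ r, a r ≤ r := fun r => (hab r).left_le
  have hlt_b : ∀ r, r < b r := fun r => (hab r).lt_right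
  have hval : ∀ t ∈ A, ∀ q, pathDivision g (a t) (b t) t q = g t := fun t ht q => by
    conv_lhs => rw [(hab t).left_eq ht]
    exact hg.pathDivision_left (hlt_b t).le q
  have hgood_left : ∀ r, IsGoodTime g f (r - a r) (a r) := fun r => by
    rcases Nat.eq_zero_or_pos (a r) with h | h
    · rw [h]; exact hg.isGoodTime_zero
    · obtain ⟨t', ht', hlt, hle⟩ := hgap _ (hab r).left_mem h
      have := (hab r).le_or_le t' ht'
      have := hlt_b r
      exact fun q i j s hq => hgood _ (hab r).left_mem q i j s (by omega)
  refine ⟨fun r q => pathDivision g (a r) (b r) r q,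
    ⟨(hval 0 h0 0).trans hg.map_zero, fun r q => hg.map_pathDivision_le (ha_le r) (hlt_b r).le
      (hgood_left r) (hgood _ (hab r).right_mem), fun r q k => ?_⟩, hval⟩
  have hsame : pathDivision g (a (r + 1)) (b (r + 1)) (r + 1) (q + Pi.single k 1) =
      pathDivision g (a r) (b r) (r + 1) (q + Pi.single k 1) := by
    by_cases h : r + 1 ∈ A
    · rw [hval _ h, (hab r).right_eq h, hg.pathDivision_right ((ha_le r).trans r.le_succ)]
    · obtain ⟨h₁, h₂⟩ := (hab (r + 1)).unique ((hab r).succ h)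
      rw [h₁, h₂]
  simp only [hsame]
  exact hg.exists_pathDivision_succ_eq (ha_le r) (hlt_b r) q k

end Divisions

/-! ### The path that takes observations in the order of their scores -/

section Greedy

variable {ι L : Type*} [Finite ι] [Nonempty ι] [LinearOrder L]

/-- A source whose next observation, after the division `q`, has the least score. Here `score k m`
is the score of observation number `m` of source `k`. -/
def minScore (score : ι → ℕ → L) (q : ι → ℕ) : ι :=
  (Finite.exists_min fun k => score k (q k)).choose

theorem minScore_le (score : ι → ℕ → L) (q : ι → ℕ) (k : ι) :
    score (minScore score q) (q (minScore score q)) ≤ score k (q k) :=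
  (Finite.exists_min fun k => score k (q k)).choose_spec k

variable [DecidableEq ι]

/-- The division into the `s` observations of least scores. -/
def greedy (score : ι → ℕ → L) : ℕ → ι → ℕ
  | 0 => 0
  | s + 1 => greedy score s + Pi.single (minScore score (greedy score s)) 1

theorem greedy_mono (score : ι → ℕ → L) : Monotone (greedy score) :=
  monotone_nat_of_le_succ fun s => le_self_add (a := greedy score s)

theorem greedy_add_le (score : ι → ℕ → L) (s d : ℕ) (k : ι) :
    greedy score (s + d) k ≤ greedy score s k + d := by
  induction d with
  | zero => rfl
  | succ d ih =>
    have hsingle : Pi.single (M := fun _ => ℕ) (minScore score (greedy score (s + d))) 1 k ≤ 1 := by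
      rw [Pi.single_apply]; split_ifs <;> omega
    rw [← add_assoc, greedy, Pi.add_apply]
    omega

theorem isDivisionPath_greedy {ι : Type*} [Fintype ι] [Nonempty ι] [DecidableEq ι]
    (score : ι → ℕ → L) : IsDivisionPath (greedy score) := by
  refine ⟨greedy_mono score, fun t => ?_⟩
  induction t with
  | zero => simp [greedy]
  | succ t ih => rw [greedy, sum_add_single, ih]

theorem exists_greedy_eq (score : ι → ℕ → L) {s m : ℕ} {j : ι} (h : m < greedy score s j) :
    ∃ s' < s, greedy score s' j = m ∧ minScore score (greedy score s') = j := by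
  induction s with
  | zero => simp [greedy] at h
  | succ s ih =>
    by_cases hm : m < greedy score s j
    · obtain ⟨s', hs', hs'_eq⟩ := ih hm
      exact ⟨s', by omega, hs'_eq⟩
    · rw [greedy, Pi.add_apply, Pi.single_apply] at h
      split_ifs at h with hj
      · exact ⟨s, by omega, by omega, hj.symm⟩
      · omega

theorem score_le_of_lt_greedy {score : ι → ℕ → L} (hmono : ∀ k, StrictMono (score k))
    {s m m' : ℕ} {j k : ι} (h : m < greedy score s j) (hle : greedy score s k ≤ m') :
    score j m ≤ score k m' := by
  obtain ⟨s', hs', rfl, rfl⟩ := exists_greedy_eq score h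
  exact (minScore_le score _ k).trans ((hmono k).monotone ((greedy_mono score hs'.le k).trans hle))

theorem lt_greedy_of_score_le {score : ι → ℕ → L} (hmono : ∀ k, StrictMono (score k))
    (hinj : ∀ k l m m', score k m = score l m' → k = l) {s m m' : ℕ} {j k : ι}
    (h : m < greedy score s j) (hle : score k m' ≤ score j m) : m' < greedy score s k := by
  by_contra! hm'
  have heq := hle.antisymm (score_le_of_lt_greedy hmono h hm')
  obtain rfl := hinj _ _ _ _ heq
  rw [(hmono k).injective heq] at hm'
  omega

theorem isGoodTime_greedy {ι β : Type*} [Fintype ι] [Nonempty ι] [DecidableEq ι] [Preorder β]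
    {score : ι → ℕ → L} (hmono : ∀ k, StrictMono (score k))
    (hinj : ∀ k l m m', score k m = score l m' → k = l) {f : (ι → ℕ) → β} {B t : ℕ}
    (h : ∀ (q : ι → ℕ) (i : ι), ∑ k, q k < t + B → greedy score t i ≤ q i →
      q (minScore score q) < greedy score t (minScore score q) →
      f (q + Pi.single (minScore score q) 1) < f (q + Pi.single i 1)) :
    IsGoodTime (greedy score) f B t := by
  intro q i j s hq hi hs hj
  have hmin := lt_greedy_of_score_le hmono hinj hj (minScore_le score q j)
  exact ⟨_, hmin, h q i hq hi (hmin.trans_le (greedy_mono score hs _))⟩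

end Greedy

/-! ### Natural density -/

section Density

theorem hasNaturalDensity_one_of_tendsto_compl {A : Set ℕ}
    (h : Tendsto (fun N : ℕ => ((Set.Icc 1 N \ A).ncard : ℝ) / N) atTop (𝓝 0)) :
    HasNaturalDensity A 1 := by
  have hcard : ∀ N : ℕ, ((A ∩ Set.Icc 1 N).ncard : ℝ) + (Set.Icc 1 N \ A).ncard = N := fun N => by
    have hsum := Set.ncard_inter_add_ncard_sdiff_eq_ncard (Set.Icc 1 N) A (Set.finite_Icc 1 N)
    rw [Set.inter_comm, ← Finset.coe_Icc, Set.ncard_coe_finset, Nat.card_Icc] at hsum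
    exact_mod_cast hsum
  refine ((tendsto_const_nhds (x := (1 : ℝ))).sub h |>.congr' ?_).trans (by rw [sub_zero])
  filter_upwards [eventually_gt_atTop 0] with N hN
  rw [eq_div_iff (by positivity), sub_mul, one_mul, div_mul_cancel₀ _ (by positivity)]
  linarith [hcard N]

/-- Distinct elements of `S` are more than `Q` apart. -/
def IsSeparatedBy (Q : ℕ) (S : Set ℕ) : Prop := ∀ s ∈ S, ∀ s' ∈ S, s < s' → s + Q < s'

theorem IsSeparatedBy.ncard_le {Q : ℕ} {S : Set ℕ} (h : IsSeparatedBy Q S) (N : ℕ) :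
    (S ∩ Set.Icc 1 N).ncard ≤ N / (Q + 1) + 1 := by
  have hmono : StrictMonoOn (· / (Q + 1)) S := fun s hs s' hs' hlt => by
    have hstep := Nat.div_le_div_right (c := Q + 1) (h s hs s' hs' hlt)
    rw [Nat.succ_eq_add_one, add_assoc, Nat.add_div_right _ Q.succ_pos] at hstep
    exact hstep
  calc (S ∩ Set.Icc 1 N).ncard
      ≤ (Finset.range (N / (Q + 1) + 1) : Set ℕ).ncard :=
        Set.ncard_le_ncard_of_injOn (· / (Q + 1))
          (fun s hs => by simpa using Nat.lt_succ_of_le (Nat.div_le_div_right hs.2.2))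
          (hmono.injOn.mono Set.inter_subset_left) (Finset.finite_toSet _)
    _ = N / (Q + 1) + 1 := by rw [Set.ncard_coe_finset, Finset.card_range]

variable {ι : Type*} [Fintype ι] {A : Set ℕ} {Q T : ℕ} {S : ι → Set ℕ}

theorem ncard_Icc_diff_le_of_cover (hS : ∀ i, IsSeparatedBy Q (S i))
    (hcov : ∀ t, T ≤ t → t ∉ A → ∃ i, t ∈ S i) (N : ℕ) :
    (Set.Icc 1 N \ A).ncard ≤ T + Fintype.card ι * (N / (Q + 1) + 1) := by
  have hsub : Set.Icc 1 N \ A ⊆ (Finset.range T : Set ℕ) ∪ ⋃ i, (S i ∩ Set.Icc 1 N) := by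
    rintro t ⟨ht, htA⟩
    rcases lt_or_ge t T with hlt | hge
    · exact Or.inl (by simpa using hlt)
    · obtain ⟨i, hi⟩ := hcov t hge htA
      exact Or.inr (Set.mem_iUnion.2 ⟨i, hi, ht⟩)
  have hfin : (⋃ i, (S i ∩ Set.Icc 1 N)).Finite :=
    Set.finite_iUnion fun i => (Set.finite_Icc 1 N).inter_of_right _
  calc (Set.Icc 1 N \ A).ncard
      ≤ (Finset.range T : Set ℕ).ncard + (⋃ i, (S i ∩ Set.Icc 1 N)).ncard :=
        (Set.ncard_le_ncard hsub ((Finset.finite_toSet _).union hfin)).trans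
          (Set.ncard_union_le _ _)
    _ ≤ T + ∑ i, (S i ∩ Set.Icc 1 N).ncard := by
        rw [Set.ncard_coe_finset, Finset.card_range]
        exact Nat.add_le_add_left (Set.ncard_iUnion_le_of_fintype _) T
    _ ≤ T + ∑ _i : ι, (N / (Q + 1) + 1) := by gcongr with i; exact (hS i).ncard_le N
    _ = T + Fintype.card ι * (N / (Q + 1) + 1) := by simp

theorem hasNaturalDensity_one_of_cover {ι : Type*} [Finite ι] {A : Set ℕ}
    (h : ∀ Q : ℕ, ∃ (T : ℕ) (S : ι → Set ℕ), (∀ i, IsSeparatedBy Q (S i)) ∧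
      ∀ t, T ≤ t → t ∉ A → ∃ i, t ∈ S i) : HasNaturalDensity A 1 := by
  have := Fintype.ofFinite ι
  obtain ⟨c, hc⟩ : ∃ c : ℝ, c = Fintype.card ι := ⟨_, rfl⟩
  refine hasNaturalDensity_one_of_tendsto_compl <| tendsto_order.2
    ⟨fun ε hε => Eventually.of_forall fun N => hε.trans_le (by positivity), fun ε hε => ?_⟩
  obtain ⟨Q, hQ⟩ : ∃ Q : ℕ, c / (Q + 1) < ε / 2 := by
    have hlim := tendsto_const_nhds (x := c).mul tendsto_one_div_add_atTop_nhds_zero_nat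
    simpa [mul_zero, div_eq_mul_inv] using (hlim.eventually_lt_const (by simpa using hε)).exists
  obtain ⟨T, S, hS, hcov⟩ := h Q
  filter_upwards [eventually_gt_atTop 0, (tendsto_const_div_atTop_nhds_zero_nat (T + c)).eventually
    (gt_mem_nhds (half_pos hε))] with N hN_pos hN_large
  have hc_nonneg : 0 ≤ c := hc ▸ Nat.cast_nonneg _
  have hcard : ((Set.Icc 1 N \ A).ncard : ℝ) ≤ T + c * ((N / (Q + 1) : ℕ) + 1) := by
    rw [hc]
    exact_mod_cast ncard_Icc_diff_le_of_cover hS hcov N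
  have hdiv : ((N / (Q + 1) : ℕ) : ℝ) ≤ N / (Q + 1) := by
    exact_mod_cast Nat.cast_div_le (α := ℝ) (m := N) (n := Q + 1)
  calc ((Set.Icc 1 N \ A).ncard : ℝ) / N ≤ (T + c * (N / (Q + 1) + 1)) / N := by
        gcongr; exact hcard.trans (by gcongr)
    _ = (T + c) / N + c / (Q + 1) := by
        have : (N : ℝ) ≠ 0 := by exact_mod_cast hN_pos.ne'
        field_simp
        ring
    _ < ε := by linarith

theorem exists_mem_of_cover (hS : ∀ i, IsSeparatedBy (Fintype.card ι) (S i))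
    (hcov : ∀ t, T ≤ t → t ∉ A → ∃ i, t ∈ S i) {t : ℕ} (ht : T ≤ t) :
    ∃ t' ∈ A, t < t' ∧ t' ≤ t + (Fintype.card ι + 1) := by
  by_contra! hcon
  set I := Finset.Icc (t + 1) (t + (Fintype.card ι + 1)) with hI
  have hmem : ∀ {t'}, t' ∈ I → t + 1 ≤ t' ∧ t' ≤ t + (Fintype.card ι + 1) := Finset.mem_Icc.1
  have hcov' : ∀ t' ∈ I, ∃ i, t' ∈ S i := fun t' ht' => by
    have := hmem ht'
    exact hcov t' (by omega) fun h => (hcon t' h (by omega)).not_ge this.2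
  have : Nonempty ι := ⟨(hcov' (t + 1) (by simp [hI])).choose⟩
  choose! i hi using hcov'
  obtain ⟨x, hx, y, hy, hne, hxy⟩ := Finset.exists_ne_map_eq_of_card_lt_of_maps_to
    (s := I) (t := Finset.univ) (f := i) (by simp [hI]) (fun _ _ => Finset.mem_univ _)
  have hx' := hi x hx
  have hy' := hi y hy
  rw [← hxy] at hy'
  have := hmem hx
  have := hmem hy
  rcases lt_or_gt_of_ne hne with hlt | hlt
  · have := hS _ x hx' y hy' hlt; omega
  · have := hS _ y hy' x hx' hlt; omega

end Density

theorem exists_hasNaturalDensity_one_of_cover {ι : Type*} [Fintype ι] {P : ℕ → Prop}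
    (h : ∀ Q : ℕ, ∃ (T : ℕ) (S : ι → Set ℕ), (∀ i, IsSeparatedBy Q (S i)) ∧
      ∀ t, T ≤ t → ¬ P t → ∃ i, t ∈ S i) :
    ∃ A : Set ℕ, HasNaturalDensity A 1 ∧ 0 ∈ A ∧ (∃ t ∈ A, 0 < t) ∧ (∀ t ∈ A, 0 < t → P t) ∧
      ∀ t ∈ A, 0 < t → ∃ t' ∈ A, t < t' ∧ t' ≤ t + (Fintype.card ι + 1) := by
  obtain ⟨T₀, S₀, hS₀, hcov₀⟩ := h (Fintype.card ι)
  set A : Set ℕ := {t | t = 0 ∨ T₀ ≤ t ∧ P t}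
  have hcov {T : ℕ} {S : ι → Set ℕ} (hS : ∀ t, T ≤ t → ¬ P t → ∃ i, t ∈ S i) (t : ℕ)
      (ht : max T T₀ ≤ t) (htA : t ∉ A) : ∃ i, t ∈ S i :=
    hS t ((le_max_left _ _).trans ht) fun hP => htA (Or.inr ⟨(le_max_right _ _).trans ht, hP⟩)
  have hnext {t : ℕ} (ht : T₀ ≤ t) : ∃ t' ∈ A, t < t' ∧ t' ≤ t + (Fintype.card ι + 1) :=
    exists_mem_of_cover hS₀ (hcov hcov₀) (by rwa [max_self])
  refine ⟨A, hasNaturalDensity_one_of_cover (ι := ι) fun Q => ?_, Or.inl rfl, ?_, ?_, ?_⟩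
  · obtain ⟨T, S, hS, hST⟩ := h Q
    exact ⟨max T T₀, S, hS, hcov hST⟩
  · obtain ⟨t, ht, hlt, -⟩ := hnext le_rfl
    exact ⟨t, ht, hlt.pos⟩
  · rintro t (rfl | ⟨-, hP⟩) hpos
    exacts [absurd hpos (lt_irrefl 0), hP]
  · rintro t (rfl | ⟨hT, -⟩) hpos
    exacts [absurd hpos (lt_irrefl 0), hnext hT]

/-! ### Sources observed with given frequencies -/

theorem eventually_le_abs_div_sub_div {x y : ℝ} (hx : 0 < x) (hirr : Irrational (x / y)) (Q : ℕ) :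
    ∀ᶠ ε : ℝ in 𝓝 0, ∀ h : ℕ, 0 < h → h ≤ Q → ∀ g : ℤ, ε ≤ |g / x - h / y| := by
  have hy : y ≠ 0 := (div_ne_zero_iff.1 hirr.ne_zero).2
  have hlim : Tendsto (fun ε : ℝ => ε * x) (𝓝 0) (𝓝 0) := by
    simpa using (continuous_mul_const x).tendsto 0
  filter_upwards [hlim.eventually (hirr.eventually_forall_le_dist_cast_div_of_denom_le Q)]
    with ε hε h h_pos hhQ g
  have h_one : (1 : ℝ) ≤ h := by exact_mod_cast h_pos
  have hdist : dist (x / y) ((g : ℤ) / (h : ℕ)) = |(g : ℝ) / x - h / y| * (x / h) := by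
    rw [Real.dist_eq, abs_sub_comm, ← abs_of_pos (show 0 < x / h by positivity), ← abs_mul]
    congr 1
    field_simp
  refine le_of_mul_le_mul_right ((hε h hhQ g).trans ?_) hx
  rw [hdist]
  gcongr
  exact div_le_self hx.le h_one

section Rank

variable {ι : Type*}

/-- The rank of observation number `m` of source `k`, for sources of frequencies `a` and
offsets `b`. -/
def obsRank (a b : ι → ℝ) (k : ι) (m : ℕ) : ℝ := (m + b k) / a k

theorem obsRank_add (a b : ι → ℝ) (k : ι) (m n : ℕ) :
    obsRank a b k (m + n) = obsRank a b k m + n / a k := by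
  simp only [obsRank, Nat.cast_add]
  ring

/-- Ranks with ties broken by the order of the sources. -/
def lexRank (a b : ι → ℝ) (k : ι) (m : ℕ) : ℝ ×ₗ ι := toLex (obsRank a b k m, k)

theorem lexRank_injective (a b : ι → ℝ) (k l : ι) (m m' : ℕ)
    (h : lexRank a b k m = lexRank a b l m') : k = l :=
  congrArg (fun x => (ofLex x).2) h

variable {a b : ι → ℝ}

theorem obsRank_strictMono (ha : ∀ k, 0 < a k) (k : ι) : StrictMono (obsRank a b k) :=
  fun m m' h => div_lt_div_of_pos_right (by gcongr) (ha k)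

variable [LinearOrder ι]

theorem obsRank_le_of_lexRank_le {k l : ι} {m m' : ℕ}
    (h : lexRank a b k m ≤ lexRank a b l m') : obsRank a b k m ≤ obsRank a b l m' :=
  (Prod.Lex.toLex_le_toLex.1 h).elim le_of_lt fun heq => heq.1.le

theorem lexRank_strictMono (ha : ∀ k, 0 < a k) (k : ι) : StrictMono (lexRank a b k) :=
  fun _ _ h => Prod.Lex.toLex_lt_toLex.2 (Or.inl (obsRank_strictMono ha k h))

/-- The divisions that give source `k` the frequency `a k`. -/
def rankPath [Finite ι] [Nonempty ι] (a b : ι → ℝ) : ℕ → ι → ℕ := greedy (lexRank a b)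

variable [Finite ι] [Nonempty ι]

theorem obsRank_le_of_lt_rankPath (ha : ∀ k, 0 < a k) {s m m' : ℕ} {k l : ι}
    (hm : m < rankPath a b s l) (hm' : rankPath a b s k ≤ m') :
    obsRank a b l m ≤ obsRank a b k m' :=
  obsRank_le_of_lexRank_le (score_le_of_lt_greedy (lexRank_strictMono ha) hm hm')

/-- At time `t`, the observations of the rank path precede all others by at least `ε`. -/
def HasGap (a b : ι → ℝ) (ε : ℝ) (t : ℕ) : Prop :=
  ∀ (k l : ι) (m m' : ℕ), rankPath a b t k ≤ m → m' < rankPath a b t l →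
    obsRank a b l m' + ε ≤ obsRank a b k m

/-- In period `s` the rank path takes an observation of source `l` whose rank is less than `ε`
below that of the next observation of source `k`. -/
structure IsNearMiss (a b : ι → ℝ) (ε : ℝ) (k l : ι) (s : ℕ) : Prop where
  ne : k ≠ l
  minScore_eq : minScore (lexRank a b) (rankPath a b s) = l
  lt_add : obsRank a b k (rankPath a b s k) < obsRank a b l (rankPath a b s l) + ε

theorem IsNearMiss.le {ε : ℝ} {k l : ι} {s : ℕ} (h : IsNearMiss a b ε k l s) :
    obsRank a b l (rankPath a b s l) ≤ obsRank a b k (rankPath a b s k) := by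
  have := minScore_le (lexRank a b) (rankPath a b s) k
  rw [h.minScore_eq] at this
  exact obsRank_le_of_lexRank_le this

theorem exists_isNearMiss_of_not_hasGap (ha : ∀ k, 0 < a k) {ε : ℝ} (hε : ∀ k, ε ≤ 1 / a k)
    {s : ℕ} (hgap : ¬ HasGap a b ε (s + 1)) : ∃ k l, IsNearMiss a b ε k l s := by
  simp only [HasGap, not_forall, not_le] at hgap
  obtain ⟨k, l, m, m', hm, hm', hlt⟩ := hgap
  set j := minScore (lexRank a b) (rankPath a b s) with hj
  have hsucc : rankPath a b (s + 1) = rankPath a b s + Pi.single j 1 := rfl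
  have hl : obsRank a b l m' ≤ obsRank a b j (rankPath a b s j) := by
    by_cases h : m' < rankPath a b s l
    · exact obsRank_le_of_lt_rankPath ha h le_rfl
    · obtain rfl : l = j := by
        by_contra hne
        rw [hsucc, Pi.add_apply, Pi.single_eq_of_ne hne, add_zero] at hm'
        exact h hm'
      rw [hsucc, Pi.add_apply, Pi.single_eq_same] at hm'
      exact (obsRank_strictMono ha j).monotone (Nat.le_of_lt_succ hm')
  have hk : obsRank a b k (rankPath a b (s + 1) k) < obsRank a b j (rankPath a b s j) + ε :=
    ((obsRank_strictMono ha k).monotone hm).trans_lt (by linarith)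
  have hkj : k ≠ j := by
    rintro rfl
    rw [hsucc, Pi.add_apply, Pi.single_eq_same, obsRank_add, Nat.cast_one] at hk
    linarith [hε j]
  refine ⟨k, j, hkj, hj.symm, ?_⟩
  rwa [hsucc, Pi.add_apply, Pi.single_eq_of_ne hkj, add_zero] at hk

theorem isSeparatedBy_isNearMiss {ε : ℝ} {k l : ι} {Q : ℕ}
    (hε : k ≠ l → ∀ h : ℕ, 0 < h → h ≤ Q → ∀ g : ℤ, ε ≤ |g / a k - h / a l|) :
    IsSeparatedBy Q ((· + 1) '' {s | IsNearMiss a b ε k l s}) := by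
  rintro _ ⟨s, hs, rfl⟩ _ ⟨s', hs', rfl⟩ hlt
  replace hlt : s + 1 ≤ s' := by simpa using hlt
  by_contra! hle
  have hmono := greedy_mono (lexRank a b)
  obtain ⟨h, hh⟩ : ∃ h, rankPath a b s' l = rankPath a b s l + h :=
    Nat.exists_eq_add_of_le (hmono (by omega) l)
  obtain ⟨g, hg⟩ : ∃ g, rankPath a b s' k = rankPath a b s k + g :=
    Nat.exists_eq_add_of_le (hmono (by omega) k)
  have hh_pos : 0 < h := by
    have hsucc : rankPath a b (s + 1) l = rankPath a b s l + 1 := by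
      simp only [rankPath, greedy, ← hs.minScore_eq, Pi.add_apply, Pi.single_eq_same]
    have : rankPath a b (s + 1) l ≤ rankPath a b s' l := hmono hlt l
    omega
  have hh_le : h ≤ Q := by
    have := greedy_add_le (lexRank a b) s (s' - s) l
    rw [Nat.add_sub_cancel' (by omega : s ≤ s')] at this
    simp only [rankPath] at hh
    omega
  refine (hε hs.ne h hh_pos hh_le g).not_gt ?_
  have hle' := hs'.le
  have hlt' := hs'.lt_add
  rw [hh, hg, obsRank_add, obsRank_add] at hle' hlt'
  rw [abs_lt, Int.cast_natCast]
  constructor <;> linarith [hs.le, hs.lt_add]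

theorem exists_gap_cover (ha : ∀ k, 0 < a k) (hirr : ∀ i j, i ≠ j → Irrational (a i / a j))
    (Q : ℕ) : ∃ ε > 0, ∃ S : ι × ι → Set ℕ, (∀ i, IsSeparatedBy Q (S i)) ∧
      ∀ t, 1 ≤ t → ¬ HasGap a b ε t → ∃ i, t ∈ S i := by
  have hsep : ∀ᶠ ε : ℝ in 𝓝[>] 0, ∀ i j, i ≠ j → ∀ h : ℕ, 0 < h → h ≤ Q → ∀ g : ℤ,
      ε ≤ |g / a i - h / a j| :=
    nhdsWithin_le_nhds <| eventually_all.2 fun i => eventually_all.2 fun j =>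
      eventually_imp_distrib_left.2 fun hij => eventually_le_abs_div_sub_div (ha i) (hirr i j hij) Q
  have hsmall : ∀ᶠ ε : ℝ in 𝓝[>] 0, ∀ i, ε ≤ 1 / a i :=
    nhdsWithin_le_nhds <| eventually_all.2 fun i => eventually_le_nhds (one_div_pos.2 (ha i))
  obtain ⟨ε, hε_sep, hε_small, hε⟩ := (hsep.and (hsmall.and self_mem_nhdsWithin)).exists
  refine ⟨ε, hε, fun p => (· + 1) '' {s | IsNearMiss a b ε p.1 p.2 s},
    fun p => isSeparatedBy_isNearMiss (hε_sep p.1 p.2), fun t ht hgap => ?_⟩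
  obtain ⟨s, rfl⟩ := Nat.exists_eq_add_of_le' ht
  obtain ⟨k, l, hkl⟩ := exists_isNearMiss_of_not_hasGap ha hε_small hgap
  exact ⟨(k, l), s, hkl, rfl⟩

end Rank

section Rank

variable {ι : Type*} [Fintype ι] [LinearOrder ι] [Nonempty ι] {a b : ι → ℝ}

theorem exists_le_obsRank_rankPath (ha : ∀ k, 0 < a k) (hsum : ∑ k, a k = 1) :
    ∃ C : ℝ, ∀ t k, t ≤ obsRank a b k (rankPath a b t k) + C := by
  set D := ∑ k, |b k| / a k
  have hle_D : ∀ k, |b k| / a k ≤ D := fun k =>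
    Finset.single_le_sum (f := fun k => |b k| / a k)
      (fun l _ => div_nonneg (abs_nonneg _) (ha l).le) (Finset.mem_univ k)
  refine ⟨D + ∑ l, (1 + |b l|), fun t k => ?_⟩
  obtain ⟨r, hr⟩ : ∃ r, r = obsRank a b k (rankPath a b t k) := ⟨_, rfl⟩
  rw [← hr]
  have hr_nonneg : 0 ≤ r + D := by
    have hb : -(|b k| / a k) ≤ r := by
      rw [hr, obsRank, ← neg_div]
      refine div_le_div_of_nonneg_right ?_ (ha k).le
      linarith [neg_abs_le (b k), (rankPath a b t k).cast_nonneg (α := ℝ)]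
    linarith [hle_D k]
  have hcount : ∀ l, (rankPath a b t l : ℝ) ≤ a l * (r + D) + (1 + |b l|) := by
    intro l
    have hal := ha l
    rcases Nat.eq_zero_or_pos (rankPath a b t l) with h0 | hpos
    · rw [h0, Nat.cast_zero]; positivity
    · have hrank := obsRank_le_of_lt_rankPath ha (Nat.sub_lt hpos one_pos)
        (le_refl (rankPath a b t k))
      rw [← hr, obsRank, div_le_iff₀ hal, Nat.cast_pred hpos] at hrank
      have hD_nonneg : 0 ≤ D := (div_nonneg (abs_nonneg _) hal.le).trans (hle_D l)
      linarith [mul_nonneg hal.le hD_nonneg, neg_abs_le (b l)]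
  calc (t : ℝ) = ∑ l, (rankPath a b t l : ℝ) := by
        rw [← Nat.cast_sum, rankPath, (isDivisionPath_greedy _).sum_eq]
    _ ≤ ∑ l, (a l * (r + D) + (1 + |b l|)) := Finset.sum_le_sum fun l _ => hcount l
    _ = r + (D + ∑ l, (1 + |b l|)) := by
        rw [Finset.sum_add_distrib, ← Finset.sum_mul, hsum, one_mul, add_assoc]

theorem eventually_le_rankPath (ha : ∀ k, 0 < a k) (hsum : ∑ k, a k = 1) (R : ℝ) :
    ∀ᶠ t in atTop, ∀ k, R ≤ rankPath a b t k := by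
  obtain ⟨C, hC⟩ := exists_le_obsRank_rankPath (b := b) ha hsum
  refine eventually_all.2 fun k => ?_
  filter_upwards [tendsto_natCast_atTop_atTop.eventually_ge_atTop ((R + b k) / a k + C)] with t ht
  have hrank := ht.trans (hC t k)
  rwa [add_le_add_iff_right, obsRank, div_le_div_iff_of_pos_right (ha k),
    add_le_add_iff_right] at hrank

end Rank

/-! ### Posterior covariance matrices -/

section ShermanMorrison

open Matrix

theorem inv_add_smul_vecMulVec {ι F : Type*} [Fintype ι] [DecidableEq ι] [Field F]
    {A : Matrix ι ι F} (hA : IsUnit A.det) {u v : ι → F} {r : F} (hr : r ≠ 0)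
    (hruv : r + v ⬝ᵥ A⁻¹ *ᵥ u ≠ 0) :
    (A + r⁻¹ • vecMulVec u v)⁻¹ =
      A⁻¹ - (r + v ⬝ᵥ A⁻¹ *ᵥ u)⁻¹ • vecMulVec (A⁻¹ *ᵥ u) (v ᵥ* A⁻¹) := by
  refine inv_eq_right_inv ?_
  have hleft : A * vecMulVec (A⁻¹ *ᵥ u) (v ᵥ* A⁻¹) = vecMulVec u (v ᵥ* A⁻¹) := by
    rw [mul_vecMulVec, mulVec_mulVec, mul_nonsing_inv _ hA, one_mulVec]
  have hcoef : r⁻¹ - (r + v ⬝ᵥ A⁻¹ *ᵥ u)⁻¹ -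
      (r + v ⬝ᵥ A⁻¹ *ᵥ u)⁻¹ * r⁻¹ * (v ⬝ᵥ A⁻¹ *ᵥ u) = 0 := by
    generalize v ⬝ᵥ A⁻¹ *ᵥ u = s at hruv
    field_simp
    ring
  calc (A + r⁻¹ • vecMulVec u v) *
        (A⁻¹ - (r + v ⬝ᵥ A⁻¹ *ᵥ u)⁻¹ • vecMulVec (A⁻¹ *ᵥ u) (v ᵥ* A⁻¹))
      = 1 + (r⁻¹ - (r + v ⬝ᵥ A⁻¹ *ᵥ u)⁻¹ - (r + v ⬝ᵥ A⁻¹ *ᵥ u)⁻¹ * r⁻¹ * (v ⬝ᵥ A⁻¹ *ᵥ u)) •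
          vecMulVec u (v ᵥ* A⁻¹) := by
        rw [mul_sub, add_mul, mul_nonsing_inv _ hA, mul_smul_comm, add_mul, hleft, smul_mul_assoc,
          smul_mul_assoc, vecMulVec_mul, vecMulVec_mul_vecMulVec, vecMulVec_smul]
        module
    _ = 1 := by rw [hcoef, zero_smul, add_zero]

end ShermanMorrison

namespace Environment

open Matrix

variable {K : ℕ} (E : Environment K)

/-- The posterior precision matrix of the state after the division `q`. -/
def precision (q : Fin K → ℕ) : Matrix (Fin K) (Fin K) ℝ :=
  E.V⁻¹ + E.Cᵀ * diagonal (fun k => (q k : ℝ) / E.σ k ^ 2) * E.C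

/-- The posterior covariance matrix of the state after the division `q`. -/
def postCov (q : Fin K → ℕ) : Matrix (Fin K) (Fin K) ℝ := (E.precision q)⁻¹

theorem isUnit_det_V : IsUnit E.V.det := E.posDef_V.det_pos.ne'.isUnit

theorem posDef_precision (q : Fin K → ℕ) : (E.precision q).PosDef := by
  refine E.posDef_V.inv.add_posSemidef ?_
  have hdiag : (diagonal (fun k => (q k : ℝ) / E.σ k ^ 2)).PosSemidef :=
    PosSemidef.diagonal fun k => by positivity
  simpa using hdiag.conjTranspose_mul_mul_same E.C

theorem isUnit_det_precision (q : Fin K → ℕ) : IsUnit (E.precision q).det :=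
  (E.posDef_precision q).det_pos.ne'.isUnit

theorem precision_mul_postCov (q : Fin K → ℕ) : E.precision q * E.postCov q = 1 :=
  mul_nonsing_inv _ (E.isUnit_det_precision q)

theorem posDef_postCov (q : Fin K → ℕ) : (E.postCov q).PosDef := (E.posDef_precision q).inv

theorem transpose_postCov (q : Fin K → ℕ) : (E.postCov q)ᵀ = E.postCov q := by
  simpa using (E.posDef_postCov q).isHermitian.eq

theorem postCov_zero : E.postCov 0 = E.V := by
  have hprior : E.precision 0 = E.V⁻¹ := by simp [precision]
  rw [postCov, hprior, nonsing_inv_nonsing_inv _ E.isUnit_det_V]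

/-- The posterior covariance matrix of the noiseless signals `⟨c_k, θ⟩` after the division `q`. -/
def signalCov (q : Fin K → ℕ) : Matrix (Fin K) (Fin K) ℝ := E.C * E.postCov q * E.Cᵀ

theorem signalCov_apply (q : Fin K → ℕ) (j k : Fin K) :
    E.signalCov q j k = E.C j ⬝ᵥ E.postCov q *ᵥ E.C k :=
  mul_mul_apply _ _ _ _ _

theorem signalCov_self_nonneg (q : Fin K → ℕ) (j : Fin K) : 0 ≤ E.signalCov q j j := by
  rw [signalCov_apply]
  simpa using (E.posDef_postCov q).posSemidef.dotProduct_mulVec_nonneg (E.C j)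

/-- The predictive variance of the next observation of source `j` after the division `q`. -/
def obsVar (q : Fin K → ℕ) (j : Fin K) : ℝ := E.σ j ^ 2 + E.signalCov q j j

theorem obsVar_pos (q : Fin K → ℕ) (j : Fin K) : 0 < E.obsVar q j :=
  add_pos_of_pos_of_nonneg (pow_pos (E.σ_pos j) 2) (E.signalCov_self_nonneg q j)

theorem precision_add_single (q : Fin K → ℕ) (j : Fin K) :
    E.precision (q + Pi.single j 1) =
      E.precision q + (E.σ j ^ 2)⁻¹ • vecMulVec (E.C j) (E.C j) := by
  unfold precision
  rw [add_assoc]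
  congr 1
  ext a b
  simp only [Matrix.add_apply, Matrix.mul_apply (M := _ * _), Matrix.smul_apply, vecMulVec_apply,
    mul_diagonal, transpose_apply, Pi.add_apply, Nat.cast_add, add_div, mul_add, add_mul,
    Finset.sum_add_distrib, smul_eq_mul]
  congr 1
  rw [Finset.sum_eq_single j]
  · rw [Pi.single_eq_same, Nat.cast_one]; ring
  · intro k _ hk; simp [hk]
  · simp

theorem postCov_add_single (q : Fin K → ℕ) (j : Fin K) :
    E.postCov (q + Pi.single j 1) = E.postCov q - (E.obsVar q j)⁻¹ •
      vecMulVec (E.postCov q *ᵥ E.C j) (E.postCov q *ᵥ E.C j) := by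
  have hvar : E.σ j ^ 2 + E.C j ⬝ᵥ (E.precision q)⁻¹ *ᵥ E.C j = E.obsVar q j := by
    rw [obsVar, signalCov_apply, postCov]
  have hrow : E.C j ᵥ* (E.precision q)⁻¹ = E.postCov q *ᵥ E.C j := by
    rw [← mulVec_transpose, ← postCov, transpose_postCov]
  rw [postCov, precision_add_single, inv_add_smul_vecMulVec (E.isUnit_det_precision q)
    (pow_pos (E.σ_pos j) 2).ne' (hvar ▸ (E.obsVar_pos q j).ne'), hvar, hrow, postCov]

theorem postCov_mulVec_apply (q : Fin K → ℕ) (i j : Fin K) :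
    (E.postCov q *ᵥ E.C j) i = (E.C * E.postCov q) j i := by
  conv_lhs => rw [← E.transpose_postCov q, mulVec_transpose]
  rfl

variable [NeZero K]

/-- The posterior covariance of the payoff-relevant state with the signal of source `j`. -/
def loading (q : Fin K → ℕ) (j : Fin K) : ℝ := (E.C * E.postCov q) j 0

/-- The marginal value of source `j`: how much one more observation reduces the posterior variance
of the payoff-relevant state. -/
def marginal (q : Fin K → ℕ) (j : Fin K) : ℝ := E.loading q j ^ 2 / E.obsVar q j

theorem marginal_nonneg (q : Fin K → ℕ) (j : Fin K) : 0 ≤ E.marginal q j :=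
  div_nonneg (sq_nonneg _) (E.obsVar_pos q j).le

theorem postCov_add_single_zero_zero (q : Fin K → ℕ) (j : Fin K) :
    E.postCov (q + Pi.single j 1) 0 0 = E.postCov q 0 0 - E.marginal q j := by
  simp only [postCov_add_single, Matrix.sub_apply, Matrix.smul_apply, vecMulVec_apply, smul_eq_mul,
    postCov_mulVec_apply, marginal, loading]
  ring

theorem postCov_zero_zero_pos (q : Fin K → ℕ) : 0 < E.postCov q 0 0 :=
  (E.posDef_postCov q).diag_pos

theorem antitone_postCov_zero_zero : Antitone fun q => E.postCov q 0 0 := by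
  intro p q hpq
  obtain ⟨d, rfl⟩ := exists_add_of_le hpq
  clear hpq
  induction hn : ∑ k, d k generalizing d with
  | zero =>
    have hd : d = 0 := funext fun k => Finset.sum_eq_zero_iff.1 hn k (Finset.mem_univ k)
    simp [hd]
  | succ n ih =>
    obtain ⟨i, -, hi⟩ : ∃ i ∈ Finset.univ, 0 < d i :=
      Finset.exists_lt_of_sum_lt (by simp [hn] : ∑ _ : Fin K, 0 < ∑ k, d k)
    rw [eq_sub_single_add_single hi] at hn ⊢
    rw [sum_add_single, add_left_inj] at hn
    have hstep := E.postCov_add_single_zero_zero (p + (d - Pi.single i 1)) i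
    rw [add_assoc] at hstep
    have hih : E.postCov (p + (d - Pi.single i 1)) 0 0 ≤ E.postCov p 0 0 := ih _ hn
    have := E.marginal_nonneg (p + (d - Pi.single i 1)) i
    change E.postCov _ 0 0 ≤ _
    linarith

end Environment

/-! ### The linear system solved by the posterior covariances of the signals -/

namespace Environment

open Matrix

variable {K : ℕ} (E : Environment K)

/-- The prior precision matrix of the signals `⟨c_k, θ⟩`. -/
def signalPrecision : Matrix (Fin K) (Fin K) ℝ := E.C⁻¹ᵀ * E.V⁻¹ * E.C⁻¹

theorem posSemidef_signalPrecision : E.signalPrecision.PosSemidef := by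
  simpa [signalPrecision] using E.posDef_V.inv.posSemidef.conjTranspose_mul_mul_same E.C⁻¹

/-- The posterior precision matrix of the signals `⟨c_k, θ⟩` after the division `q`. -/
def postSignalPrecision (q : Fin K → ℕ) : Matrix (Fin K) (Fin K) ℝ :=
  diagonal (fun k => (q k : ℝ) / E.σ k ^ 2) + E.signalPrecision

variable {E}

theorem transpose_inv_mul_transpose_C (hC : IsUnit E.C) : E.C⁻¹ᵀ * E.Cᵀ = 1 := by
  rw [← transpose_mul, mul_nonsing_inv _ ((isUnit_iff_isUnit_det _).1 hC), transpose_one]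

theorem postSignalPrecision_mul (hC : IsUnit E.C) (q : Fin K → ℕ) :
    E.postSignalPrecision q * (E.C * E.postCov q) = E.C⁻¹ᵀ := by
  have hpull : E.postSignalPrecision q * E.C = E.C⁻¹ᵀ * E.precision q := by
    rw [precision, postSignalPrecision, signalPrecision, add_mul, mul_add,
      Matrix.mul_assoc _ E.C⁻¹, nonsing_inv_mul _ ((isUnit_iff_isUnit_det _).1 hC), Matrix.mul_one,
      ← Matrix.mul_assoc, ← Matrix.mul_assoc, transpose_inv_mul_transpose_C hC, Matrix.one_mul,
      add_comm]
  rw [← Matrix.mul_assoc, hpull, Matrix.mul_assoc, E.precision_mul_postCov, Matrix.mul_one]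

theorem postSignalPrecision_mul_signalCov (hC : IsUnit E.C) (q : Fin K → ℕ) :
    E.postSignalPrecision q * E.signalCov q = 1 := by
  rw [signalCov, ← Matrix.mul_assoc, postSignalPrecision_mul hC, transpose_inv_mul_transpose_C hC]

theorem postSignalPrecision_mulVec_col_signalCov (hC : IsUnit E.C) (q : Fin K → ℕ) (k : Fin K) :
    E.postSignalPrecision q *ᵥ (E.signalCov q).col k = Pi.single k 1 := by
  rw [← mulVec_single_one, mulVec_mulVec, postSignalPrecision_mul_signalCov hC, one_mulVec]

theorem postSignalPrecision_mulVec (q : Fin K → ℕ) (w : Fin K → ℝ) (k : Fin K) :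
    (E.postSignalPrecision q *ᵥ w) k =
      q k / E.σ k ^ 2 * w k + (E.signalPrecision *ᵥ w) k := by
  rw [postSignalPrecision, add_mulVec, Pi.add_apply, mulVec_diagonal]

variable [NeZero K]

theorem postSignalPrecision_mulVec_loading (hC : IsUnit E.C) (q : Fin K → ℕ) :
    E.postSignalPrecision q *ᵥ E.loading q = E.C⁻¹ 0 :=
  funext fun k => congrFun₂ (postSignalPrecision_mul hC q) k 0

theorem postCov_zero_zero_eq_dotProduct (hC : IsUnit E.C) (q : Fin K → ℕ) :
    E.postCov q 0 0 = E.C⁻¹ 0 ⬝ᵥ E.loading q := by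
  have hcancel : E.C⁻¹ * (E.C * E.postCov q) = E.postCov q := by
    rw [← Matrix.mul_assoc, nonsing_inv_mul _ ((isUnit_iff_isUnit_det _).1 hC), Matrix.one_mul]
  exact (congrFun₂ hcancel 0 0).symm

end Environment

/-! ### The joint law of the state and the errors -/

namespace Environment

open Matrix

section Marginals

variable {K : ℕ} (E : Environment K) (μ : EuclideanSpace ℝ (Fin K))

theorem map_fst_law : (E.law μ).map Prod.fst = multivariateGaussian μ E.V := by
  simp [law, Measure.map_fst_prod]

theorem map_snd_law : (E.law μ).map Prod.snd = Measure.infinitePi fun p : Fin K × ℕ =>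
    gaussianReal 0 (Real.toNNReal (E.σ p.1 ^ 2)) := by
  simp [law, Measure.map_snd_prod]

theorem map_error_law (p : Fin K × ℕ) :
    (E.law μ).map (fun ω => ω.2 p) = gaussianReal 0 (Real.toNNReal (E.σ p.1 ^ 2)) := by
  rw [← Measure.infinitePi_map_eval (fun p : Fin K × ℕ =>
    gaussianReal 0 (Real.toNNReal (E.σ p.1 ^ 2))) p, ← E.map_snd_law μ,
    Measure.map_map (by fun_prop) (by fun_prop)]
  rfl

theorem iIndepFun_error_law : iIndepFun (fun p (ω : Sample K) => ω.2 p) (E.law μ) := by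
  rw [iIndepFun_iff_map_fun_eq_infinitePi_map (by fun_prop)]
  simp_rw [map_error_law]
  exact E.map_snd_law μ

theorem hasGaussianLaw_state (i : Fin K) :
    HasGaussianLaw (fun ω : Sample K => ω.1 i) (E.law μ) := by
  have hstate : HasGaussianLaw (Prod.fst : Sample K → EuclideanSpace ℝ (Fin K)) (E.law μ) :=
    ⟨by rw [map_fst_law]; infer_instance⟩
  exact hstate.map_fun (EuclideanSpace.proj i)

theorem hasGaussianLaw_error (p : Fin K × ℕ) :
    HasGaussianLaw (fun ω : Sample K => ω.2 p) (E.law μ) :=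
  ⟨by rw [map_error_law]; infer_instance⟩

theorem integral_state (i : Fin K) : ∫ ω, ω.1 i ∂(E.law μ) = μ i := by
  have hcoord := (EuclideanSpace.proj i : EuclideanSpace ℝ (Fin K) →L[ℝ] ℝ).integral_comp_comm
    (IsGaussian.integrable_id (μ := multivariateGaussian μ E.V))
  simp only [id, integral_id_multivariateGaussian, PiLp.proj_apply] at hcoord
  rwa [← map_fst_law, integral_map (by fun_prop) (by fun_prop)] at hcoord

theorem integral_error (p : Fin K × ℕ) : ∫ ω, ω.2 p ∂(E.law μ) = 0 := by
  have hmean : ∫ x, x ∂((E.law μ).map (fun ω => ω.2 p)) = 0 := by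
    rw [map_error_law, integral_id_gaussianReal]
  rwa [integral_map (by fun_prop) (by fun_prop)] at hmean

theorem covariance_state (i j : Fin K) :
    cov[fun ω : Sample K => ω.1 i, fun ω => ω.1 j; E.law μ] = E.V i j := by
  rw [← covariance_eval_multivariateGaussian (μ := μ) E.posDef_V.posSemidef i j, ← map_fst_law,
    covariance_map_fun (Measurable.aestronglyMeasurable (by fun_prop))
      (Measurable.aestronglyMeasurable (by fun_prop)) (by fun_prop)]

theorem variance_error (p : Fin K × ℕ) :
    Var[fun ω : Sample K => ω.2 p; E.law μ] = E.σ p.1 ^ 2 := by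
  have hvar : Var[fun x => x; (E.law μ).map fun ω => ω.2 p] = E.σ p.1 ^ 2 := by
    rw [map_error_law, variance_fun_id_gaussianReal, Real.coe_toNNReal _ (sq_nonneg _)]
  rwa [variance_map (by fun_prop) (by fun_prop)] at hvar

theorem covariance_error (p r : Fin K × ℕ) :
    cov[fun ω : Sample K => ω.2 p, fun ω => ω.2 r; E.law μ] =
      if p = r then E.σ p.1 ^ 2 else 0 := by
  split_ifs with hpr
  · rw [← hpr, covariance_self (by fun_prop), variance_error]
  · exact ((E.iIndepFun_error_law μ).indepFun hpr).covariance_eq_zero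
      (E.hasGaussianLaw_error μ p).memLp_two (E.hasGaussianLaw_error μ r).memLp_two

theorem covariance_state_error (i : Fin K) (p : Fin K × ℕ) :
    cov[fun ω : Sample K => ω.1 i, fun ω => ω.2 p; E.law μ] = 0 := by
  have hindep : IndepFun (fun ω : Sample K => ω.1 i) (fun ω => ω.2 p) (E.law μ) :=
    indepFun_prod (X := fun x : EuclideanSpace ℝ (Fin K) => x i)
      (Y := fun e : Fin K × ℕ → ℝ => e p) (by fun_prop) (by fun_prop)
  exact hindep.covariance_eq_zero (E.hasGaussianLaw_state μ i).memLp_two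
    (E.hasGaussianLaw_error μ p).memLp_two

end Marginals

section LinearForms

variable {K : ℕ} {I : Type*} [Fintype I] {g : I → Fin K × ℕ}

/-- The linear form with coefficients `u` in the state vector and `η` in the errors with indices
`g p`. Signals and residuals are such forms. -/
def linForm (g : I → Fin K × ℕ) (u : Fin K → ℝ) (η : I → ℝ) (ω : Sample K) : ℝ :=
  ∑ i, u i * ω.1 i + ∑ p, η p * ω.2 (g p)

theorem measurable_linForm (u : Fin K → ℝ) (η : I → ℝ) : Measurable (linForm g u η) := by
  unfold linForm; fun_prop

variable (E : Environment K) (μ : EuclideanSpace ℝ (Fin K))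

theorem memLp_state_sum (u : Fin K → ℝ) :
    MemLp (fun ω : Sample K => ∑ i, u i * ω.1 i) 2 (E.law μ) :=
  memLp_finsetSum _ fun i _ => (E.hasGaussianLaw_state μ i).memLp_two.const_mul _

theorem memLp_error_sum (g : I → Fin K × ℕ) (η : I → ℝ) :
    MemLp (fun ω : Sample K => ∑ p, η p * ω.2 (g p)) 2 (E.law μ) :=
  memLp_finsetSum _ fun p _ => (E.hasGaussianLaw_error μ (g p)).memLp_two.const_mul _

theorem memLp_linForm (u : Fin K → ℝ) (η : I → ℝ) : MemLp (linForm g u η) 2 (E.law μ) :=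
  (E.memLp_state_sum μ u).add (E.memLp_error_sum μ g η)

theorem integral_linForm (u : Fin K → ℝ) (η : I → ℝ) :
    ∫ ω, linForm g u η ω ∂(E.law μ) = ∑ i, u i * μ i := by
  unfold linForm
  rw [integral_add ((E.memLp_state_sum μ u).integrable (by norm_num))
      ((E.memLp_error_sum μ g η).integrable (by norm_num)),
    integral_finsetSum _ fun i _ => (E.hasGaussianLaw_state μ i).integrable.const_mul _,
    integral_finsetSum _ fun p _ => (E.hasGaussianLaw_error μ (g p)).integrable.const_mul _]
  simp only [integral_const_mul, integral_state, integral_error, mul_zero, Finset.sum_const_zero,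
    add_zero]

theorem covariance_state_sum (u u' : Fin K → ℝ) :
    cov[fun ω : Sample K => ∑ i, u i * ω.1 i, fun ω => ∑ i, u' i * ω.1 i; E.law μ] =
      u ⬝ᵥ E.V *ᵥ u' := by
  have hmem i := (E.hasGaussianLaw_state μ i).memLp_two
  rw [covariance_fun_sum_fun_sum (fun i => (hmem i).const_mul _) fun i => (hmem i).const_mul _]
  simp only [covariance_const_mul_left, covariance_const_mul_right, covariance_state, dotProduct,
    mulVec, Finset.mul_sum]
  exact Finset.sum_congr rfl fun i _ => Finset.sum_congr rfl fun j _ => by ring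

theorem covariance_error_sum (hg : Function.Injective g) (η η' : I → ℝ) :
    cov[fun ω : Sample K => ∑ p, η p * ω.2 (g p), fun ω => ∑ p, η' p * ω.2 (g p); E.law μ] =
      ∑ p, η p * η' p * E.σ (g p).1 ^ 2 := by
  classical
  have hmem p := (E.hasGaussianLaw_error μ (g p)).memLp_two
  rw [covariance_fun_sum_fun_sum (fun p => (hmem p).const_mul _) fun p => (hmem p).const_mul _]
  simp only [covariance_const_mul_left, covariance_const_mul_right, covariance_error, hg.eq_iff]
  exact Finset.sum_congr rfl fun p _ => by simp [mul_left_comm, mul_assoc]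

theorem covariance_state_sum_error_sum (u : Fin K → ℝ) (η : I → ℝ) :
    cov[fun ω : Sample K => ∑ i, u i * ω.1 i, fun ω => ∑ p, η p * ω.2 (g p); E.law μ] = 0 := by
  rw [covariance_fun_sum_fun_sum (fun i => (E.hasGaussianLaw_state μ i).memLp_two.const_mul _)
    fun p => (E.hasGaussianLaw_error μ (g p)).memLp_two.const_mul _]
  simp [covariance_const_mul_left, covariance_const_mul_right, covariance_state_error]

theorem covariance_linForm (hg : Function.Injective g) (u u' : Fin K → ℝ) (η η' : I → ℝ) :
    cov[linForm g u η, linForm g u' η'; E.law μ] =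
      u ⬝ᵥ E.V *ᵥ u' + ∑ p, η p * η' p * E.σ (g p).1 ^ 2 := by
  have hS := E.memLp_state_sum μ
  have hN := E.memLp_error_sum μ g
  have hsplit (v : Fin K → ℝ) (ζ : I → ℝ) : linForm g v ζ =
      (fun ω : Sample K => ∑ i, v i * ω.1 i) + fun ω => ∑ p, ζ p * ω.2 (g p) := rfl
  rw [hsplit, hsplit, covariance_add_left (hS _) (hN _) ((hS _).add (hN _)),
    covariance_add_right (hS _) (hS _) (hN _), covariance_add_right (hN _) (hS _) (hN _),
    covariance_comm (fun ω : Sample K => ∑ p, η p * ω.2 (g p)), covariance_state_sum_error_sum,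
    covariance_state_sum_error_sum, covariance_state_sum, covariance_error_sum E μ hg, add_zero,
    zero_add]

theorem map_state_errors_law (hg : Function.Injective g) :
    (E.law μ).map (fun ω => (ω.1, fun p => ω.2 (g p))) =
      (multivariateGaussian μ E.V).prod
        (Measure.pi fun p => gaussianReal 0 (Real.toNNReal (E.σ (g p).1 ^ 2))) := by
  rw [← Measure.infinitePi_eq_pi,
    ← Measure.map_infinitePi_infinitePi_of_inj (P := fun p : Fin K × ℕ =>
      gaussianReal 0 (Real.toNNReal (E.σ p.1 ^ 2))) hg]
  conv_rhs => rw [← Measure.map_id (μ := multivariateGaussian μ E.V)]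
  rw [Measure.map_prod_map _ _ measurable_id (by fun_prop)]
  rfl

theorem isGaussian_pi_gaussianReal (m : I → ℝ) (v : I → NNReal) :
    IsGaussian (Measure.pi fun p => gaussianReal (m p) (v p)) := by
  have hcoord (p : I) : HasGaussianLaw (fun x : I → ℝ => x p)
      (Measure.pi fun p => gaussianReal (m p) (v p)) :=
    ⟨by rw [(measurePreserving_eval _ p).map_eq]; infer_instance⟩
  have hjoint := ((iIndepFun_pi (μ := fun p => gaussianReal (m p) (v p)) (X := fun _ x => x)
    fun _ => aemeasurable_id).hasGaussianLaw hcoord).isGaussian_map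
  rwa [Measure.map_id'] at hjoint

theorem hasGaussianLaw_state_errors {J : Type*} [Finite J] {g : J → Fin K × ℕ}
    (hg : Function.Injective g) :
    HasGaussianLaw (fun ω : Sample K => (ω.1, fun p => ω.2 (g p))) (E.law μ) := by
  have := Fintype.ofFinite J
  refine ⟨?_⟩
  have := isGaussian_pi_gaussianReal (0 : J → ℝ) fun p => Real.toNNReal (E.σ (g p).1 ^ 2)
  rw [map_state_errors_law E μ hg]
  infer_instance

theorem indepFun_linForm_of_covariance_eq_zero {κ : Type*} [Finite κ] (hg : Function.Injective g)
    {u : Fin K → ℝ} {η : I → ℝ} {u' : κ → Fin K → ℝ} {η' : κ → I → ℝ}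
    (hcov : ∀ j, cov[linForm g u η, linForm g (u' j) (η' j); E.law μ] = 0) :
    IndepFun (linForm g u η) (fun ω j => linForm g (u' j) (η' j) ω) (E.law μ) := by
  have := Fintype.ofFinite κ
  let F (u : Fin K → ℝ) (η : I → ℝ) : EuclideanSpace ℝ (Fin K) × (I → ℝ) →L[ℝ] ℝ :=
    (∑ i, u i • EuclideanSpace.proj i).comp (ContinuousLinearMap.fst ℝ _ _) +
      (∑ p, η p • ContinuousLinearMap.proj p).comp (ContinuousLinearMap.snd ℝ _ _)
  have hF (u : Fin K → ℝ) (η : I → ℝ) (ω : Sample K) :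
      F u η (ω.1, fun p => ω.2 (g p)) = linForm g u η ω := by simp [F, linForm]
  have hjoint := (E.hasGaussianLaw_state_errors μ hg).map_fun
    ((ContinuousLinearMap.pi fun _ : Unit => F u η).prod
      (ContinuousLinearMap.pi fun j => F (u' j) (η' j)))
  simp only [ContinuousLinearMap.prod_apply, ContinuousLinearMap.coe_pi', hF] at hjoint
  exact (hjoint.indepFun_of_covariance_eval fun _ => hcov).comp (measurable_pi_apply ())
    measurable_id

end LinearForms

end Environment

/-! ### The posterior variance -/

namespace Environment

open Matrix

variable {K : ℕ} (E : Environment K)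

/-- The observations entering a division `q`, as indices of errors. -/
def obsIndex (q : Fin K → ℕ) (p : Σ k, Fin (q k)) : Fin K × ℕ := (p.1, p.2)

theorem obsIndex_injective (q : Fin K → ℕ) : Function.Injective (obsIndex q) := by
  rintro ⟨k, n⟩ ⟨k', n'⟩ h
  obtain ⟨rfl, hn⟩ := Prod.mk.inj h
  exact congrArg (Sigma.mk k) (Fin.ext hn)

theorem signal_eq_linForm (q : Fin K → ℕ) (p : Σ k, Fin (q k)) :
    E.signal p.1 p.2 = linForm (obsIndex q) (E.C p.1) (Pi.single p 1) := by
  ext ω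
  simp [signal, linForm, obsIndex, Pi.single_apply]

variable [NeZero K]

/-- The weight of each observation of source `k` in the posterior mean of the payoff-relevant state
after the division `q`. -/
def gain (q : Fin K → ℕ) (k : Fin K) : ℝ := E.loading q k / E.σ k ^ 2

/-- The posterior mean of the payoff-relevant state after the division `q`, for the prior mean
`0`. -/
def postMean (q : Fin K → ℕ) (ω : Sample K) : ℝ :=
  ∑ p : Σ k, Fin (q k), E.gain q p.1 * E.signal p.1 p.2 ω

/-- The coefficients of the state vector in the payoff-relevant state minus its posterior mean. -/
def residualVec (q : Fin K → ℕ) : Fin K → ℝ := E.V⁻¹ *ᵥ (E.postCov q).col 0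

/-- The payoff-relevant state minus its posterior mean, as a linear form. -/
def residual (q : Fin K → ℕ) : Sample K → ℝ :=
  linForm (obsIndex q) (E.residualVec q) (fun p => -E.gain q p.1)

theorem residualVec_apply (q : Fin K → ℕ) (i : Fin K) :
    E.residualVec q i =
      (Pi.single 0 1 : Fin K → ℝ) i - ∑ k, (q k : ℝ) * E.gain q k * E.C k i := by
  have hprec := congrFun₂ (E.precision_mul_postCov q) i 0
  rw [precision, Matrix.add_mul, Matrix.add_apply, Matrix.mul_assoc, Matrix.mul_assoc,
    Matrix.one_apply] at hprec
  rw [Pi.single_apply, ← hprec, eq_sub_iff_add_eq]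
  refine congrArg (E.residualVec q i + ·) ?_
  rw [Matrix.mul_apply]
  refine Finset.sum_congr rfl fun k _ => ?_
  rw [diagonal_mul, transpose_apply, gain, loading]
  ring

theorem state_eq_residual_add_postMean (q : Fin K → ℕ) (ω : Sample K) :
    ω.1 0 = E.residual q ω + E.postMean q ω := by
  have hstate : ∑ i, E.residualVec q i * ω.1 i =
      ω.1 0 - ∑ p : Σ k, Fin (q k), E.gain q p.1 * ∑ i, E.C p.1 i * ω.1 i := by
    simp only [residualVec_apply, sub_mul, Finset.sum_sub_distrib, Fintype.sum_sigma,
      Finset.sum_const, Finset.card_univ, Fintype.card_fin, nsmul_eq_mul, Finset.sum_mul,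
      Finset.mul_sum]
    congr 1
    · simp [Pi.single_apply]
    · rw [Finset.sum_comm]
      exact Finset.sum_congr rfl fun k _ => Finset.sum_congr rfl fun i _ => by ring
  rw [residual, linForm, hstate]
  simp only [postMean, signal, obsIndex, mul_add, Finset.sum_add_distrib, neg_mul,
    Finset.sum_neg_distrib]
  ring

theorem residualVec_dotProduct_V_mulVec (q : Fin K → ℕ) (c : Fin K → ℝ) :
    E.residualVec q ⬝ᵥ E.V *ᵥ c = (E.postCov q *ᵥ c) 0 := by
  have hV : E.Vᵀ = E.V := by simpa using E.posDef_V.isHermitian.eq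
  rw [residualVec, dotProduct_mulVec, ← mulVec_transpose, hV, mulVec_mulVec,
    mul_nonsing_inv _ E.isUnit_det_V, one_mulVec]
  conv_rhs => rw [← E.transpose_postCov q]
  rfl

theorem covariance_residual_signal (q : Fin K → ℕ) (p : Σ k, Fin (q k)) :
    cov[E.residual q, E.signal p.1 p.2; E.law 0] = 0 := by
  rw [signal_eq_linForm, residual, E.covariance_linForm _ (obsIndex_injective q),
    residualVec_dotProduct_V_mulVec, postCov_mulVec_apply, ← loading]
  simp only [Pi.single_apply, mul_ite, mul_one, mul_zero, ite_mul, zero_mul, Finset.sum_ite_eq',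
    Finset.mem_univ, if_true, gain, obsIndex, neg_mul]
  rw [div_mul_cancel₀ _ (pow_pos (E.σ_pos p.1) 2).ne', add_neg_cancel]

theorem covariance_residual_state (q : Fin K → ℕ) :
    cov[E.residual q, fun ω : Sample K => ω.1 0; E.law 0] = E.postCov q 0 0 := by
  have hstate : (fun ω : Sample K => ω.1 0) = linForm (obsIndex q) (Pi.single 0 1) 0 := by
    ext ω; simp [linForm, Pi.single_apply]
  rw [hstate, residual, E.covariance_linForm _ (obsIndex_injective q),
    residualVec_dotProduct_V_mulVec]
  simp

theorem indepFun_residual (q : Fin K → ℕ) :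
    IndepFun (E.residual q) (fun ω (p : Σ k, Fin (q k)) => E.signal p.1 p.2 ω) (E.law 0) := by
  simp only [signal_eq_linForm]
  refine E.indepFun_linForm_of_covariance_eq_zero 0 (obsIndex_injective q) fun p => ?_
  rw [← signal_eq_linForm]
  exact E.covariance_residual_signal q p

theorem measurable_residual (q : Fin K → ℕ) : Measurable (E.residual q) := measurable_linForm _ _

theorem memLp_residual (q : Fin K → ℕ) : MemLp (E.residual q) 2 (E.law 0) :=
  E.memLp_linForm 0 _ _

theorem integral_residual (q : Fin K → ℕ) : ∫ ω, E.residual q ω ∂(E.law 0) = 0 := by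
  unfold residual
  simp [integral_linForm]

theorem memLp_gain_mul_signal (q : Fin K → ℕ) (p : Σ k, Fin (q k)) :
    MemLp (fun ω => E.gain q p.1 * E.signal p.1 p.2 ω) 2 (E.law 0) := by
  rw [signal_eq_linForm]
  exact (E.memLp_linForm 0 _ _).const_mul _

theorem memLp_postMean (q : Fin K → ℕ) : MemLp (E.postMean q) 2 (E.law 0) :=
  memLp_finsetSum _ fun p _ => E.memLp_gain_mul_signal q p

theorem stronglyMeasurable_postMean (q : Fin K → ℕ) :
    StronglyMeasurable[E.obsAlgebra q] (E.postMean q) := by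
  have hobs : Measurable[E.obsAlgebra q]
      (fun ω (p : Σ k, Fin (q k)) => E.signal p.1 p.2 ω) := comap_measurable _
  have hsum : Measurable (fun x : (Σ k, Fin (q k)) → ℝ => ∑ p, E.gain q p.1 * x p) := by fun_prop
  exact (hsum.comp hobs).stronglyMeasurable

theorem condExp_state_ae_eq_postMean (q : Fin K → ℕ) :
    (E.law 0)[fun ω : Sample K => ω.1 0 | E.obsAlgebra q] =ᵐ[E.law 0] E.postMean q := by
  have hm := E.obsAlgebra_le q
  have hmean_int := (E.memLp_postMean q).integrable (by norm_num)
  have hsum := condExp_add ((E.memLp_residual q).integrable (by norm_num)) hmean_int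
    (E.obsAlgebra q)
  have hresidual := condExp_indep_eq (E.measurable_residual q).comap_le hm
    (comap_measurable (E.residual q)).stronglyMeasurable (E.indepFun_residual q)
  have hmean := condExp_of_stronglyMeasurable hm (E.stronglyMeasurable_postMean q) hmean_int
  rw [show (fun ω : Sample K => ω.1 0) = E.residual q + E.postMean q from
    funext (E.state_eq_residual_add_postMean q)]
  filter_upwards [hsum, hresidual] with ω hω hω'
  rw [hω, Pi.add_apply, hω', hmean, E.integral_residual, zero_add]

theorem posteriorVariance_eq_variance_residual (q : Fin K → ℕ) :
    E.posteriorVariance q = Var[E.residual q; E.law 0] := by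
  rw [posteriorVariance, posteriorVarianceAt, condVar, integral_condExp (E.obsAlgebra_le q),
    variance_of_integral_eq_zero (E.measurable_residual q).aemeasurable (E.integral_residual q)]
  refine integral_congr_ae ?_
  filter_upwards [E.condExp_state_ae_eq_postMean q] with ω hω
  simp only [Pi.pow_apply, Pi.sub_apply]
  rw [hω, E.state_eq_residual_add_postMean q, add_sub_cancel_right]

theorem posteriorVariance_eq (q : Fin K → ℕ) : E.posteriorVariance q = E.postCov q 0 0 := by
  have hmean : cov[E.residual q, E.postMean q; E.law 0] = 0 := by
    unfold postMean
    rw [covariance_fun_sum_right (E.memLp_gain_mul_signal q) (E.memLp_residual q)]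
    simp [covariance_const_mul_right, covariance_residual_signal]
  have hstate : (fun ω : Sample K => ω.1 0) = E.residual q + E.postMean q :=
    funext (E.state_eq_residual_add_postMean q)
  rw [posteriorVariance_eq_variance_residual, ← covariance_residual_state, hstate,
    covariance_add_right (E.memLp_residual q) (E.memLp_residual q) (E.memLp_postMean q), hmean,
    add_zero, covariance_self (E.measurable_residual q).aemeasurable]

end Environment

/-! ### Strictly positive marginal values -/

namespace Environment

variable {K : ℕ} [NeZero K] (E : Environment K)

theorem extPosteriorVariance_le {p : Fin K → ℕ} {q : Fin K → ℕ∞} (h : ∀ k, (p k : ℕ∞) ≤ q k) :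
    E.extPosteriorVariance q ≤ E.postCov p 0 0 := by
  rw [← posteriorVariance_eq]
  refine ciInf_le ⟨0, ?_⟩ (⟨p, h⟩ : {p : Fin K → ℕ // ∀ k, (p k : ℕ∞) ≤ q k})
  rintro _ ⟨r, rfl⟩
  simpa only [posteriorVariance_eq] using (E.postCov_zero_zero_pos r.1).le

theorem exists_postCov_lt {q : Fin K → ℕ∞} {c : ℝ} (h : E.extPosteriorVariance q < c) :
    ∃ p : Fin K → ℕ, (∀ k, (p k : ℕ∞) ≤ q k) ∧ E.postCov p 0 0 < c := by
  have : Nonempty {p : Fin K → ℕ // ∀ k, (p k : ℕ∞) ≤ q k} := ⟨⟨0, fun k => by simp⟩⟩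
  obtain ⟨p, hp⟩ := exists_lt_of_ciInf_lt h
  exact ⟨p.1, p.2, E.posteriorVariance_eq p.1 ▸ hp⟩

end Environment

theorem exists_le_of_natCast_le_iSup {u : ℕ → ℕ} {m : ℕ} (h : (m : ℕ∞) ≤ ⨆ n, (u n : ℕ∞)) :
    ∃ n, m ≤ u n := by
  by_contra! hlt
  have hm : 0 < m := (Nat.zero_le _).trans_lt (hlt 0)
  have hsup : ⨆ n, (u n : ℕ∞) ≤ ((m - 1 : ℕ) : ℕ∞) :=
    iSup_le fun n => Nat.cast_le.2 (Nat.le_sub_one_of_lt (hlt n))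
  have := Nat.cast_le.1 (h.trans hsup)
  omega

theorem exists_le_add_single_of_le_update_iSup {ι : Type*} [Finite ι] [DecidableEq ι]
    {u : ℕ → ι → ℕ} (hmono : Monotone u) {p : ι → ℕ} {j : ι} {m : ℕ} (hj : ∀ n, u n j = m)
    (hp : ∀ k, (p k : ℕ∞) ≤ Function.update (fun k => ⨆ n, (u n k : ℕ∞)) j (m + 1) k) :
    ∃ N, ∀ n ≥ N, p ≤ u n + Pi.single j 1 := by
  have hcoord (k : ι) : ∃ n, p k ≤ (u n + Pi.single j 1 : ι → ℕ) k := by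
    have hpk := hp k
    rcases eq_or_ne k j with rfl | hk
    · rw [Function.update_self] at hpk
      exact ⟨0, by simpa [hj] using (by exact_mod_cast hpk : p k ≤ m + 1)⟩
    · rw [Function.update_of_ne hk] at hpk
      obtain ⟨n, hn⟩ := exists_le_of_natCast_le_iSup hpk
      exact ⟨n, by simpa [Pi.single_eq_of_ne hk] using hn⟩
  choose N hN using hcoord
  obtain ⟨M, hM⟩ := Finite.exists_le N
  exact ⟨M, fun n hn k => (hN k).trans (add_le_add (hmono ((hM k).trans hn) k) le_rfl)⟩

namespace Environment.PositiveMarginalValue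

variable {K : ℕ} [NeZero K] {E : Environment K}

-- Otherwise some divisions with marginal values tending to `0` increase to a division with possibly
-- infinite entries, at which source `j` has no marginal value.
theorem exists_le_marginal_of_eq (h : E.PositiveMarginalValue) (j : Fin K) (m : ℕ) :
    ∃ δ > 0, ∀ q : Fin K → ℕ, q j = m → δ ≤ E.marginal q j := by
  by_contra! hsmall
  choose Q hQj hQ using fun n : ℕ => hsmall (1 / ((n : ℝ) + 1)) (by positivity)
  obtain ⟨g, hg⟩ := (wellQuasiOrdered_le (α := Fin K → ℕ)).exists_monotone_subseq Q
  have hmono : Monotone (Q ∘ g) := fun m n hmn => hg m n hmn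
  set L : Fin K → ℕ∞ := fun k => ⨆ n, (Q (g n) k : ℕ∞) with hL
  have hLj : L j = m := by simp [hL, hQj]
  obtain ⟨p, hpL, hp⟩ := E.exists_postCov_lt (h L j (by rw [hLj]; exact ENat.natCast_ne_top m))
  obtain ⟨N, hN⟩ := exists_le_add_single_of_le_update_iSup hmono (fun n => hQj (g n))
    (by rwa [hLj] at hpL)
  obtain ⟨n₀, hn₀⟩ := exists_nat_one_div_lt (sub_pos.2 hp)
  set n := max n₀ N
  have hlower : E.postCov (Q (g n) + Pi.single j 1) 0 0 ≤ E.postCov p 0 0 :=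
    E.antitone_postCov_zero_zero (hN n (le_max_right _ _))
  have hupper : E.extPosteriorVariance L ≤ E.postCov (Q (g n)) 0 0 :=
    E.extPosteriorVariance_le fun k => le_iSup (fun n => (Q (g n) k : ℕ∞)) n
  have hn : 1 / ((g n : ℝ) + 1) ≤ 1 / ((n₀ : ℝ) + 1) := by
    have : n₀ ≤ g n := (le_max_left _ _).trans g.strictMono.le_apply
    gcongr
  rw [postCov_add_single_zero_zero] at hlower
  linarith [hQ (g n)]

theorem exists_le_marginal_of_le (h : E.PositiveMarginalValue) (B : ℕ) :
    ∃ δ > 0, ∀ (q : Fin K → ℕ) (j : Fin K), q j ≤ B → δ ≤ E.marginal q j := by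
  choose δ hδpos hδ using fun x : Fin K × Fin (B + 1) => h.exists_le_marginal_of_eq x.1 x.2
  obtain ⟨x, hx⟩ := Finite.exists_min δ
  exact ⟨δ x, hδpos x, fun q j hq => (hx _).trans (hδ (j, ⟨q j, by omega⟩) q rfl)⟩

theorem loading_ne_zero (h : E.PositiveMarginalValue) (q : Fin K → ℕ) (j : Fin K) :
    E.loading q j ≠ 0 := by
  obtain ⟨δ, hδ, hmarginal⟩ := h.exists_le_marginal_of_le (q j)
  intro hzero
  have := hmarginal q j le_rfl
  simp only [marginal, hzero, ne_eq, OfNat.ofNat_ne_zero, not_false_eq_true, zero_pow,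
    zero_div] at this
  linarith

end Environment.PositiveMarginalValue

/-! ### Bounds on marginal values -/

open Matrix in
theorem abs_mulVec_le {m n : Type*} [Fintype n] (A : Matrix m n ℝ) {w : n → ℝ} {b : ℝ}
    (h : ∀ l, |w l| ≤ b) (k : m) : |(A *ᵥ w) k| ≤ (∑ l, |A k l|) * b := by
  rw [mulVec, dotProduct, Finset.sum_mul]
  refine (Finset.abs_sum_le_sum_abs _ _).trans (Finset.sum_le_sum fun l _ => ?_)
  rw [abs_mul]
  exact mul_le_mul_of_nonneg_left (h l) (abs_nonneg _)

open Matrix in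
theorem mul_sq_le_diagonal_add_mulVec_dotProduct {ι : Type*} [Fintype ι] [DecidableEq ι]
    {P : Matrix ι ι ℝ} (hP : P.PosSemidef) {d : ι → ℝ} (hd : 0 ≤ d) (w : ι → ℝ) (k : ι) :
    d k * w k ^ 2 ≤ ((diagonal d + P) *ᵥ w) ⬝ᵥ w := by
  have hdiag : diagonal d *ᵥ w ⬝ᵥ w = ∑ l, d l * w l ^ 2 :=
    Finset.sum_congr rfl fun l _ => by rw [mulVec_diagonal]; ring
  have hsingle : d k * w k ^ 2 ≤ ∑ l, d l * w l ^ 2 :=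
    Finset.single_le_sum (f := fun l => d l * w l ^ 2)
      (fun l _ => mul_nonneg (hd l) (sq_nonneg _)) (Finset.mem_univ k)
  have hnonneg : 0 ≤ (P *ᵥ w) ⬝ᵥ w := by
    simpa only [dotProduct_comm, star_trivial] using hP.dotProduct_mulVec_nonneg w
  rw [add_mulVec, add_dotProduct, hdiag]
  linarith

open Matrix in
theorem abs_le_sum_abs_diagonal_add_mulVec_div {ι : Type*} [Fintype ι] [DecidableEq ι]
    {P : Matrix ι ι ℝ} (hP : P.PosSemidef) {d : ι → ℝ} {y : ℝ} (hy : 0 < y) (hd : ∀ k, y ≤ d k)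
    (w : ι → ℝ) (k : ι) : |w k| ≤ (∑ l, |((diagonal d + P) *ᵥ w) l|) / y := by
  set v := (diagonal d + P) *ᵥ w
  have : Nonempty ι := ⟨k⟩
  obtain ⟨m, hm⟩ := Finite.exists_max fun l => |w l|
  refine (hm k).trans ?_
  rw [le_div_iff₀ hy]
  rcases (abs_nonneg (w m)).eq_or_lt with hzero | hwm
  · rw [← hzero, zero_mul]
    exact Finset.sum_nonneg fun _ _ => abs_nonneg _
  have hupper : v ⬝ᵥ w ≤ (∑ l, |v l|) * |w m| := by
    rw [dotProduct, Finset.sum_mul]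
    refine Finset.sum_le_sum fun l _ => (le_abs_self _).trans ?_
    rw [abs_mul]
    exact mul_le_mul_of_nonneg_left (hm l) (abs_nonneg _)
  refine le_of_mul_le_mul_right ?_ hwm
  calc |w m| * y * |w m| = y * w m ^ 2 := by rw [← sq_abs (w m)]; ring
    _ ≤ d m * w m ^ 2 := by gcongr; exact hd m
    _ ≤ v ⬝ᵥ w := mul_sq_le_diagonal_add_mulVec_dotProduct hP (fun l => hy.le.trans (hd l)) w m
    _ ≤ (∑ l, |v l|) * |w m| := hupper

theorem lt_of_mul_sq_le {p p' F x y z : ℝ} (hF : 0 < F) (hx : 0 ≤ x) (hx' : x < 1) (hy : 0 < y)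
    (hp : p * z ^ 2 ≤ F ^ 2 * (1 + x) ^ 2) (hp' : F ^ 2 * (1 - x) ^ 2 ≤ p' * (y ^ 2 * (1 + x)))
    (hyz : (1 + x) ^ 2 * y < (1 - x) * z) : p < p' := by
  have hz : 0 < z := by
    have : 0 < (1 - x) * z := hyz.trans' (by positivity)
    exact pos_of_mul_pos_right this (sub_nonneg.2 hx'.le)
  have hsq : (1 + x) ^ 2 * (y ^ 2 * (1 + x)) < (1 - x) ^ 2 * z ^ 2 :=
    calc (1 + x) ^ 2 * (y ^ 2 * (1 + x)) = y ^ 2 * (1 + x) ^ 3 := by ring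
      _ ≤ y ^ 2 * (1 + x) ^ 4 := by gcongr <;> linarith
      _ = ((1 + x) ^ 2 * y) ^ 2 := by ring
      _ < ((1 - x) * z) ^ 2 := by gcongr
      _ = (1 - x) ^ 2 * z ^ 2 := by ring
  calc p ≤ F ^ 2 * (1 + x) ^ 2 / z ^ 2 := (le_div_iff₀ (by positivity)).2 hp
    _ < F ^ 2 * (1 - x) ^ 2 / (y ^ 2 * (1 + x)) := by
      rw [div_lt_div_iff₀ (by positivity) (by positivity), mul_assoc, mul_assoc]
      gcongr
    _ ≤ p' := (div_le_iff₀ (by positivity)).2 hp'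

namespace Environment

open Matrix

variable {K : ℕ} {E : Environment K}

/-- The relative correction of the variance of an observation of source `k`. -/
def varCorr (E : Environment K) (q : Fin K → ℕ) (k : Fin K) : ℝ :=
  E.signalCov q k k / E.σ k ^ 2

theorem varCorr_nonneg (q : Fin K → ℕ) (k : Fin K) : 0 ≤ E.varCorr q k :=
  div_nonneg (E.signalCov_self_nonneg q k) (sq_nonneg _)

theorem obsVar_eq_mul (q : Fin K → ℕ) (k : Fin K) :
    E.obsVar q k = E.σ k ^ 2 * (1 + E.varCorr q k) := by
  have := E.σ_pos k
  rw [obsVar, varCorr]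
  field_simp

variable [NeZero K]

/-- The normalizing constant of the limiting frequencies. -/
def freqScale (E : Environment K) : ℝ := ∑ j, |E.C⁻¹ 0 j| * E.σ j

/-- The relative correction of the loading of source `k`, see `count_mul_loading`. -/
def loadingCorr (E : Environment K) (q : Fin K → ℕ) (k : Fin K) : ℝ :=
  (E.signalPrecision *ᵥ E.loading q) k / E.C⁻¹ 0 k

namespace NonRedundant

theorem freqScale_pos (hE : E.NonRedundant) : 0 < E.freqScale :=
  Finset.sum_pos (fun k _ => mul_pos (abs_pos.2 (hE.2 k)) (E.σ_pos k)) Finset.univ_nonempty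

theorem freq_mul_freqScale (hE : E.NonRedundant) (k : Fin K) :
    E.freq k * E.freqScale = |E.C⁻¹ 0 k| * E.σ k :=
  div_mul_cancel₀ _ hE.freqScale_pos.ne'

theorem freq_pos (hE : E.NonRedundant) (k : Fin K) : 0 < E.freq k :=
  div_pos (mul_pos (abs_pos.2 (hE.2 k)) (E.σ_pos k)) hE.freqScale_pos

theorem sum_freq (hE : E.NonRedundant) : ∑ k, E.freq k = 1 :=
  (Finset.sum_div ..).symm.trans (div_self hE.freqScale_pos.ne')

theorem freq_le_one (hE : E.NonRedundant) (k : Fin K) : E.freq k ≤ 1 :=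
  (Finset.single_le_sum (fun l _ => (hE.freq_pos l).le) (Finset.mem_univ k)).trans_eq hE.sum_freq

theorem count_mul_marginal_le (hE : E.NonRedundant) (q : Fin K → ℕ) (k : Fin K) :
    q k * E.marginal q k ≤ E.postCov 0 0 0 := by
  have hσ := E.σ_pos k
  have hloading : q k / E.σ k ^ 2 * E.loading q k ^ 2 ≤ E.postCov q 0 0 := by
    rw [postCov_zero_zero_eq_dotProduct hE.1, ← postSignalPrecision_mulVec_loading hE.1 q]
    exact mul_sq_le_diagonal_add_mulVec_dotProduct (d := fun l => q l / E.σ l ^ 2)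
      E.posSemidef_signalPrecision (fun l => by positivity) (E.loading q) k
  calc q k * E.marginal q k ≤ q k * (E.loading q k ^ 2 / E.σ k ^ 2) := by
        rw [marginal]
        gcongr
        exact le_add_of_nonneg_right (E.signalCov_self_nonneg q k)
    _ = q k / E.σ k ^ 2 * E.loading q k ^ 2 := by ring
    _ ≤ E.postCov q 0 0 := hloading
    _ ≤ E.postCov 0 0 0 := E.antitone_postCov_zero_zero zero_le

theorem count_mul_loading (hE : E.NonRedundant) (q : Fin K → ℕ) (k : Fin K) :
    q k * E.loading q k = E.σ k ^ 2 * E.C⁻¹ 0 k * (1 - E.loadingCorr q k) := by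
  have hσ := E.σ_pos k
  have hcoef := hE.2 k
  have hsystem := congrFun (postSignalPrecision_mulVec_loading hE.1 q) k
  rw [postSignalPrecision_mulVec] at hsystem
  rw [loadingCorr]
  field_simp at hsystem ⊢
  linear_combination hsystem

theorem marginal_mul (hE : E.NonRedundant) (q : Fin K → ℕ) (k : Fin K) :
    E.marginal q k * ((q k / E.freq k) ^ 2 * (1 + E.varCorr q k)) =
      E.freqScale ^ 2 * (1 - E.loadingCorr q k) ^ 2 := by
  have hσ := E.σ_pos k
  have hfreq := hE.freq_pos k
  have hvar : 0 < 1 + E.varCorr q k := by linarith [E.varCorr_nonneg q k]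
  calc E.marginal q k * ((q k / E.freq k) ^ 2 * (1 + E.varCorr q k))
      = (q k * E.loading q k) ^ 2 / (E.freq k ^ 2 * E.σ k ^ 2) := by
        rw [marginal, obsVar_eq_mul]
        field_simp
    _ = (|E.C⁻¹ 0 k| * E.σ k) ^ 2 * (1 - E.loadingCorr q k) ^ 2 / E.freq k ^ 2 := by
        rw [hE.count_mul_loading, mul_pow |_|, sq_abs]
        field_simp
    _ = E.freqScale ^ 2 * (1 - E.loadingCorr q k) ^ 2 := by
        rw [← hE.freq_mul_freqScale]
        field_simp

theorem exists_abs_le_mul_sum_abs_div (hE : E.NonRedundant) :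
    ∃ A, ∀ (q : Fin K → ℕ) (y : ℝ), 0 < y → (∀ k, y ≤ q k / E.freq k) → ∀ (w : Fin K → ℝ) k,
      |w k| ≤ A * (∑ l, |(E.postSignalPrecision q *ᵥ w) l|) / y := by
  obtain ⟨m, hm⟩ := Finite.exists_min fun l => E.freq l / E.σ l ^ 2
  set c := E.freq m / E.σ m ^ 2
  have hc : 0 < c := div_pos (hE.freq_pos m) (pow_pos (E.σ_pos m) 2)
  refine ⟨c⁻¹, fun q y hy hq w k => ?_⟩
  have hlevel (l : Fin K) : c * y ≤ q l / E.σ l ^ 2 := by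
    have hql := (le_div_iff₀ (hE.freq_pos l)).1 (hq l)
    calc c * y ≤ E.freq l / E.σ l ^ 2 * y := by gcongr; exact hm l
      _ = y * E.freq l / E.σ l ^ 2 := by ring
      _ ≤ q l / E.σ l ^ 2 := by gcongr
  refine (abs_le_sum_abs_diagonal_add_mulVec_div E.posSemidef_signalPrecision (mul_pos hc hy)
    hlevel w k).trans_eq ?_
  rw [postSignalPrecision]
  field_simp

theorem exists_abs_loadingCorr_le (hE : E.NonRedundant) (k : Fin K) :
    ∃ A, ∀ (q : Fin K → ℕ) (y : ℝ), 0 < y → (∀ k, y ≤ q k / E.freq k) →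
      |E.loadingCorr q k| ≤ A / y := by
  obtain ⟨A, hA⟩ := hE.exists_abs_le_mul_sum_abs_div
  refine ⟨(∑ l, |E.signalPrecision k l|) * (A * ∑ l, |E.C⁻¹ 0 l|) / |E.C⁻¹ 0 k|,
    fun q y hy hq => ?_⟩
  have hloading := hA q y hy hq (E.loading q)
  rw [postSignalPrecision_mulVec_loading hE.1] at hloading
  rw [loadingCorr, abs_div, div_right_comm, mul_div_assoc]
  gcongr
  exact abs_mulVec_le _ hloading k

theorem exists_abs_signalCov_le (hE : E.NonRedundant) :
    ∃ A, ∀ (q : Fin K → ℕ) (y : ℝ), 0 < y → (∀ k, y ≤ q k / E.freq k) → ∀ k l,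
      |E.signalCov q k l| ≤ A / y := by
  obtain ⟨A, hA⟩ := hE.exists_abs_le_mul_sum_abs_div
  refine ⟨A, fun q y hy hq k l => ?_⟩
  have hcov := hA q y hy hq ((E.signalCov q).col l) k
  simpa [postSignalPrecision_mulVec_col_signalCov hE.1, Pi.single_apply, apply_ite abs] using hcov

theorem exists_varCorr_le (hE : E.NonRedundant) (k : Fin K) :
    ∃ A, ∀ (q : Fin K → ℕ) (y : ℝ), 0 < y → (∀ k, y ≤ q k / E.freq k) →
      E.varCorr q k ≤ A / y := by
  obtain ⟨A, hA⟩ := hE.exists_abs_signalCov_le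
  refine ⟨A / E.σ k ^ 2, fun q y hy hq => ?_⟩
  rw [varCorr, div_right_comm]
  gcongr
  exact (le_abs_self _).trans (hA q y hy hq k k)

theorem marginal_mul_sq_le (hE : E.NonRedundant) {q : Fin K → ℕ} {k : Fin K} {x : ℝ}
    (hx : |E.loadingCorr q k| ≤ x) :
    E.marginal q k * (q k / E.freq k) ^ 2 ≤ E.freqScale ^ 2 * (1 + x) ^ 2 := by
  obtain ⟨hlower, hupper⟩ := abs_le.1 hx
  calc E.marginal q k * (q k / E.freq k) ^ 2
      ≤ E.marginal q k * ((q k / E.freq k) ^ 2 * (1 + E.varCorr q k)) := by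
        have := E.varCorr_nonneg q k
        have := E.marginal_nonneg q k
        gcongr
        exact le_mul_of_one_le_right (sq_nonneg _) (by linarith)
    _ = E.freqScale ^ 2 * (1 - E.loadingCorr q k) ^ 2 := hE.marginal_mul q k
    _ ≤ E.freqScale ^ 2 * (1 + x) ^ 2 := by
        have : (1 - E.loadingCorr q k) ^ 2 ≤ (1 + x) ^ 2 := by
          apply sq_le_sq' <;> linarith
        gcongr

theorem le_marginal_mul_sq (hE : E.NonRedundant) {q : Fin K → ℕ} {k : Fin K} {x : ℝ}
    (hx : |E.loadingCorr q k| ≤ x) (hvar : E.varCorr q k ≤ x) (hx' : x ≤ 1) :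
    E.freqScale ^ 2 * (1 - x) ^ 2 ≤ E.marginal q k * ((q k / E.freq k) ^ 2 * (1 + x)) :=
  calc E.freqScale ^ 2 * (1 - x) ^ 2 ≤ E.freqScale ^ 2 * (1 - E.loadingCorr q k) ^ 2 := by
        have := (abs_le.1 hx).2
        have : 0 ≤ 1 - x := sub_nonneg.2 hx'
        gcongr
    _ = E.marginal q k * ((q k / E.freq k) ^ 2 * (1 + E.varCorr q k)) :=
        (hE.marginal_mul q k).symm
    _ ≤ E.marginal q k * ((q k / E.freq k) ^ 2 * (1 + x)) := by
        have := E.marginal_nonneg q k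
        gcongr

theorem exists_corr_le (hE : E.NonRedundant) :
    ∃ A > 0, ∀ (q : Fin K → ℕ) (y : ℝ), 0 < y → (∀ k, y ≤ q k / E.freq k) → ∀ k,
      |E.loadingCorr q k| ≤ A / y ∧ E.varCorr q k ≤ A / y := by
  choose A₁ hA₁ using hE.exists_abs_loadingCorr_le
  choose A₂ hA₂ using hE.exists_varCorr_le
  obtain ⟨A, hA⟩ := Finite.exists_le fun k => max (A₁ k) (A₂ k)
  refine ⟨max A 1, by positivity, fun q y hy hq k => ?_⟩
  obtain ⟨hle₁, hle₂⟩ := max_le_iff.1 ((hA k).trans (le_max_left A 1))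
  exact ⟨(hA₁ k q y hy hq).trans (by gcongr), (hA₂ k q y hy hq).trans (by gcongr)⟩

theorem exists_marginal_lt_of_add_le (hE : E.NonRedundant) :
    ∃ M > 0, ∀ C : ℝ, ∃ Y > 0, ∀ (q : Fin K → ℕ) (i j : Fin K),
      (∀ k, q j / E.freq j - C ≤ q k / E.freq k) → Y ≤ q j / E.freq j →
      q j / E.freq j + M ≤ q i / E.freq i → E.marginal q i < E.marginal q j := by
  obtain ⟨A, hA, hcorr⟩ := hE.exists_corr_le
  refine ⟨16 * A + 1, by positivity, fun C => ⟨4 * A + 2 * |C| + 1, by positivity,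
    fun q i j hq hY hij => ?_⟩⟩
  set y := (q j : ℝ) / E.freq j
  have hy : 0 < y := hY.trans_lt' (by positivity)
  have hlevel (k : Fin K) : y / 2 ≤ q k / E.freq k := by
    linarith [hq k, le_abs_self C]
  set x := A / (y / 2) with hx
  have hxy : x * y = 2 * A := by rw [hx]; field_simp
  have hx0 : 0 < x := by positivity
  have hx1 : x ≤ 1 / 2 := by
    rw [hx, div_le_iff₀ (by positivity)]
    linarith [abs_nonneg C]
  obtain ⟨hloading, hvar⟩ := hcorr q (y / 2) (by positivity) hlevel j
  refine lt_of_mul_sq_le hE.freqScale_pos hx0.le (by linarith) hy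
    (hE.marginal_mul_sq_le (hcorr q (y / 2) (by positivity) hlevel i).1)
    (hE.le_marginal_mul_sq hloading hvar (by linarith)) ?_
  have hz : (1 - x) * (y + (16 * A + 1)) ≤ (1 - x) * (q i / E.freq i) :=
    mul_le_mul_of_nonneg_left hij (by linarith)
  nlinarith

end NonRedundant

end Environment

/-! ### Marginal values near balanced divisions -/

namespace Environment

open Matrix

variable {K : ℕ} [NeZero K] {E : Environment K}

/-- The limit of the loading correction of source `k` times the level of the division, as divisions
stay near the balanced ones and their level tends to infinity. -/
def corrLimit (E : Environment K) (k : Fin K) : ℝ :=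
  (E.signalPrecision *ᵥ fun l => E.σ l ^ 2 * E.C⁻¹ 0 l / E.freq l) k / E.C⁻¹ 0 k

/-- The offset of the ranks of the observations of source `k`, chosen so that the marginal value
at a count `m` is nearly proportional to `obsRank E.freq E.offset k m ^ (-2)`. -/
def offset (E : Environment K) (k : Fin K) : ℝ := 1 / 2 + E.freq k * E.corrLimit k

/-- The filter on pairs of a division `q` and a level `y` expressing that every normalized count
`q k / E.freq k` stays within `M` of `y` while `y` tends to infinity. -/
def balanced (E : Environment K) (M : ℝ) : Filter ((Fin K → ℕ) × ℝ) :=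
  comap Prod.snd atTop ⊓ 𝓟 {x | ∀ k, |x.1 k / E.freq k - x.2| ≤ M}

/-- The reciprocal of the marginal value of source `k`, multiplied by the square of the normalizing
constant of the limiting frequencies. -/
def invMarginal (E : Environment K) (q : Fin K → ℕ) (k : Fin K) : ℝ :=
  (q k / E.freq k) ^ 2 * (1 + E.varCorr q k) / (1 - E.loadingCorr q k) ^ 2

theorem tendsto_level (M : ℝ) : Tendsto Prod.snd (E.balanced M) atTop :=
  tendsto_comap.mono_left inf_le_left

theorem eventually_balanced (M : ℝ) :
    ∀ᶠ x in E.balanced M, ∀ k, |x.1 k / E.freq k - x.2| ≤ M :=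
  mem_inf_of_right (mem_principal_self _)

theorem tendsto_const_div_level (M c : ℝ) : Tendsto (fun x => c / x.2) (E.balanced M) (𝓝 0) :=
  tendsto_const_nhds.div_atTop (tendsto_level M)

theorem tendsto_ratio (M : ℝ) (k : Fin K) :
    Tendsto (fun x => x.1 k / E.freq k / x.2) (E.balanced M) (𝓝 1) := by
  have h : Tendsto (fun x => x.1 k / E.freq k / x.2 - 1) (E.balanced M) (𝓝 0) := by
    refine squeeze_zero_norm' ?_ (tendsto_const_div_level M M)
    filter_upwards [eventually_balanced M, (tendsto_level M).eventually_gt_atTop 0] with x hx hx0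
    rw [Real.norm_eq_abs, div_sub_one hx0.ne', abs_div, abs_of_pos hx0]
    gcongr
    exact hx k
  simpa using h.add_const 1

theorem tendsto_ratio_inv (M : ℝ) (k : Fin K) :
    Tendsto (fun x => (x.1 k / E.freq k / x.2)⁻¹) (E.balanced M) (𝓝 1) := by
  simpa using (tendsto_ratio (E := E) M k).inv₀ one_ne_zero

theorem tendsto_obsRank_div_level (M : ℝ) (k : Fin K) :
    Tendsto (fun x => obsRank E.freq E.offset k (x.1 k) / x.2) (E.balanced M) (𝓝 1) := by
  have h := (tendsto_ratio (E := E) M k).add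
    (tendsto_const_div_level (E := E) M (E.offset k / E.freq k))
  rw [add_zero] at h
  refine h.congr fun x => ?_
  rw [obsRank]
  ring

theorem tendsto_zero_of_abs_le_div_level {f : (Fin K → ℕ) → ℝ}
    (h : ∃ A, ∀ (q : Fin K → ℕ) (y : ℝ), 0 < y → (∀ k, y ≤ q k / E.freq k) → |f q| ≤ A / y)
    (M : ℝ) : Tendsto (fun x => f x.1) (E.balanced M) (𝓝 0) := by
  obtain ⟨A, hA⟩ := h
  refine squeeze_zero_norm' ?_ (tendsto_const_div_level M (2 * A))
  filter_upwards [eventually_balanced M, (tendsto_level M).eventually_gt_atTop (2 * |M|)]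
    with x hx hlevel
  have hx0 : 0 < x.2 := hlevel.trans_le' (by positivity)
  refine (hA x.1 (x.2 / 2) (by positivity) fun k => ?_).trans_eq (by field_simp)
  linarith [(abs_le.1 (hx k)).1, le_abs_self M]

namespace NonRedundant

theorem tendsto_loadingCorr (hE : E.NonRedundant) (M : ℝ) (k : Fin K) :
    Tendsto (fun x => E.loadingCorr x.1 k) (E.balanced M) (𝓝 0) :=
  tendsto_zero_of_abs_le_div_level (hE.exists_abs_loadingCorr_le k) M

theorem tendsto_signalCov (hE : E.NonRedundant) (M : ℝ) (k l : Fin K) :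
    Tendsto (fun x => E.signalCov x.1 k l) (E.balanced M) (𝓝 0) := by
  obtain ⟨A, hA⟩ := hE.exists_abs_signalCov_le
  exact tendsto_zero_of_abs_le_div_level ⟨A, fun q y hy hq => hA q y hy hq k l⟩ M

theorem eventually_count_pos (hE : E.NonRedundant) (M : ℝ) (k : Fin K) :
    ∀ᶠ x in E.balanced M, (0 : ℝ) < x.1 k := by
  filter_upwards [eventually_balanced M, (tendsto_level M).eventually_gt_atTop M] with x hx hlevel
  refine (div_pos_iff_of_pos_right (hE.freq_pos k)).1 ?_
  linarith [(abs_le.1 (hx k)).1]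

theorem tendsto_level_mul_loading (hE : E.NonRedundant) (M : ℝ) (k : Fin K) :
    Tendsto (fun x => x.2 * E.loading x.1 k) (E.balanced M)
      (𝓝 (E.σ k ^ 2 * E.C⁻¹ 0 k / E.freq k)) := by
  have h := (tendsto_ratio_inv (E := E) M k).mul
    (((hE.tendsto_loadingCorr M k).const_sub 1).const_mul (E.σ k ^ 2 * E.C⁻¹ 0 k / E.freq k))
  rw [sub_zero, mul_one, one_mul] at h
  refine h.congr' ?_
  filter_upwards [hE.eventually_count_pos M k, (tendsto_level M).eventually_gt_atTop 0]
    with x hcount hx0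
  have := hE.freq_pos k
  rw [div_mul_eq_mul_div, ← hE.count_mul_loading x.1 k]
  field_simp

theorem tendsto_level_mul_loadingCorr (hE : E.NonRedundant) (M : ℝ) (k : Fin K) :
    Tendsto (fun x => x.2 * E.loadingCorr x.1 k) (E.balanced M) (𝓝 (E.corrLimit k)) := by
  have h : Tendsto (fun x => (∑ l, E.signalPrecision k l * (x.2 * E.loading x.1 l)) / E.C⁻¹ 0 k)
      (E.balanced M) (𝓝 (E.corrLimit k)) :=
    (tendsto_finsetSum _ fun l _ => (hE.tendsto_level_mul_loading M l).const_mul _).div_const _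
  refine h.congr fun x => ?_
  rw [loadingCorr, mulVec, dotProduct, mul_div_assoc', Finset.mul_sum]
  congr 1
  exact Finset.sum_congr rfl fun l _ => by ring

theorem tendsto_level_mul_varCorr (hE : E.NonRedundant) (M : ℝ) (k : Fin K) :
    Tendsto (fun x => x.2 * E.varCorr x.1 k) (E.balanced M) (𝓝 (1 / E.freq k)) := by
  have hrest : Tendsto (fun x => (E.signalPrecision *ᵥ (E.signalCov x.1).col k) k)
      (E.balanced M) (𝓝 0) := by
    have h := tendsto_finsetSum Finset.univ fun l _ =>
      (hE.tendsto_signalCov M l k).const_mul (E.signalPrecision k l)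
    simpa only [mul_zero, Finset.sum_const_zero, mulVec, dotProduct, col_apply] using h
  have h := (tendsto_ratio_inv (E := E) M k).mul ((hrest.const_sub 1).const_mul (1 / E.freq k))
  rw [sub_zero, mul_one, one_mul] at h
  refine h.congr' ?_
  filter_upwards [hE.eventually_count_pos M k, (tendsto_level M).eventually_gt_atTop 0]
    with x hcount hx0
  have hvar := congrFun (postSignalPrecision_mulVec_col_signalCov hE.1 x.1 k) k
  rw [postSignalPrecision_mulVec, Pi.single_eq_same, ← eq_sub_iff_add_eq] at hvar
  have hfreq := hE.freq_pos k
  have hσ := E.σ_pos k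
  rw [← hvar, varCorr, col_apply]
  field_simp

-- The offsets are chosen to cancel the terms of first order in the level.
theorem tendsto_invMarginal_sub (hE : E.NonRedundant) (M : ℝ) (k : Fin K) :
    Tendsto (fun x => (E.invMarginal x.1 k - obsRank E.freq E.offset k (x.1 k) ^ 2) / x.2)
      (E.balanced M) (𝓝 0) := by
  have hfreq := hE.freq_pos k
  set b := E.offset k / E.freq k with hb
  have hb' : b = 1 / 2 * (1 / E.freq k) + E.corrLimit k := by
    rw [hb, offset]
    field_simp
  have hratio := tendsto_ratio (E := E) M k
  have hcorr := hE.tendsto_loadingCorr M k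
  have hlevelCorr := hE.tendsto_level_mul_loadingCorr M k
  have hfirst := ((hE.tendsto_level_mul_varCorr M k).add (hlevelCorr.const_mul 2)).sub
    (hlevelCorr.mul hcorr) |>.div ((hcorr.const_sub 1).pow 2) (by norm_num)
  have hlim := (((hratio.pow 2).mul hfirst).sub (hratio.const_mul (2 * b))).sub
    (tendsto_const_div_level (E := E) M (b ^ 2))
  have hzero : (1 : ℝ) ^ 2 *
      ((1 / E.freq k + 2 * E.corrLimit k - E.corrLimit k * 0) / (1 - 0) ^ 2) -
      2 * b * 1 - 0 = 0 := by
    rw [hb']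
    ring
  rw [hzero] at hlim
  refine hlim.congr' ?_
  filter_upwards [(tendsto_level M).eventually_gt_atTop 0,
    hcorr.eventually (eventually_ne_nhds zero_ne_one)] with x hx0 hne
  have hne' : 1 - E.loadingCorr x.1 k ≠ 0 := sub_ne_zero.2 hne.symm
  have hrank : obsRank E.freq E.offset k (x.1 k) = x.1 k / E.freq k + b := add_div _ _ _
  rw [hrank, invMarginal, Pi.div_apply]
  field_simp
  ring

theorem eventually_invMarginal_lt (hE : E.NonRedundant) (M : ℝ) {ε : ℝ} (hε : 0 < ε) :
    ∀ᶠ x in E.balanced M, ∀ i j,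
      obsRank E.freq E.offset j (x.1 j) + ε ≤ obsRank E.freq E.offset i (x.1 i) →
      E.invMarginal x.1 j < E.invMarginal x.1 i := by
  have hrank : ∀ᶠ x in E.balanced M, ∀ k, 1 / 2 < obsRank E.freq E.offset k (x.1 k) / x.2 :=
    eventually_all.2 fun k =>
      (tendsto_obsRank_div_level (E := E) M k).eventually (lt_mem_nhds (by norm_num))
  have hinv : ∀ᶠ x in E.balanced M, ∀ k, |(E.invMarginal x.1 k -
      obsRank E.freq E.offset k (x.1 k) ^ 2) / x.2| < ε / 4 :=
    eventually_all.2 fun k => by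
      have habs := (hE.tendsto_invMarginal_sub M k).abs
      rw [abs_zero] at habs
      exact habs.eventually (gt_mem_nhds (by positivity))
  filter_upwards [hrank, hinv, (tendsto_level M).eventually_gt_atTop 0]
    with x hrank hinv hx0 i j hij
  have hinv_i := (lt_div_iff₀ hx0).1 (abs_lt.1 (hinv i)).1
  have hinv_j := (div_lt_iff₀ hx0).1 (abs_lt.1 (hinv j)).2
  have hrank_i := (lt_div_iff₀ hx0).1 (hrank i)
  have hrank_j := (lt_div_iff₀ hx0).1 (hrank j)
  nlinarith

theorem marginal_eq_div_invMarginal (hE : E.NonRedundant) {q : Fin K → ℕ} {k : Fin K}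
    (hq : (0 : ℝ) < q k) (hcorr : E.loadingCorr q k ≠ 1) :
    0 < E.invMarginal q k ∧ E.marginal q k = E.freqScale ^ 2 / E.invMarginal q k := by
  have hfreq := hE.freq_pos k
  have hvar := E.varCorr_nonneg q k
  have hne : 1 - E.loadingCorr q k ≠ 0 := sub_ne_zero.2 hcorr.symm
  have hpos : 0 < E.invMarginal q k := by
    unfold invMarginal
    positivity
  refine ⟨hpos, (eq_div_iff hpos.ne').2 ?_⟩
  rw [invMarginal, mul_div_assoc', hE.marginal_mul]
  exact mul_div_cancel_right₀ _ (pow_ne_zero 2 hne)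

theorem eventually_marginal_lt (hE : E.NonRedundant) (M : ℝ) {ε : ℝ} (hε : 0 < ε) :
    ∀ᶠ x in E.balanced M, ∀ i j,
      obsRank E.freq E.offset j (x.1 j) + ε ≤ obsRank E.freq E.offset i (x.1 i) →
      E.marginal x.1 i < E.marginal x.1 j := by
  have hcorr : ∀ᶠ x in E.balanced M, ∀ k, E.loadingCorr x.1 k ≠ 1 :=
    eventually_all.2 fun k =>
      (hE.tendsto_loadingCorr M k).eventually (eventually_ne_nhds zero_ne_one)
  filter_upwards [hE.eventually_invMarginal_lt M hε, hcorr,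
    eventually_all.2 (hE.eventually_count_pos M)] with x hinv hcorr hcount i j hij
  obtain ⟨-, hmarginal_i⟩ := hE.marginal_eq_div_invMarginal (hcount i) (hcorr i)
  obtain ⟨hpos, hmarginal_j⟩ := hE.marginal_eq_div_invMarginal (hcount j) (hcorr j)
  rw [hmarginal_i, hmarginal_j]
  exact div_lt_div_of_pos_left (pow_pos hE.freqScale_pos 2) hpos (hinv i j hij)

theorem exists_marginal_lt_of_obsRank_add_le (hE : E.NonRedundant) (M : ℝ) {ε : ℝ} (hε : 0 < ε) :
    ∃ Y, ∀ (q : Fin K → ℕ) (y : ℝ), Y ≤ y → (∀ k, |q k / E.freq k - y| ≤ M) →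
      ∀ i j, obsRank E.freq E.offset j (q j) + ε ≤ obsRank E.freq E.offset i (q i) →
      E.marginal q i < E.marginal q j := by
  have h := hE.eventually_marginal_lt M hε
  rw [balanced, eventually_inf_principal, eventually_comap] at h
  obtain ⟨Y, hY⟩ := eventually_atTop.1 h
  exact ⟨Y, fun q y hy hq => hY y hy (q, y) rfl hq⟩

end NonRedundant

end Environment

/-! ### Optimal divisions at good times -/

section Ranks

variable {ι : Type*} {a b : ι → ℝ}

theorem exists_abs_obsRank_sub_div_le [Finite ι] (a b : ι → ℝ) :
    ∃ D, ∀ k m, |obsRank a b k m - m / a k| ≤ D := by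
  obtain ⟨D, hD⟩ := Finite.exists_le fun k => |b k / a k|
  refine ⟨D, fun k m => ?_⟩
  rw [obsRank, add_div, add_sub_cancel_left]
  exact hD k

theorem exists_obsRank_sub_le_of_sum_le [Fintype ι] (ha : ∀ k, 0 < a k) (hsum : ∑ k, a k = 1)
    (W : ℝ) : ∃ L, ∀ (q : ι → ℕ) (r : ℝ), (∀ k, r ≤ obsRank a b k (q k)) → ∑ k, (q k : ℝ) ≤ r + W →
      ∀ k, obsRank a b k (q k) - r ≤ L := by
  obtain ⟨L, hL⟩ := Finite.exists_le fun k => (W + ∑ l, b l) / a k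
  refine ⟨L, fun q r hr hq k => le_trans ?_ (hL k)⟩
  have hmul (l : ι) : a l * (obsRank a b l (q l) - r) = q l + b l - a l * r := by
    rw [mul_sub, obsRank, mul_div_cancel₀ _ (ha l).ne']
  rw [le_div_iff₀' (ha k)]
  calc a k * (obsRank a b k (q k) - r) ≤ ∑ l, a l * (obsRank a b l (q l) - r) :=
        Finset.single_le_sum (f := fun l => a l * (obsRank a b l (q l) - r))
          (fun l _ => mul_nonneg (ha l).le (sub_nonneg.2 (hr l))) (Finset.mem_univ k)
    _ = ∑ l, (q l : ℝ) + ∑ l, b l - r := by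
        simp only [hmul, Finset.sum_sub_distrib, Finset.sum_add_distrib, ← Finset.sum_mul, hsum,
          one_mul]
    _ ≤ W + ∑ l, b l := by linarith

end Ranks

namespace Environment.NonRedundant

variable {K : ℕ} [NeZero K] {E : Environment K}

theorem exists_marginal_lt_of_le (hE : E.NonRedundant) (hpos : E.PositiveMarginalValue) (B : ℕ) :
    ∃ R : ℝ, ∀ (q : Fin K → ℕ) (i j : Fin K), q j ≤ B → R ≤ q i →
      E.marginal q i < E.marginal q j := by
  obtain ⟨δ, hδ, hmarginal⟩ := hpos.exists_le_marginal_of_le B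
  refine ⟨E.postCov 0 0 0 / δ + 1, fun q i j hj hi => (hmarginal q j hj).trans_lt' ?_⟩
  have hlt : E.postCov 0 0 0 / δ < q i := by linarith
  have hqi : (0 : ℝ) < q i := hlt.trans' (div_pos (E.postCov_zero_zero_pos 0) hδ)
  refine lt_of_mul_lt_mul_left ?_ hqi.le
  exact (hE.count_mul_marginal_le q i).trans_lt ((div_lt_iff₀ hδ).1 hlt)

theorem exists_marginal_lt_of_minimal_obsRank (hE : E.NonRedundant)
    (hpos : E.PositiveMarginalValue) {ε : ℝ} (hε : 0 < ε) (W : ℝ) :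
    ∃ R : ℝ, ∀ (q : Fin K → ℕ) (i j : Fin K),
      (∀ k, obsRank E.freq E.offset j (q j) ≤ obsRank E.freq E.offset k (q k)) →
      obsRank E.freq E.offset j (q j) + ε ≤ obsRank E.freq E.offset i (q i) →
      ∑ k, (q k : ℝ) ≤ obsRank E.freq E.offset i (q i) + W → R ≤ q i →
      E.marginal q i < E.marginal q j := by
  obtain ⟨D, hD⟩ := exists_abs_obsRank_sub_div_le E.freq E.offset
  obtain ⟨M, -, hM⟩ := hE.exists_marginal_lt_of_add_le
  obtain ⟨Y₁, -, hfar⟩ := hM (2 * D)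
  obtain ⟨L, hL⟩ := exists_obsRank_sub_le_of_sum_le (b := E.offset) hE.freq_pos hE.sum_freq
    (M + 2 * D + W)
  obtain ⟨Y₂, hnear⟩ := hE.exists_marginal_lt_of_obsRank_add_le (max L 0 + 2 * D) hε
  obtain ⟨R, hrare⟩ := hE.exists_marginal_lt_of_le hpos ⌈max Y₁ Y₂⌉₊
  refine ⟨R, fun q i j hmin hji hsum hR => ?_⟩
  have hD' (k : Fin K) := abs_le.1 (hD k (q k))
  rcases le_or_gt (q j) ⌈max Y₁ Y₂⌉₊ with hj | hj
  · exact hrare q i j hj hR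
  have hY : max Y₁ Y₂ ≤ q j / E.freq j :=
    (Nat.lt_of_ceil_lt hj).le.trans (le_div_self (Nat.cast_nonneg _) (hE.freq_pos j)
      (hE.freq_le_one j))
  rcases le_or_gt (q j / E.freq j + M) (q i / E.freq i) with hij | hij
  · refine hfar q i j (fun k => ?_) ((le_max_left _ _).trans hY) hij
    linarith [hmin k, (hD' j).1, (hD' k).2]
  · refine hnear q _ ((le_max_right _ _).trans hY) (fun k => ?_) i j hji
    have hrank := hL q _ hmin (by linarith [(hD' j).1, (hD' i).2]) k
    rw [abs_le]
    constructor <;>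
      linarith [hmin k, (hD' j).1, (hD' j).2, (hD' k).1, (hD' k).2, le_max_left L 0,
        le_max_right L 0]

theorem exists_isGoodTime_rankPath (hE : E.NonRedundant) (hpos : E.PositiveMarginalValue) {ε : ℝ}
    (hε : 0 < ε) (B : ℕ) : ∃ T, ∀ t ≥ T, HasGap E.freq E.offset ε t →
      IsGoodTime (rankPath E.freq E.offset) (fun q => E.postCov q 0 0) B t := by
  obtain ⟨C, hC⟩ := exists_le_obsRank_rankPath (b := E.offset) hE.freq_pos hE.sum_freq
  obtain ⟨R, hR⟩ := hE.exists_marginal_lt_of_minimal_obsRank hpos hε (C + B)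
  obtain ⟨T, hT⟩ := eventually_atTop.1
    (eventually_le_rankPath (b := E.offset) hE.freq_pos hE.sum_freq R)
  refine ⟨T, fun t ht hgap => isGoodTime_greedy (lexRank_strictMono hE.freq_pos)
    (lexRank_injective _ _) fun q i hq hi hj => ?_⟩
  have hsum : ∑ k, (q k : ℝ) ≤ t + B := by exact_mod_cast hq.le
  have hrank : obsRank E.freq E.offset i (rankPath E.freq E.offset t i) ≤
      obsRank E.freq E.offset i (q i) := (obsRank_strictMono hE.freq_pos i).monotone hi
  simp only [postCov_add_single_zero_zero]
  refine sub_lt_sub_left (hR q i _ (fun k => obsRank_le_of_lexRank_le (minScore_le _ q k))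
    (hgap i _ _ _ hi hj) (by linarith [hC t i]) ((hT t ht i).trans ?_)) _
  exact_mod_cast hi

theorem isTOptimal_iff_of_isGoodTime {B t : ℕ} {g : ℕ → Fin K → ℕ} (hg : IsDivisionPath g)
    (ht : IsGoodTime g (fun q => E.postCov q 0 0) B t) (q : Fin K → ℕ) :
    E.IsTOptimal t q ↔ q = g t := by
  have hlt {p : Fin K → ℕ} (hp : ∑ k, p k = t) (hne : p ≠ g t) :
      E.posteriorVariance (g t) < E.posteriorVariance p := by
    simpa only [posteriorVariance_eq] using ht.path_lt hg hp hne
  constructor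
  · rintro ⟨hq, hmin⟩
    by_contra hne
    exact (hlt hq hne).not_ge (hmin _ (hg.sum_eq t))
  · rintro rfl
    refine ⟨hg.sum_eq t, fun p hp => ?_⟩
    rcases eq_or_ne p (g t) with rfl | hne
    exacts [le_rfl, (hlt hp hne).le]

theorem exists_isReduction (hE : E.NonRedundant) (hpos : E.PositiveMarginalValue)
    (hirr : ∀ i j : Fin K, i ≠ j → Irrational (E.freq i / E.freq j)) :
    ∃ (A : Set ℕ) (n : ℕ → Fin K → ℕ) (G : ℕ → (Fin K → ℕ) → Fin K → ℕ),
      HasNaturalDensity A 1 ∧ (∀ t ∈ A, ∀ q : Fin K → ℕ, E.IsTOptimal t q ↔ q = n t) ∧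
      IsReduction (fun q => E.postCov q 0 0) G ∧ ∀ t ∈ A, ∀ q, G t q = n t := by
  set g := rankPath E.freq E.offset
  have hg : IsDivisionPath g := isDivisionPath_greedy _
  set B := Fintype.card (Fin K × Fin K) + 1
  obtain ⟨A, hdensity, hzero, hne, hA, hgap⟩ := exists_hasNaturalDensity_one_of_cover
    (ι := Fin K × Fin K) (P := IsGoodTime g (fun q => E.postCov q 0 0) B) fun Q => by
      obtain ⟨ε, hε, S, hS, hcover⟩ := exists_gap_cover (b := E.offset) hE.freq_pos hirr Q
      obtain ⟨T, hT⟩ := hE.exists_isGoodTime_rankPath hpos hε B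
      exact ⟨max 1 T, S, hS, fun t ht hbad => hcover t ((le_max_left _ _).trans ht)
        fun hgap => hbad (hT t ((le_max_right _ _).trans ht) hgap)⟩
  have hgood : ∀ t ∈ A, IsGoodTime g (fun q => E.postCov q 0 0) B t := fun t ht => by
    rcases Nat.eq_zero_or_pos t with rfl | htpos
    exacts [hg.isGoodTime_zero, hA t ht htpos]
  obtain ⟨G, hG, hGA⟩ := hg.exists_isReduction hgood hzero hne hgap
  exact ⟨A, g, G, hdensity, fun t ht => isTOptimal_iff_of_isGoodTime hg (hgood t ht), hG, hGA⟩

end Environment.NonRedundant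

/-! ### Centred Gaussian measures -/

section CenteredGaussian

variable {E F : Type*} [NormedAddCommGroup E] [NormedSpace ℝ E] [MeasurableSpace E]
  [NormedAddCommGroup F] [NormedSpace ℝ F] [MeasurableSpace F]

/-- `P` is the centred Gaussian measure under which the variance of every continuous linear form
`L` is `v L`. The variance is a parameter, so that laws are identified by comparing variances. -/
def IsCenteredGaussian (P : Measure E) (v : StrongDual ℝ E → ℝ) : Prop :=
  ∀ L, charFunDual P L = Complex.exp (-(v L / 2 : ℝ))

theorem isCenteredGaussian_gaussianReal {v : ℝ} (hv : 0 ≤ v) :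
    IsCenteredGaussian (gaussianReal 0 v.toNNReal) fun L => v * L 1 ^ 2 := by
  intro L
  have hL : InnerProductSpace.toDualMap ℝ ℝ (L 1) = L := by ext; simp
  rw [← hL, ← charFun_eq_charFunDual_toDualMap, charFun_gaussianReal, Real.coe_toNNReal _ hv, hL]
  congr 1
  push_cast
  ring

open scoped Matrix in
theorem isCenteredGaussian_multivariateGaussian {ι : Type*} [Fintype ι] [DecidableEq ι]
    {S : Matrix ι ι ℝ} (hS : S.PosSemidef) :
    IsCenteredGaussian (multivariateGaussian 0 S) fun L =>
      (fun i => L (EuclideanSpace.single i 1)) ⬝ᵥ S *ᵥ fun i => L (EuclideanSpace.single i 1) := by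
  intro L
  obtain ⟨u, rfl⟩ := (InnerProductSpace.toDual ℝ (EuclideanSpace ℝ ι)).surjective L
  have hu : (fun i => InnerProductSpace.toDual ℝ _ u (EuclideanSpace.single i 1)) = u.ofLp := by
    ext i
    simp [EuclideanSpace.inner_single_right]
  beta_reduce
  rw [hu]
  change charFunDual _ (InnerProductSpace.toDualMap ℝ _ u) = _
  rw [← charFun_eq_charFunDual_toDualMap, charFun_multivariateGaussian hS]
  simp

theorem IsCenteredGaussian.prod {P : Measure E} {Q : Measure F} [SFinite P] [SFinite Q]
    {v : StrongDual ℝ E → ℝ} {w : StrongDual ℝ F → ℝ} (hP : IsCenteredGaussian P v)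
    (hQ : IsCenteredGaussian Q w) :
    IsCenteredGaussian (P.prod Q) fun L =>
      v (L.comp (ContinuousLinearMap.inl ℝ E F)) + w (L.comp (ContinuousLinearMap.inr ℝ E F)) := by
  intro L
  rw [charFunDual_prod, hP, hQ, ← Complex.exp_add]
  congr 1
  push_cast
  ring

theorem IsCenteredGaussian.measurePreserving [BorelSpace E] [BorelSpace F]
    [SecondCountableTopology F] [CompleteSpace F]
    {P : Measure E} {Q : Measure F} [IsFiniteMeasure P] [IsFiniteMeasure Q]
    {v : StrongDual ℝ E → ℝ} {w : StrongDual ℝ F → ℝ} (hP : IsCenteredGaussian P v)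
    (hQ : IsCenteredGaussian Q w) (T : E →L[ℝ] F) (h : ∀ L : StrongDual ℝ F, v (L.comp T) = w L) :
    MeasurePreserving T P Q := by
  refine ⟨T.continuous.measurable, Measure.ext_of_charFunDual ?_⟩
  ext L
  rw [charFunDual_map, hP, hQ, h]

theorem measurePreserving_add_mul_gaussianReal {v w : ℝ} (hv : 0 ≤ v) (hw : 0 ≤ w) (b : ℝ) :
    MeasurePreserving (fun p : ℝ × ℝ => p.1 + b * p.2)
      ((gaussianReal 0 v.toNNReal).prod (gaussianReal 0 w.toNNReal))
      (gaussianReal 0 (v + w * b ^ 2).toNNReal) := by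
  refine ((isCenteredGaussian_gaussianReal hv).prod
    (isCenteredGaussian_gaussianReal hw)).measurePreserving
    (isCenteredGaussian_gaussianReal (by positivity))
    (ContinuousLinearMap.fst ℝ ℝ ℝ + b • ContinuousLinearMap.snd ℝ ℝ ℝ) fun L => ?_
  have hL (x : ℝ) : L x = x * L 1 := by rw [← smul_eq_mul, ← map_smul, smul_eq_mul, mul_one]
  simp only [ContinuousLinearMap.comp_apply, ContinuousLinearMap.inl_apply,
    ContinuousLinearMap.inr_apply, _root_.add_apply, _root_.smul_apply,
    ContinuousLinearMap.coe_fst', ContinuousLinearMap.coe_snd', smul_eq_mul, mul_zero, add_zero,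
    mul_one, zero_add]
  rw [hL b]
  ring

/-- The regression on `U` of a standard Gaussian variable that contributes `κ` times itself to the
centred Gaussian `U` of variance `κ ^ 2 + r`, with the residual supplied by a standard Gaussian `w`
independent of `U`. -/
def gaussianPart (κ r U w : ℝ) : ℝ := κ / (κ ^ 2 + r) * U + √(r / (κ ^ 2 + r)) * w

theorem measurable_gaussianPart {α : Type*} [MeasurableSpace α] (κ r : ℝ) {U w : α → ℝ}
    (hU : Measurable U) (hw : Measurable w) :
    Measurable fun a => gaussianPart κ r (U a) (w a) :=
  (hU.const_mul _).add (hw.const_mul _)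

theorem measurePreserving_gaussianPart {κ r : ℝ} (hκ : κ ≠ 0) (hr : 0 ≤ r) :
    MeasurePreserving (fun p : ℝ × ℝ => (gaussianPart κ r p.1 p.2,
        p.1 - κ * gaussianPart κ r p.1 p.2))
      ((gaussianReal 0 (κ ^ 2 + r).toNNReal).prod (gaussianReal 0 1))
      ((gaussianReal 0 1).prod (gaussianReal 0 r.toNNReal)) := by
  set z : ℝ × ℝ →L[ℝ] ℝ := (κ / (κ ^ 2 + r)) • ContinuousLinearMap.fst ℝ ℝ ℝ +
    √(r / (κ ^ 2 + r)) • ContinuousLinearMap.snd ℝ ℝ ℝ with hz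
  have hvar : 0 < κ ^ 2 + r := by positivity
  have hroot : √(r / (κ ^ 2 + r)) ^ 2 = r / (κ ^ 2 + r) := Real.sq_sqrt (by positivity)
  have hone : IsCenteredGaussian (gaussianReal 0 1) fun L => 1 * L 1 ^ 2 := by
    simpa using isCenteredGaussian_gaussianReal zero_le_one
  refine ((isCenteredGaussian_gaussianReal hvar.le).prod hone).measurePreserving
    (hone.prod (isCenteredGaussian_gaussianReal hr))
    (z.prod (ContinuousLinearMap.fst ℝ ℝ ℝ - κ • z)) fun L => ?_
  have hL (x y : ℝ) : L (x, y) = x * L (1, 0) + y * L (0, 1) := by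
    rw [← smul_eq_mul, ← smul_eq_mul, ← map_smul, ← map_smul, ← map_add]
    simp
  simp only [ContinuousLinearMap.comp_apply, ContinuousLinearMap.inl_apply,
    ContinuousLinearMap.inr_apply, ContinuousLinearMap.prod_apply, _root_.sub_apply,
    _root_.add_apply, _root_.smul_apply, ContinuousLinearMap.coe_fst',
    ContinuousLinearMap.coe_snd', smul_eq_mul, mul_zero, add_zero, mul_one, zero_add, hz]
  rw [hL (_ / _), hL √_]
  generalize √(r / (κ ^ 2 + r)) = ρ at hroot ⊢
  have hvar' := hvar.ne'
  calc _ = (κ ^ 2 + r) * (κ / (κ ^ 2 + r) * (L (1, 0) - κ * L (0, 1)) + L (0, 1)) ^ 2 +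
        ρ ^ 2 * (L (1, 0) - κ * L (0, 1)) ^ 2 := by ring
    _ = L (1, 0) ^ 2 + r * L (0, 1) ^ 2 := by
        rw [hroot]
        field_simp
        ring
    _ = _ := by ring

end CenteredGaussian

/-! ### Innovations -/

section Innovation

open scoped Matrix

variable {ι : Type*} [Fintype ι]

theorem dotProduct_mulVec_add_smul {S : Matrix ι ι ℝ} (hS : S.IsSymm) {c b : ι → ℝ} {s σ : ℝ}
    (hs : s ^ 2 = σ ^ 2 + c ⬝ᵥ S *ᵥ c) (hb : S *ᵥ c = s • b) (u : ι → ℝ) (τ : ℝ) :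
    (u + τ • c) ⬝ᵥ S *ᵥ (u + τ • c) + σ ^ 2 * τ ^ 2 =
      (s * τ + u ⬝ᵥ b) ^ 2 + u ⬝ᵥ (S - Matrix.vecMulVec b b) *ᵥ u := by
  have huc : u ⬝ᵥ S *ᵥ c = s * (u ⬝ᵥ b) := by rw [hb, dotProduct_smul, smul_eq_mul]
  have hcu : c ⬝ᵥ S *ᵥ u = s * (u ⬝ᵥ b) := by
    rw [← huc, Matrix.dotProduct_mulVec, ← Matrix.mulVec_transpose, hS, dotProduct_comm]
  have hub : u ⬝ᵥ Matrix.vecMulVec b b *ᵥ u = (u ⬝ᵥ b) ^ 2 := by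
    rw [Matrix.vecMulVec_mulVec, dotProduct_smul, MulOpposite.smul_eq_mul_unop,
      MulOpposite.unop_op, dotProduct_comm b, sq]
  rw [Matrix.sub_mulVec, dotProduct_sub, hub, Matrix.mulVec_add, Matrix.mulVec_smul,
    add_dotProduct, dotProduct_add, dotProduct_add, smul_dotProduct, smul_dotProduct,
    dotProduct_smul, dotProduct_smul, huc, hcu]
  simp only [smul_eq_mul]
  linear_combination -τ ^ 2 * hs

variable [DecidableEq ι]

theorem strongDual_prod_euclideanSpace_apply (L : StrongDual ℝ (ℝ × EuclideanSpace ℝ ι)) (z : ℝ)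
    (x : EuclideanSpace ℝ ι) :
    L (z, x) = z * L (1, 0) + (fun i => L (0, EuclideanSpace.single i 1)) ⬝ᵥ x.ofLp := by
  have hx : x = ∑ i, x i • EuclideanSpace.single i (1 : ℝ) := by
    simpa using ((EuclideanSpace.basisFun ι ℝ).sum_repr x).symm
  have hsplit : (z, x) = z • ((1 : ℝ), (0 : EuclideanSpace ℝ ι)) + (0, x) := by simp
  have hinr : L (0, x) = (fun i => L (0, EuclideanSpace.single i 1)) ⬝ᵥ x.ofLp := by
    change L.comp (ContinuousLinearMap.inr ℝ _ _) x = _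
    conv_lhs => rw [hx]
    simp [dotProduct, mul_comm]
  rw [hsplit, map_add, map_smul, smul_eq_mul, hinr]

open scoped RealInnerProductSpace in
/-- The factor `s⁻¹ * (⟪c, x⟫ + e)` is the standardized observation of `x` along `c` with error `e`;
it is independent of the remaining error `x - s⁻¹ * (⟪c, x⟫ + e) • b`. -/
theorem measurePreserving_innovation {S : Matrix ι ι ℝ} (hS : S.PosSemidef)
    {c b : EuclideanSpace ℝ ι} (hS' : (S - Matrix.vecMulVec b b).PosSemidef) {s σ : ℝ} (hs : s ≠ 0)
    (hsσ : s ^ 2 = σ ^ 2 + c ⬝ᵥ S *ᵥ c) (hb : S *ᵥ c = s • b.ofLp) :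
    MeasurePreserving
      (fun p : EuclideanSpace ℝ ι × ℝ => (s⁻¹ * (⟪c, p.1⟫ + p.2),
        p.1 - (s⁻¹ * (⟪c, p.1⟫ + p.2)) • b))
      ((multivariateGaussian 0 S).prod (gaussianReal 0 (σ ^ 2).toNNReal))
      ((gaussianReal 0 1).prod (multivariateGaussian 0 (S - Matrix.vecMulVec b b))) := by
  set Z : EuclideanSpace ℝ ι × ℝ →L[ℝ] ℝ := s⁻¹ • ((innerSL ℝ c).comp
    (ContinuousLinearMap.fst ℝ _ _) + ContinuousLinearMap.snd ℝ _ _) with hZ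
  have hone : IsCenteredGaussian (gaussianReal 0 1) fun L => 1 * L 1 ^ 2 := by
    simpa using isCenteredGaussian_gaussianReal zero_le_one
  refine ((isCenteredGaussian_multivariateGaussian hS).prod
    (isCenteredGaussian_gaussianReal (sq_nonneg σ))).measurePreserving
    (hone.prod (isCenteredGaussian_multivariateGaussian hS'))
    (Z.prod (ContinuousLinearMap.fst ℝ _ _ - Z.smulRight b)) fun L => ?_
  set a := L (1, 0)
  set u : ι → ℝ := fun i => L (0, EuclideanSpace.single i 1)
  have hL (z : ℝ) (x : EuclideanSpace ℝ ι) : L (z, x) = z * a + u ⬝ᵥ x.ofLp :=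
    strongDual_prod_euclideanSpace_apply L z x
  set τ := s⁻¹ * (a - u ⬝ᵥ b) with hτ
  have hsτ : s * τ + u ⬝ᵥ b = a := by
    rw [hτ, mul_inv_cancel_left₀ hs, sub_add_cancel]
  have hTe : (fun i => L (Z (EuclideanSpace.single i 1, 0),
      EuclideanSpace.single i 1 - Z (EuclideanSpace.single i 1, 0) • b)) = u + τ • c.ofLp := by
    ext i
    simp only [hL, hZ, hτ, smul_add, _root_.add_apply, _root_.smul_apply,
      ContinuousLinearMap.comp_apply, ContinuousLinearMap.coe_fst', ContinuousLinearMap.coe_snd',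
      coe_innerSL_apply, EuclideanSpace.inner_single_right, Real.ringHom_apply, smul_eq_mul,
      WithLp.ofLp_sub, WithLp.ofLp_smul, PiLp.ofLp_single, dotProduct_sub, dotProduct_smul,
      dotProduct_single, Pi.add_apply, Pi.smul_apply]
    ring
  have hTn : L (Z (0, 1), 0 - Z (0, 1) • b) = τ := by
    simp only [hL, hZ, hτ, smul_add, _root_.add_apply, _root_.smul_apply,
      ContinuousLinearMap.comp_apply, ContinuousLinearMap.coe_fst', ContinuousLinearMap.coe_snd',
      coe_innerSL_apply, inner_zero_right, smul_eq_mul, zero_sub, WithLp.ofLp_neg,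
      WithLp.ofLp_smul, dotProduct_neg, dotProduct_smul]
    ring
  change (fun i => L (Z (EuclideanSpace.single i 1, 0),
      EuclideanSpace.single i 1 - Z (EuclideanSpace.single i 1, 0) • b)) ⬝ᵥ S *ᵥ (fun i =>
      L (Z (EuclideanSpace.single i 1, 0), EuclideanSpace.single i 1 -
        Z (EuclideanSpace.single i 1, 0) • b)) + σ ^ 2 * L (Z (0, 1), 0 - Z (0, 1) • b) ^ 2 =
    1 * a ^ 2 + u ⬝ᵥ (S - Matrix.vecMulVec b b) *ᵥ u
  have hsymm : S.IsSymm := hS.isHermitian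
  rw [hTe, hTn, dotProduct_mulVec_add_smul hsymm hsσ hb, hsτ, one_mul]

end Innovation

/-! ### Independence and laws of sequences -/

section Products

variable {α β γ δ : Type*} [MeasurableSpace α] [MeasurableSpace β] [MeasurableSpace γ]
  [MeasurableSpace δ]

theorem measurePreserving_prodProdProdComm (μ : Measure α) (ν : Measure β) (ρ : Measure γ)
    (τ : Measure δ) [SFinite μ] [SFinite ν] [SFinite ρ] [SFinite τ] :
    MeasurePreserving (fun p : (α × β) × γ × δ => ((p.1.1, p.2.1), (p.1.2, p.2.2)))
      ((μ.prod ν).prod (ρ.prod τ)) ((μ.prod ρ).prod (ν.prod τ)) := by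
  refine ⟨by fun_prop, Measure.ext_of_lintegral _ fun f hf => ?_⟩
  rw [lintegral_map hf (by fun_prop), lintegral_prod _ (by fun_prop),
    lintegral_prod _ (by fun_prop), lintegral_prod _ (by fun_prop), lintegral_prod _ (by fun_prop)]
  refine lintegral_congr fun x => ?_
  calc ∫⁻ y, ∫⁻ p : γ × δ, f ((x, p.1), (y, p.2)) ∂(ρ.prod τ) ∂ν
      = ∫⁻ y, ∫⁻ z, ∫⁻ w, f ((x, z), (y, w)) ∂τ ∂ρ ∂ν :=
        lintegral_congr fun y =>
          lintegral_prod (fun p : γ × δ => f ((x, p.1), (y, p.2))) (by fun_prop)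
    _ = ∫⁻ z, ∫⁻ y, ∫⁻ w, f ((x, z), (y, w)) ∂τ ∂ν ∂ρ := lintegral_lintegral_swap (by fun_prop)
    _ = ∫⁻ z, ∫⁻ p : β × δ, f ((x, z), p) ∂(ν.prod τ) ∂ρ :=
        lintegral_congr fun z =>
          (lintegral_prod (fun p : β × δ => f ((x, z), p)) (by fun_prop)).symm

theorem indepFun_prodMk_prod {Ω Ω' : Type*} [MeasurableSpace Ω] [MeasurableSpace Ω']
    {P : Measure Ω} {Q : Measure Ω'} [IsProbabilityMeasure P] [IsProbabilityMeasure Q]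
    {f : Ω → α} {g : Ω → β} {f' : Ω' → γ} {g' : Ω' → δ} (hf : Measurable f) (hg : Measurable g)
    (hf' : Measurable f') (hg' : Measurable g') (h : IndepFun f g P) (h' : IndepFun f' g' Q) :
    IndepFun (fun p : Ω × Ω' => (f p.1, f' p.2)) (fun p => (g p.1, g' p.2)) (P.prod Q) := by
  rw [indepFun_iff_map_prod_eq_prod_map_map hf.aemeasurable hg.aemeasurable] at h
  rw [indepFun_iff_map_prod_eq_prod_map_map hf'.aemeasurable hg'.aemeasurable] at h'
  rw [indepFun_iff_map_prod_eq_prod_map_map (by fun_prop) (by fun_prop)]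
  have hcomm :=
    (measurePreserving_prodProdProdComm (P.map f) (P.map g) (Q.map f') (Q.map g')).map_eq
  rwa [← h, ← h', Measure.map_prod_map _ _ (by fun_prop) (by fun_prop),
    Measure.map_map (by fun_prop) (by fun_prop), Measure.map_prod_map P Q hf hf',
    Measure.map_prod_map P Q hg hg'] at hcomm

end Products

theorem indepFun_restrict_infinitePi {ι : Type*} {Ω : ι → Type*} [∀ i, MeasurableSpace (Ω i)]
    {P : ∀ i, Measure (Ω i)} [∀ i, IsProbabilityMeasure (P i)] {S T : Finset ι}
    (h : Disjoint S T) :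
    IndepFun (fun (x : ∀ i, Ω i) (i : S) => x i) (fun x (i : T) => x i) (Measure.infinitePi P) :=
  (iIndepFun_infinitePi (P := P) (X := fun _ x => x) fun _ => measurable_id).indepFun_finset S T h
    fun i => measurable_pi_apply i

section GaussianStep

open scoped Matrix RealInnerProductSpace

variable {ι : Type*} [Fintype ι] [DecidableEq ι]

/-- Of the Gaussian pair `(R, x)` with observation error `e`, the part `R + β * Z` containing the
innovation `Z` of `x` is split into a new standard Gaussian variable and a new residual. -/
theorem measurePreserving_gaussianStep {S : Matrix ι ι ℝ} (hS : S.PosSemidef)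
    {c b : EuclideanSpace ℝ ι} (hS' : (S - Matrix.vecMulVec b b).PosSemidef) {s σ : ℝ} (hs : s ≠ 0)
    (hsσ : s ^ 2 = σ ^ 2 + c ⬝ᵥ S *ᵥ c) (hb : S *ᵥ c = s • b.ofLp) {r r' κ β : ℝ} (hr : 0 ≤ r)
    (hr' : 0 ≤ r') (hκ : κ ≠ 0) (hvar : r + β ^ 2 = κ ^ 2 + r') :
    MeasurePreserving
      (fun p : (ℝ × EuclideanSpace ℝ ι) × ℝ × ℝ =>
        let Z := s⁻¹ * (⟪c, p.1.2⟫ + p.2.1)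
        let z := gaussianPart κ r' (p.1.1 + β * Z) p.2.2
        (z, p.1.1 + β * Z - κ * z, p.1.2 - Z • b))
      (((gaussianReal 0 r.toNNReal).prod (multivariateGaussian 0 S)).prod
        ((gaussianReal 0 (σ ^ 2).toNNReal).prod (gaussianReal 0 1)))
      ((gaussianReal 0 1).prod ((gaussianReal 0 r'.toNNReal).prod
        (multivariateGaussian 0 (S - Matrix.vecMulVec b b)))) := by
  have hsum : MeasurePreserving (fun p : ℝ × ℝ => p.1 + β * p.2)
      ((gaussianReal 0 r.toNNReal).prod (gaussianReal 0 1))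
      (gaussianReal 0 (κ ^ 2 + r').toNNReal) := by
    simpa [hvar] using measurePreserving_add_mul_gaussianReal hr zero_le_one β
  have hobserve := ((MeasurePreserving.id
    ((gaussianReal 0 r.toNNReal).prod (gaussianReal 0 1))).prod
    (measurePreserving_innovation hS hS' hs hsσ hb)).comp
    ((measurePreserving_prodProdProdComm _ _ _ _).comp
      ((MeasurePreserving.id _).prod Measure.measurePreserving_swap))
  have hcollect := (measurePreserving_prodAssoc _ _ _).symm.comp
    ((hsum.prod (MeasurePreserving.id ((gaussianReal 0 1).prod
      (multivariateGaussian 0 (S - Matrix.vecMulVec b b))))).comp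
      (measurePreserving_prodProdProdComm _ _ _ _))
  exact (measurePreserving_prodAssoc _ _ _).comp
    (((measurePreserving_gaussianPart hκ hr').prod (MeasurePreserving.id _)).comp
      (hcollect.comp hobserve))

end GaussianStep

theorem measurable_finInit (t : ℕ) :
    Measurable (fun x : Fin (t + 1) → ℝ => (Fin.init x : Fin t → ℝ)) :=
  measurable_pi_lambda _ fun _ => measurable_pi_apply _

theorem measurable_finSnoc (t : ℕ) :
    Measurable (fun p : (Fin t → ℝ) × ℝ => (Fin.snoc p.1 p.2 : Fin (t + 1) → ℝ)) := by
  refine measurable_pi_lambda _ fun i => ?_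
  induction i using Fin.lastCases with
  | last => simpa using measurable_snd
  | cast i => simpa [Function.comp_def] using (measurable_pi_apply i).comp measurable_fst

section Sequences

variable {α : Type*} [MeasurableSpace α]

/-- The first `t` terms of a sequence of realizations that is accompanied by a further component;
it is used to compare laws of infinite plays through their finite parts. -/
def initialSegment (t : ℕ) (x : (ℕ → ℝ) × α) : (Fin t → ℝ) × α := (fun i => x.1 i, x.2)

theorem measurable_initialSegment (t : ℕ) :
    Measurable (initialSegment t : (ℕ → ℝ) × α → (Fin t → ℝ) × α) := by
  unfold initialSegment
  fun_prop

theorem monotone_comap_initialSegment :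
    Monotone fun t => MeasurableSpace.comap (initialSegment t : (ℕ → ℝ) × α → _) inferInstance := by
  intro t u htu
  let restrict (a : (Fin u → ℝ) × α) : (Fin t → ℝ) × α := (fun i => a.1 (Fin.castLE htu i), a.2)
  have hrestrict : Measurable restrict := by fun_prop
  change MeasurableSpace.comap (restrict ∘ initialSegment u) _ ≤ _
  rw [← MeasurableSpace.comap_comp]
  exact MeasurableSpace.comap_mono hrestrict.comap_le

theorem iSup_comap_initialSegment :
    ⨆ t, MeasurableSpace.comap (initialSegment t : (ℕ → ℝ) × α → _) inferInstance =
      (inferInstance : MeasurableSpace ((ℕ → ℝ) × α)) := by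
  refine le_antisymm (iSup_le fun t => (measurable_initialSegment t).comap_le) ?_
  set m := ⨆ t, MeasurableSpace.comap (initialSegment t : (ℕ → ℝ) × α → _) inferInstance
  have hinit (t : ℕ) : Measurable[m] (initialSegment t : (ℕ → ℝ) × α → _) :=
    measurable_iff_comap_le.2 (le_iSup (fun t => MeasurableSpace.comap
      (initialSegment t : (ℕ → ℝ) × α → _) inferInstance) t)
  refine sup_le (measurable_iff_comap_le.1 ((@measurable_pi_iff _ _ _ m _ _).2 fun n => ?_))
    (measurable_iff_comap_le.1 ?_)
  · exact Measurable.comp (f := initialSegment (n + 1))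
      (g := fun a : (Fin (n + 1) → ℝ) × α => a.1 (Fin.last n)) (by fun_prop) (hinit (n + 1))
  · exact Measurable.comp (f := initialSegment 0) (g := Prod.snd) measurable_snd (hinit 0)

theorem ext_of_map_initialSegment {P Q : Measure ((ℕ → ℝ) × α)} [IsProbabilityMeasure P]
    [IsProbabilityMeasure Q] (h : ∀ t, P.map (initialSegment t) = Q.map (initialSegment t)) :
    P = Q := by
  have hpi := isPiSystem_iUnion_of_monotone _
    (fun t => (MeasurableSpace.comap (initialSegment t : (ℕ → ℝ) × α → _)
      inferInstance).isPiSystem_measurableSet) fun t u htu => monotone_comap_initialSegment htu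
  refine ext_of_generate_finite _ ?_ hpi ?_ (by simp)
  · exact iSup_comap_initialSegment.symm.trans
      (MeasurableSpace.generateFrom_iUnion_measurableSet _).symm
  · rintro _ ⟨_, ⟨t, rfl⟩, ⟨s, hs, rfl⟩⟩
    rw [← Measure.map_apply (measurable_initialSegment t) hs, h t,
      Measure.map_apply (measurable_initialSegment t) hs]

end Sequences

/-! ### Mimicking a strategy -/

section NextSource

variable {ι : Type*} [Fintype ι] [DecidableEq ι]

open Classical in
/-- The index that the reduction `G` increases when `k` is increased in `q`. It is a total function,
with the junk value `k` where `G` does not increase a single index. -/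
def nextSource (G : ℕ → (ι → ℕ) → ι → ℕ) (t : ℕ) (q : ι → ℕ) (k : ι) : ι :=
  if h : ∃ j, G (t + 1) (q + Pi.single k 1) = G t q + Pi.single j 1 then h.choose else k

theorem IsReduction.map_succ_add_single {β : Type*} [Preorder β] {f : (ι → ℕ) → β}
    {G : ℕ → (ι → ℕ) → ι → ℕ} (hG : IsReduction f G) (t : ℕ) (q : ι → ℕ) (k : ι) :
    G (t + 1) (q + Pi.single k 1) = G t q + Pi.single (nextSource G t q k) 1 := by
  rw [nextSource, dif_pos (hG.exists_map_succ t q k)]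
  exact (hG.exists_map_succ t q k).choose_spec

theorem nextSource_id (t : ℕ) (q : ι → ℕ) (k : ι) : nextSource (fun _ q => q) t q k = k := by
  have hsingle := add_left_cancel ((isReduction_id fun _ : ι → ℕ => ()).map_succ_add_single t q k)
  by_contra hne
  simpa [Ne.symm hne] using congrFun hsingle k

end NextSource

namespace Environment

open scoped Matrix RealInnerProductSpace

variable {K : ℕ} (E : Environment K)

/-- The mean of an observation of source `j` in the state `m`. -/
def fit (j : Fin K) (m : EuclideanSpace ℝ (Fin K)) : ℝ := E.C j ⬝ᵥ m.ofLp

theorem fit_eq_inner (j : Fin K) (m : EuclideanSpace ℝ (Fin K)) :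
    E.fit j m = ⟪WithLp.toLp 2 (E.C j), m⟫ := by
  rw [EuclideanSpace.inner_eq_star_dotProduct, star_trivial, dotProduct_comm, fit]

/-- The predictive standard deviation of the next observation of source `j` after the division
`q`. -/
def scale (q : Fin K → ℕ) (j : Fin K) : ℝ := √(E.obsVar q j)

theorem scale_pos (q : Fin K → ℕ) (j : Fin K) : 0 < E.scale q j :=
  Real.sqrt_pos.2 (E.obsVar_pos q j)

theorem scale_sq (q : Fin K → ℕ) (j : Fin K) : E.scale q j ^ 2 = E.obsVar q j :=
  Real.sq_sqrt (E.obsVar_pos q j).le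

/-- The change of the posterior mean per unit of the standardized observation of source `j` after
the division `q`. -/
def kalmanGain (q : Fin K → ℕ) (j : Fin K) : EuclideanSpace ℝ (Fin K) :=
  WithLp.toLp 2 ((E.scale q j)⁻¹ • E.postCov q *ᵥ E.C j)

theorem postCov_mulVec_eq_kalmanGain (q : Fin K → ℕ) (j : Fin K) :
    E.postCov q *ᵥ E.C j = E.scale q j • (E.kalmanGain q j).ofLp :=
  (smul_inv_smul₀ (E.scale_pos q j).ne' _).symm

theorem postCov_add_single_eq_kalmanGain (q : Fin K → ℕ) (j : Fin K) :
    E.postCov (q + Pi.single j 1) =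
      E.postCov q - Matrix.vecMulVec (E.kalmanGain q j).ofLp (E.kalmanGain q j).ofLp := by
  have hscale : (E.scale q j ^ 2)⁻¹ * E.scale q j * E.scale q j = 1 := by
    rw [mul_assoc, ← sq, inv_mul_cancel₀ (pow_pos (E.scale_pos q j) 2).ne']
  rw [postCov_add_single, postCov_mulVec_eq_kalmanGain, Matrix.smul_vecMulVec,
    Matrix.vecMulVec_smul, smul_smul, smul_smul, ← scale_sq, hscale, one_smul]

/-- The standardized observation of source `j` after the division `q`, if the posterior mean is `m`
and the realization is `y`. -/
def innovation (q : Fin K → ℕ) (j : Fin K) (m : EuclideanSpace ℝ (Fin K)) (y : ℝ) : ℝ :=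
  (E.scale q j)⁻¹ * (y - E.fit j m)

theorem innovation_fit_add (q : Fin K → ℕ) (j : Fin K) (m : EuclideanSpace ℝ (Fin K)) (z : ℝ) :
    E.innovation q j m (E.fit j m + E.scale q j * z) = z := by
  rw [innovation, add_sub_cancel_left, inv_mul_cancel_left₀ (E.scale_pos q j).ne']

theorem fit_add_scale_mul_innovation (q : Fin K → ℕ) (j : Fin K) (m : EuclideanSpace ℝ (Fin K))
    (y : ℝ) : E.fit j m + E.scale q j * E.innovation q j m y = y := by
  rw [innovation, mul_inv_cancel_left₀ (E.scale_pos q j).ne', add_sub_cancel]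

theorem innovation_signal (q : Fin K → ℕ) (j : Fin K) (m : EuclideanSpace ℝ (Fin K)) (t : ℕ)
    (ω : Sample K) :
    E.innovation q j m (E.signal j t ω) =
      (E.scale q j)⁻¹ * (E.fit j (ω.1 - m) + ω.2 (j, t)) := by
  have hsignal : E.signal j t ω = E.fit j ω.1 + ω.2 (j, t) := rfl
  rw [innovation, hsignal, fit, fit, fit, WithLp.ofLp_sub, dotProduct_sub]
  ring

/-- The posterior mean after the realization `y` of source `j`, if the division and the posterior
mean were `q` and `m`. -/
def updateMean (q : Fin K → ℕ) (j : Fin K) (m : EuclideanSpace ℝ (Fin K)) (y : ℝ) :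
    EuclideanSpace ℝ (Fin K) :=
  m + E.innovation q j m y • E.kalmanGain q j

theorem measurable_fit :
    Measurable fun p : Fin K × EuclideanSpace ℝ (Fin K) => E.fit p.1 p.2 :=
  measurable_from_prod_countable_right fun j => by
    unfold fit dotProduct
    fun_prop

theorem measurable_innovation :
    Measurable fun p : ((Fin K → ℕ) × Fin K) × EuclideanSpace ℝ (Fin K) × ℝ =>
      E.innovation p.1.1 p.1.2 p.2.1 p.2.2 :=
  measurable_from_prod_countable_right fun p => by
    unfold innovation fit dotProduct
    fun_prop

theorem measurable_updateMean :
    Measurable fun p : ((Fin K → ℕ) × Fin K) × EuclideanSpace ℝ (Fin K) × ℝ =>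
      E.updateMean p.1.1 p.1.2 p.2.1 p.2.2 :=
  measurable_from_prod_countable_right fun p => by
    unfold updateMean innovation fit dotProduct
    fun_prop

theorem measurable_signal_uncurry (t : ℕ) :
    Measurable fun p : Fin K × Sample K => E.signal p.1 t p.2 :=
  measurable_from_prod_countable_right fun k => E.measurable_signal k t

variable [NeZero K]

theorem kalmanGain_zero_sq (q : Fin K → ℕ) (j : Fin K) :
    E.kalmanGain q j 0 ^ 2 = E.postCov q 0 0 - E.postCov (q + Pi.single j 1) 0 0 := by
  rw [postCov_add_single_eq_kalmanGain, Matrix.sub_apply, Matrix.vecMulVec_apply]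
  ring

variable {E} in
theorem PositiveMarginalValue.kalmanGain_zero_ne_zero (hpos : E.PositiveMarginalValue)
    (q : Fin K → ℕ) (j : Fin K) : E.kalmanGain q j 0 ≠ 0 := by
  have hloading : E.kalmanGain q j 0 = (E.scale q j)⁻¹ * E.loading q j :=
    congrArg (_ * ·) (E.postCov_mulVec_apply q 0 j)
  rw [hloading]
  exact mul_ne_zero (inv_ne_zero (E.scale_pos q j).ne') (hpos.loading_ne_zero q j)

variable (G : ℕ → (Fin K → ℕ) → Fin K → ℕ)

/-- The reduction of the posterior variance when `G` replaces the division `q`. -/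
def slack (t : ℕ) (q : Fin K → ℕ) : ℝ := E.postCov q 0 0 - E.postCov (G t q) 0 0

variable {E G} in
theorem slack_nonneg (hG : IsReduction (fun q => E.postCov q 0 0) G) {t : ℕ} {q : Fin K → ℕ}
    (hq : ∑ k, q k = t) : 0 ≤ E.slack G t q :=
  sub_nonneg.2 (hG.map_le t q hq)

/-- The simulated standardized observation of source `k` after the division `q`: `Z` is the
standardized observation actually made, `R` is the difference of the actual and the simulated
posterior mean of the payoff-relevant state, and `w` is an independent randomization. -/
def simulated (t : ℕ) (q : Fin K → ℕ) (k : Fin K) (R Z w : ℝ) : ℝ :=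
  gaussianPart (E.kalmanGain q k 0) (E.slack G (t + 1) (q + Pi.single k 1))
    (R + E.kalmanGain (G t q) (nextSource G t q k) 0 * Z) w

theorem measurable_simulated (t : ℕ) :
    Measurable fun p : ((Fin K → ℕ) × Fin K) × ℝ × ℝ × ℝ =>
      E.simulated G t p.1.1 p.1.2 p.2.1 p.2.2.1 p.2.2.2 :=
  measurable_from_prod_countable_right fun p => by
    simp only [simulated]
    exact measurable_gaussianPart _ _ (by fun_prop) (by fun_prop)

theorem simulated_id {q : Fin K → ℕ} {k : Fin K} (hgain : E.kalmanGain q k 0 ≠ 0) (t : ℕ)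
    (Z w : ℝ) : E.simulated (fun _ q => q) t q k 0 Z w = Z := by
  simp only [simulated, gaussianPart, slack, sub_self, zero_div, Real.sqrt_zero, zero_mul, add_zero,
    zero_add, nextSource_id]
  field_simp

end Environment

namespace Strategy

open Environment

variable {K : ℕ} {𝒜 : ℕ → Type*} [∀ t, MeasurableSpace (𝒜 t)]
  (s : Strategy K 𝒜) (E : Environment K) (μ : EuclideanSpace ℝ (Fin K))
  (G : ℕ → (Fin K → ℕ) → Fin K → ℕ)

/-- The division as a function of the realizations; `Strategy.division` is a function of the sample
point. -/
def count : ∀ t : ℕ, (Fin t → ℝ) → Fin K → ℕ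
  | 0, _ => 0
  | t + 1, x => count t (Fin.init x) + Pi.single (s.source t (Fin.init x)) 1

/-- The posterior mean as a function of the realizations. -/
def mean : ∀ t : ℕ, (Fin t → ℝ) → EuclideanSpace ℝ (Fin K)
  | 0, _ => μ
  | t + 1, x => E.updateMean (s.count t (Fin.init x)) (s.source t (Fin.init x))
      (mean t (Fin.init x)) (x (Fin.last t))

/-- The realizations after period `t`, if the standardized observation of this period is `z`. -/
def extend (t : ℕ) (x : Fin t → ℝ) (z : ℝ) : Fin (t + 1) → ℝ :=
  Fin.snoc (α := fun _ => ℝ) x (E.fit (s.source t x) (s.mean E μ t x) +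
    E.scale (s.count t x) (s.source t x) * z)

theorem count_snoc (t : ℕ) (x : Fin t → ℝ) (y : ℝ) :
    s.count (t + 1) (Fin.snoc (α := fun _ => ℝ) x y) =
      s.count t x + Pi.single (s.source t x) 1 := by
  rw [count, Fin.init_snoc]

theorem mean_snoc (t : ℕ) (x : Fin t → ℝ) (y : ℝ) :
    s.mean E μ (t + 1) (Fin.snoc (α := fun _ => ℝ) x y) =
      E.updateMean (s.count t x) (s.source t x) (s.mean E μ t x) y := by
  rw [mean, Fin.init_snoc, Fin.snoc_last]

theorem count_extend (t : ℕ) (x : Fin t → ℝ) (z : ℝ) :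
    s.count (t + 1) (s.extend E μ t x z) = s.count t x + Pi.single (s.source t x) 1 :=
  s.count_snoc t x _

theorem mean_extend (t : ℕ) (x : Fin t → ℝ) (z : ℝ) :
    s.mean E μ (t + 1) (s.extend E μ t x z) =
      s.mean E μ t x + z • E.kalmanGain (s.count t x) (s.source t x) := by
  rw [extend, mean_snoc, updateMean, innovation_fit_add]

theorem sum_count (t : ℕ) (x : Fin t → ℝ) : ∑ k, s.count t x k = t := by
  induction t with
  | zero => simp [count]
  | succ t ih => rw [count, sum_add_single, ih]

theorem measurable_count (t : ℕ) : Measurable (s.count t) := by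
  induction t with
  | zero => exact measurable_const
  | succ t ih =>
    exact (measurable_of_countable fun p : (Fin K → ℕ) × Fin K => p.1 + Pi.single p.2 1).comp
      ((ih.prodMk (s.measurable_source t)).comp (measurable_finInit t))

theorem measurable_count_source (t : ℕ) : Measurable fun x => (s.count t x, s.source t x) :=
  (s.measurable_count t).prodMk (s.measurable_source t)

theorem measurable_mean (t : ℕ) : Measurable (s.mean E μ t) := by
  induction t with
  | zero => exact measurable_const
  | succ t ih =>
    exact E.measurable_updateMean.comp (((s.measurable_count_source t).comp
      (measurable_finInit t)).prodMk ((ih.comp (measurable_finInit t)).prodMk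
        (measurable_pi_apply _)))

theorem measurable_extend (t : ℕ) :
    Measurable fun p : (Fin t → ℝ) × ℝ => s.extend E μ t p.1 p.2 := by
  have hfit := E.measurable_fit.comp ((s.measurable_source t).prodMk (s.measurable_mean E μ t))
  have hscale := (measurable_of_countable fun p : (Fin K → ℕ) × Fin K => E.scale p.1 p.2).comp
    (s.measurable_count_source t)
  exact (measurable_finSnoc t).comp (measurable_fst.prodMk
    ((hfit.comp measurable_fst).add ((hscale.comp measurable_fst).mul measurable_snd)))

theorem division_succ (ω : Sample K) (t : ℕ) :
    s.division E ω (t + 1) =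
      s.division E ω t + Pi.single (s.source t (s.history E ω t)) 1 := by
  ext k
  rw [Pi.add_apply, division, division, Finset.range_add_one, Finset.filter_insert]
  split_ifs with hk
  · rw [Finset.card_insert_of_notMem (by simp), hk, Pi.single_eq_same]
  · rw [Pi.single_eq_of_ne (Ne.symm hk), add_zero]

/-- The source that replaces the source chosen by the strategy, if its realizations are `x`. -/
def mimicSource (t : ℕ) (x : Fin t → ℝ) : Fin K := nextSource G t (s.count t x) (s.source t x)

theorem measurable_mimicSource (t : ℕ) : Measurable (s.mimicSource G t) :=
  (measurable_of_countable fun p : (Fin K → ℕ) × Fin K => nextSource G t p.1 p.2).comp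
    (s.measurable_count_source t)

theorem measurable_mimicDivision (t : ℕ) :
    Measurable fun x => (G t (s.count t x), s.mimicSource G t x) :=
  ((measurable_of_countable (G t)).comp (s.measurable_count t)).prodMk
    (s.measurable_mimicSource G t)

variable [NeZero K]

/-- One period of the simulation: from the simulated realizations and the actual posterior mean
`p`, the actual realization `y` of the replacing source and the randomization `w`. -/
def mimicStep (t : ℕ) (p : (Fin t → ℝ) × EuclideanSpace ℝ (Fin K)) (y w : ℝ) :
    (Fin (t + 1) → ℝ) × EuclideanSpace ℝ (Fin K) :=
  (s.extend E μ t p.1 (E.simulated G t (s.count t p.1) (s.source t p.1)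
      (p.2 0 - s.mean E μ t p.1 0)
      (E.innovation (G t (s.count t p.1)) (s.mimicSource G t p.1) p.2 y) w),
    E.updateMean (G t (s.count t p.1)) (s.mimicSource G t p.1) p.2 y)

theorem measurable_mimicStep (t : ℕ) :
    Measurable fun a : ((Fin t → ℝ) × EuclideanSpace ℝ (Fin K)) × ℝ × ℝ =>
      s.mimicStep E μ G t a.1 a.2.1 a.2.2 := by
  have hx : Measurable fun a : ((Fin t → ℝ) × EuclideanSpace ℝ (Fin K)) × ℝ × ℝ => a.1.1 :=
    measurable_fst.fst
  have hm : Measurable fun a : ((Fin t → ℝ) × EuclideanSpace ℝ (Fin K)) × ℝ × ℝ => a.1.2 :=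
    measurable_fst.snd
  have hobserved := ((s.measurable_mimicDivision G t).comp hx).prodMk
    (hm.prodMk measurable_snd.fst)
  have hcoord : Measurable fun m : EuclideanSpace ℝ (Fin K) => m 0 := by fun_prop
  have hresidual := (hcoord.comp hm).sub (hcoord.comp ((s.measurable_mean E μ t).comp hx))
  have hsimulated := (E.measurable_simulated G t).comp (((s.measurable_count_source t).comp
    hx).prodMk (hresidual.prodMk ((E.measurable_innovation.comp hobserved).prodMk
      measurable_snd.snd)))
  exact ((s.measurable_extend E μ t).comp (hx.prodMk hsimulated)).prodMk
    (E.measurable_updateMean.comp hobserved)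

/-- The simulated realizations and the actual posterior mean, from the randomizations `w` and the
actual realizations. -/
def mimic (w : ℕ → ℝ) : ∀ t : ℕ, (Fin t → ℝ) → (Fin t → ℝ) × EuclideanSpace ℝ (Fin K)
  | 0, _ => (Fin.elim0, μ)
  | t + 1, y => s.mimicStep E μ G t (mimic w t (Fin.init y)) (y (Fin.last t)) (w t)

theorem measurable_mimic (w : ℕ → ℝ) (t : ℕ) : Measurable (s.mimic E μ G w t) := by
  induction t with
  | zero => exact measurable_const
  | succ t ih =>
    exact (s.measurable_mimicStep E μ G t).comp ((ih.comp (measurable_finInit t)).prodMk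
      ((measurable_pi_apply _).prodMk measurable_const))

/-- The strategy that observes the replacing sources while it simulates the realizations of the
strategy `s`, whose actions it takes. -/
def mimicStrategy (w : ℕ → ℝ) : Strategy K 𝒜 where
  source t y := s.mimicSource G t (s.mimic E μ G w t y).1
  measurable_source t := (s.measurable_mimicSource G t).comp (s.measurable_mimic E μ G w t).fst
  action t y := s.action t (s.mimic E μ G w (t + 1) y).1
  measurable_action t := (s.measurable_action t).comp (s.measurable_mimic E μ G w (t + 1)).fst

/-- The simulated realizations and the actual posterior mean at a sample point. -/
def mimicState (t : ℕ) (ω : Sample K) (w : ℕ → ℝ) : (Fin t → ℝ) × EuclideanSpace ℝ (Fin K) :=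
  s.mimic E μ G w t ((s.mimicStrategy E μ G w).history E ω t)

theorem mimicState_succ (t : ℕ) (ω : Sample K) (w : ℕ → ℝ) :
    s.mimicState E μ G (t + 1) ω w = s.mimicStep E μ G t (s.mimicState E μ G t ω w)
      (E.signal (s.mimicSource G t (s.mimicState E μ G t ω w).1) t ω) (w t) := by
  rw [mimicState, history, mimic, Fin.init_snoc, Fin.snoc_last]
  rfl

theorem measurable_mimicState (t : ℕ) :
    Measurable fun p : Sample K × (ℕ → ℝ) => s.mimicState E μ G t p.1 p.2 := by
  induction t with
  | zero => exact measurable_const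
  | succ t ih =>
    have hsignal := (E.measurable_signal_uncurry t).comp
      (((s.measurable_mimicSource G t).comp ih.fst).prodMk measurable_fst)
    simp only [mimicState_succ]
    exact (s.measurable_mimicStep E μ G t).comp
      (ih.prodMk (hsignal.prodMk ((measurable_pi_apply t).comp measurable_snd)))

theorem mimicState_congr (t : ℕ) {ω ω' : Sample K} {w w' : ℕ → ℝ} (hstate : ω.1 = ω'.1)
    (herror : ∀ n < t, ∀ k, ω.2 (k, n) = ω'.2 (k, n)) (hw : ∀ n < t, w n = w' n) :
    s.mimicState E μ G t ω w = s.mimicState E μ G t ω' w' := by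
  induction t with
  | zero => rfl
  | succ t ih =>
    rw [mimicState_succ, mimicState_succ, ih (fun n hn => herror n (Nat.lt_succ_of_lt hn))
      (fun n hn => hw n (Nat.lt_succ_of_lt hn)), hw t (Nat.lt_succ_self t)]
    simp only [signal, hstate, herror t (Nat.lt_succ_self t)]

variable {E G} in
theorem division_mimicStrategy (hG : IsReduction (fun q => E.postCov q 0 0) G) (ω : Sample K)
    (w : ℕ → ℝ) (t : ℕ) :
    (s.mimicStrategy E μ G w).division E ω t = G t (s.count t (s.mimicState E μ G t ω w).1) := by
  induction t with
  | zero =>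
    ext k
    simp [division, count, hG.map_zero]
  | succ t ih =>
    rw [division_succ, ih, mimicState_succ, mimicStep, count_extend, hG.map_succ_add_single]
    rfl

variable {E} in
theorem mimicState_id (hpos : E.PositiveMarginalValue) (t : ℕ) (ω : Sample K) (w : ℕ → ℝ) :
    s.mimicState E μ (fun _ q => q) t ω w =
      (s.history E ω t, s.mean E μ t (s.history E ω t)) := by
  induction t with
  | zero => exact Prod.ext (Subsingleton.elim _ _) rfl
  | succ t ih =>
    rw [mimicState_succ, ih]
    simp only [mimicStep, mimicSource, nextSource_id, sub_self,
      E.simulated_id (hpos.kalmanGain_zero_ne_zero _ _)]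
    rw [extend, fit_add_scale_mul_innovation, history, mean_snoc]

end Strategy

section Indicator

theorem measurable_indicator_fun {ι : Type*} (S : Set ι) :
    Measurable fun x : ι → ℝ => S.indicator x := by
  classical
  refine measurable_pi_lambda _ fun i => ?_
  simp only [Set.indicator_apply]
  split_ifs <;> fun_prop

theorem indepFun_indicator_infinitePi {ι : Type*} {P : ι → Measure ℝ}
    [∀ i, IsProbabilityMeasure (P i)] {S T : Finset ι} (h : Disjoint S T) :
    IndepFun (fun x => (S : Set ι).indicator x) (fun x (i : T) => x i) (Measure.infinitePi P) := by
  classical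
  have hextend : Measurable fun (y : S → ℝ) i => if hi : i ∈ S then y ⟨i, hi⟩ else 0 := by
    refine measurable_pi_lambda _ fun i => ?_
    split_ifs <;> fun_prop
  convert (indepFun_restrict_infinitePi (P := P) h).comp hextend measurable_id using 1
  · funext x i
    simp [Set.indicator_apply]
  · rfl

end Indicator

namespace Environment

variable {K : ℕ} (E : Environment K) (μ : EuclideanSpace ℝ (Fin K))

/-- The law of a sample point together with independent standard Gaussian randomizations. -/
def extLaw : Measure (Sample K × (ℕ → ℝ)) :=
  (E.law μ).prod (Measure.infinitePi fun _ : ℕ => gaussianReal 0 1)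

instance : IsProbabilityMeasure (E.extLaw μ) := by
  unfold extLaw
  infer_instance

theorem measurePreserving_state_extLaw :
    MeasurePreserving (fun p : Sample K × (ℕ → ℝ) => p.1.1) (E.extLaw μ)
      (multivariateGaussian μ E.V) :=
  measurePreserving_fst.comp measurePreserving_fst

/-- The errors and the randomization of period `t`. -/
def periodNoise (t : ℕ) (p : Sample K × (ℕ → ℝ)) : (Fin K → ℝ) × ℝ :=
  (fun k => p.1.2 (k, t), p.2 t)

theorem measurable_periodNoise (t : ℕ) : Measurable (periodNoise (K := K) t) := by
  unfold periodNoise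
  fun_prop

/-- The sample point with the errors and randomizations from period `t` on replaced by `0`. -/
def truncate (t : ℕ) (p : Sample K × (ℕ → ℝ)) : Sample K × (ℕ → ℝ) :=
  ((p.1.1, (Set.univ ×ˢ Set.Iio t).indicator p.1.2), (Set.Iio t).indicator p.2)

theorem indepFun_truncate_periodNoise (t : ℕ) :
    IndepFun (truncate t) (periodNoise t) (E.extLaw μ) := by
  have herrors : Disjoint ((Finset.univ : Finset (Fin K)) ×ˢ Finset.range t)
      (Finset.univ ×ˢ {t}) :=
    Finset.disjoint_product.2 (Or.inr (by simp))
  have hrandom : Disjoint (Finset.range t) {t} := by simp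
  have hsample := indepFun_prodMk_prod (P := multivariateGaussian μ E.V) measurable_id
    measurable_const (measurable_indicator_fun _) (by fun_prop)
    (indepFun_const_right id ())
    (indepFun_indicator_infinitePi
      (P := fun i : Fin K × ℕ => gaussianReal 0 (Real.toNNReal (E.σ i.1 ^ 2))) herrors)
  have hindep := indepFun_prodMk_prod
    (measurable_fst.prodMk ((measurable_indicator_fun _).comp measurable_snd)) (by fun_prop)
    (measurable_indicator_fun _) (by fun_prop) hsample
    (indepFun_indicator_infinitePi (P := fun _ : ℕ => gaussianReal 0 1) hrandom)
  have hnoise : Measurable fun a : (Unit × (↥((Finset.univ : Finset (Fin K)) ×ˢ {t}) → ℝ)) ×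
      (({t} : Finset ℕ) → ℝ) =>
      ((fun k => a.1.2 ⟨(k, t), by simp⟩, a.2 ⟨t, by simp⟩) : (Fin K → ℝ) × ℝ) := by
    fun_prop
  convert hindep.comp measurable_id hnoise using 1
  · funext p
    simp [truncate]
  · rfl
  · rfl

theorem measurePreserving_noise (t : ℕ) (j : Fin K) :
    MeasurePreserving (fun n : (Fin K → ℝ) × ℝ => (n.1 j, n.2)) ((E.extLaw μ).map (periodNoise t))
      ((gaussianReal 0 (Real.toNNReal (E.σ j ^ 2))).prod (gaussianReal 0 1)) := by
  refine ⟨by fun_prop, ?_⟩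
  rw [Measure.map_map (by fun_prop) (measurable_periodNoise t)]
  exact (((measurePreserving_eval_infinitePi (fun i : Fin K × ℕ =>
    gaussianReal 0 (Real.toNNReal (E.σ i.1 ^ 2))) (j, t)).comp (measurePreserving_snd
      (μ := multivariateGaussian μ E.V))).prod
    (measurePreserving_eval_infinitePi (fun _ : ℕ => gaussianReal 0 1) t)).map_eq

variable [NeZero K] (G : ℕ → (Fin K → ℕ) → Fin K → ℕ)

/-- The law of the two components of the error of the simulated posterior mean, if `G` replaces the
division `q`: the difference of the two posterior means of the payoff-relevant state, and the error
of the actual posterior mean. -/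
def residualLaw (t : ℕ) (q : Fin K → ℕ) : Measure (ℝ × EuclideanSpace ℝ (Fin K)) :=
  (gaussianReal 0 (E.slack G t q).toNNReal).prod (multivariateGaussian 0 (E.postCov (G t q)))

instance (t : ℕ) (q : Fin K → ℕ) : IsProbabilityMeasure (E.residualLaw G t q) := by
  unfold residualLaw
  infer_instance

/-- The simulated standardized observation of source `k` after the division `q`, and the updated
components of the error, from the components `c` of the error and the noise `n` of the period. -/
def errorUpdate (t : ℕ) (q : Fin K → ℕ) (k : Fin K) (c : ℝ × EuclideanSpace ℝ (Fin K))
    (n : (Fin K → ℝ) × ℝ) : ℝ × ℝ × EuclideanSpace ℝ (Fin K) :=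
  let j := nextSource G t q k
  let Z := (E.scale (G t q) j)⁻¹ * (E.fit j c.2 + n.1 j)
  let z := E.simulated G t q k c.1 Z n.2
  (z, c.1 + E.kalmanGain (G t q) j 0 * Z - E.kalmanGain q k 0 * z,
    c.2 - Z • E.kalmanGain (G t q) j)

theorem measurable_errorUpdate (t : ℕ) :
    Measurable fun a : ((Fin K → ℕ) × Fin K) × (ℝ × EuclideanSpace ℝ (Fin K)) ×
      (Fin K → ℝ) × ℝ => E.errorUpdate G t a.1.1 a.1.2 a.2.1 a.2.2 :=
  measurable_from_prod_countable_right fun a => by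
    simp only [errorUpdate, simulated, gaussianPart, fit, dotProduct]
    fun_prop

variable {E G}

theorem measurePreserving_errorUpdate (hpos : E.PositiveMarginalValue)
    (hG : IsReduction (fun q => E.postCov q 0 0) G) {t : ℕ} {q : Fin K → ℕ} (hq : ∑ i, q i = t)
    (k : Fin K) :
    MeasurePreserving (fun p => E.errorUpdate G t q k p.1 p.2)
      ((E.residualLaw G t q).prod ((E.extLaw μ).map (periodNoise t)))
      ((gaussianReal 0 1).prod (E.residualLaw G (t + 1) (q + Pi.single k 1))) := by
  have := Measure.isProbabilityMeasure_map (μ := E.extLaw μ)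
    (measurable_periodNoise t).aemeasurable
  set j := nextSource G t q k
  have hsucc : G (t + 1) (q + Pi.single k 1) = G t q + Pi.single j 1 := hG.map_succ_add_single t q k
  have hvar : E.slack G t q + E.kalmanGain (G t q) j 0 ^ 2 =
      E.kalmanGain q k 0 ^ 2 + E.slack G (t + 1) (q + Pi.single k 1) := by
    rw [kalmanGain_zero_sq, kalmanGain_zero_sq, slack, slack, hsucc]
    ring
  have hcov := E.postCov_add_single_eq_kalmanGain (G t q) j
  have hstep := measurePreserving_gaussianStep (E.posDef_postCov (G t q)).posSemidef
    (σ := E.σ j) (c := WithLp.toLp 2 (E.C j))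
    (hcov ▸ (E.posDef_postCov (G t q + Pi.single j 1)).posSemidef)
    (E.scale_pos (G t q) j).ne' (by rw [scale_sq, obsVar, signalCov_apply])
    (E.postCov_mulVec_eq_kalmanGain (G t q) j) (slack_nonneg hG hq)
    (slack_nonneg hG (by rw [sum_add_single, hq])) (hpos.kalmanGain_zero_ne_zero q k) hvar
  rw [← hcov, ← hsucc] at hstep
  simp only [← fit_eq_inner] at hstep
  exact hstep.comp ((MeasurePreserving.id _).prod (E.measurePreserving_noise μ t j))

theorem measurePreserving_residual (hG : IsReduction (fun q => E.postCov q 0 0) G) {t : ℕ}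
    {q : Fin K → ℕ} (hq : ∑ k, q k = t) :
    MeasurePreserving (fun c : ℝ × EuclideanSpace ℝ (Fin K) => c.1 + c.2 0) (E.residualLaw G t q)
      (gaussianReal 0 (E.postCov q 0 0).toNNReal) := by
  have hsum := measurePreserving_add_mul_gaussianReal (slack_nonneg hG hq)
    (E.postCov_zero_zero_pos (G t q)).le 1
  simp only [slack, one_pow, mul_one, one_mul, sub_add_cancel] at hsum
  exact hsum.comp ((MeasurePreserving.id _).prod
    (measurePreserving_eval_multivariateGaussian (μ := 0)
      (E.posDef_postCov (G t q)).posSemidef (i := 0)))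

end Environment

/-! ### The law of the simulated realizations -/

theorem measurePreserving_sub_multivariateGaussian {ι : Type*} [Fintype ι] [DecidableEq ι]
    (μ : EuclideanSpace ℝ ι) (S : Matrix ι ι ℝ) :
    MeasurePreserving (fun x => x - μ) (multivariateGaussian μ S) (multivariateGaussian 0 S) := by
  refine ⟨by fun_prop, ?_⟩
  unfold multivariateGaussian
  rw [Measure.map_map (by fun_prop) (by fun_prop)]
  simp only [Function.comp_def, add_sub_cancel_left, zero_add]

namespace Strategy

open Environment

variable {K : ℕ} {𝒜 : ℕ → Type*} [∀ t, MeasurableSpace (𝒜 t)] (s : Strategy K 𝒜)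
  (E : Environment K) (μ : EuclideanSpace ℝ (Fin K))

/-- The law of the first `t` realizations, described through the standardized observations. -/
def realizationLaw : ∀ t : ℕ, Measure (Fin t → ℝ)
  | 0 => Measure.dirac Fin.elim0
  | t + 1 => ((realizationLaw t).prod (gaussianReal 0 1)).map fun p => s.extend E μ t p.1 p.2

instance (t : ℕ) : IsProbabilityMeasure (s.realizationLaw E μ t) := by
  induction t with
  | zero =>
    unfold realizationLaw
    infer_instance
  | succ t ih =>
    unfold realizationLaw
    exact Measure.isProbabilityMeasure_map (s.measurable_extend E μ t).aemeasurable

variable [NeZero K] (G : ℕ → (Fin K → ℕ) → Fin K → ℕ)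

/-- The residual law of the current division, as a kernel. -/
def residualKernel (t : ℕ) : Kernel (Fin t → ℝ) (ℝ × EuclideanSpace ℝ (Fin K)) :=
  (Kernel.ofFunOfCountable (E.residualLaw G t)).comap (s.count t) (s.measurable_count t)

theorem residualKernel_apply (t : ℕ) (x : Fin t → ℝ) :
    s.residualKernel E G t x = E.residualLaw G t (s.count t x) := rfl

instance (t : ℕ) : IsMarkovKernel (s.residualKernel E G t) :=
  ⟨fun x => by
    rw [residualKernel_apply]
    infer_instance⟩

/-- The simulated realizations and the two components of the error, in terms of the simulated
realizations, the actual posterior mean and the state. -/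
def errorOf (t : ℕ)
    (a : ((Fin t → ℝ) × EuclideanSpace ℝ (Fin K)) × EuclideanSpace ℝ (Fin K)) :
    (Fin t → ℝ) × ℝ × EuclideanSpace ℝ (Fin K) :=
  (a.1.1, a.1.2 0 - s.mean E μ t a.1.1 0, a.2 - a.1.2)

theorem measurable_errorOf (t : ℕ) : Measurable (s.errorOf E μ t) := by
  have hcoord : Measurable fun m : EuclideanSpace ℝ (Fin K) => m 0 := by fun_prop
  exact measurable_fst.fst.prodMk (((hcoord.comp measurable_fst.snd).sub
    (hcoord.comp ((s.measurable_mean E μ t).comp measurable_fst.fst))).prodMk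
    (measurable_snd.sub measurable_fst.snd))

/-- The simulated realizations and the two components of the error at a sample point. -/
def mimicError (t : ℕ) (p : Sample K × (ℕ → ℝ)) : (Fin t → ℝ) × ℝ × EuclideanSpace ℝ (Fin K) :=
  s.errorOf E μ t (s.mimicState E μ G t p.1 p.2, p.1.1)

theorem measurable_mimicError (t : ℕ) : Measurable (s.mimicError E μ G t) :=
  (s.measurable_errorOf E μ t).comp ((s.measurable_mimicState E μ G t).prodMk measurable_fst.fst)

theorem mimicError_truncate (t : ℕ) (p : Sample K × (ℕ → ℝ)) :
    s.mimicError E μ G t (truncate t p) = s.mimicError E μ G t p := by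
  have hstate : s.mimicState E μ G t (truncate t p).1 (truncate t p).2 =
      s.mimicState E μ G t p.1 p.2 :=
    s.mimicState_congr E μ G t rfl (fun n hn k => by simp [truncate, hn])
      fun n hn => by simp [truncate, hn]
  rw [mimicError, hstate]
  rfl

theorem indepFun_mimicError_periodNoise (t : ℕ) :
    IndepFun (s.mimicError E μ G t) (periodNoise t) (E.extLaw μ) := by
  simpa only [Function.comp_def, mimicError_truncate, id] using
    (E.indepFun_truncate_periodNoise μ t).comp (s.measurable_mimicError E μ G t) measurable_id

/-- One period of `mimicError`, with the noise `n` of the period. -/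
def errorStep (t : ℕ) (a : (Fin t → ℝ) × ℝ × EuclideanSpace ℝ (Fin K)) (n : (Fin K → ℝ) × ℝ) :
    (Fin (t + 1) → ℝ) × ℝ × EuclideanSpace ℝ (Fin K) :=
  (s.extend E μ t a.1 (E.errorUpdate G t (s.count t a.1) (s.source t a.1) a.2 n).1,
    (E.errorUpdate G t (s.count t a.1) (s.source t a.1) a.2 n).2)

theorem measurable_errorStep (t : ℕ) :
    Measurable fun p : ((Fin t → ℝ) × ℝ × EuclideanSpace ℝ (Fin K)) × (Fin K → ℝ) × ℝ =>
      s.errorStep E μ G t p.1 p.2 := by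
  have hupdate := (E.measurable_errorUpdate G t).comp
    (((s.measurable_count_source t).comp measurable_fst.fst).prodMk
      (measurable_fst.snd.prodMk measurable_snd))
  exact ((s.measurable_extend E μ t).comp (measurable_fst.fst.prodMk hupdate.fst)).prodMk
    hupdate.snd

theorem mimicError_succ (t : ℕ) (p : Sample K × (ℕ → ℝ)) :
    s.mimicError E μ G (t + 1) p =
      s.errorStep E μ G t (s.mimicError E μ G t p) (periodNoise t p) := by
  simp only [mimicError, mimicState_succ]
  generalize s.mimicState E μ G t p.1 p.2 = a
  simp only [errorOf, errorStep, errorUpdate, mimicStep, mimicSource, periodNoise, mean_extend,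
    updateMean, innovation_signal, PiLp.add_apply, PiLp.smul_apply, smul_eq_mul,
    Prod.mk.injEq, true_and]
  exact ⟨by ring, sub_add_eq_sub_sub _ _ _⟩

theorem map_mimicError_zero {G : ℕ → (Fin K → ℕ) → Fin K → ℕ} (hG : G 0 0 = 0) :
    (E.extLaw μ).map (s.mimicError E μ G 0) =
      s.realizationLaw E μ 0 ⊗ₘ s.residualKernel E G 0 := by
  have hcentre := (measurePreserving_sub_multivariateGaussian μ E.V).comp
    (E.measurePreserving_state_extLaw μ)
  have hresidual : s.residualKernel E G 0 Fin.elim0 =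
      (multivariateGaussian 0 E.V).map (Prod.mk 0) := by
    rw [residualKernel_apply, residualLaw, count, slack, hG, sub_self, Real.toNNReal_zero,
      gaussianReal_zero_var, postCov_zero, Measure.dirac_prod]
  refine Measure.ext_of_lintegral _ fun f hf => ?_
  rw [Measure.lintegral_compProd hf, realizationLaw,
    lintegral_dirac' _ hf.lintegral_kernel_prod_right', hresidual, ← hcentre.map_eq,
    Measure.map_map (by fun_prop) (by fun_prop), lintegral_map hf (s.measurable_mimicError E μ G 0),
    lintegral_map (by fun_prop) (by fun_prop)]
  refine lintegral_congr fun p => ?_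
  simp only [mimicError, errorOf, mimicState, mimic, mean, sub_self, Function.comp_apply]

variable {E G}

theorem lintegral_errorStep (hpos : E.PositiveMarginalValue)
    (hG : IsReduction (fun q => E.postCov q 0 0) G) (t : ℕ) (x : Fin t → ℝ)
    {f : (Fin (t + 1) → ℝ) × ℝ × EuclideanSpace ℝ (Fin K) → ENNReal} (hf : Measurable f) :
    ∫⁻ c, ∫⁻ n, f (s.errorStep E μ G t (x, c) n) ∂((E.extLaw μ).map (periodNoise t))
        ∂(E.residualLaw G t (s.count t x)) =
      ∫⁻ z, ∫⁻ c, f (s.extend E μ t x z, c)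
        ∂(E.residualLaw G (t + 1) (s.count t x + Pi.single (s.source t x) 1))
        ∂(gaussianReal 0 1) := by
  have := Measure.isProbabilityMeasure_map (μ := E.extLaw μ)
    (measurable_periodNoise t).aemeasurable
  have hupdate := measurePreserving_errorUpdate μ hpos hG (s.sum_count t x) (s.source t x)
  have hfx : Measurable fun a : ℝ × ℝ × EuclideanSpace ℝ (Fin K) =>
      f (s.extend E μ t x a.1, a.2) :=
    hf.comp (((s.measurable_extend E μ t).comp
      (measurable_const.prodMk measurable_fst)).prodMk measurable_snd)
  calc _ = ∫⁻ p, f (s.errorStep E μ G t (x, p.1) p.2)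
          ∂((E.residualLaw G t (s.count t x)).prod ((E.extLaw μ).map (periodNoise t))) :=
        (lintegral_prod _ (hfx.comp hupdate.measurable).aemeasurable).symm
    _ = ∫⁻ a, f (s.extend E μ t x a.1, a.2) ∂((gaussianReal 0 1).prod
          (E.residualLaw G (t + 1) (s.count t x + Pi.single (s.source t x) 1))) :=
        hupdate.lintegral_comp hfx
    _ = _ := lintegral_prod _ hfx.aemeasurable

theorem map_errorStep (hpos : E.PositiveMarginalValue)
    (hG : IsReduction (fun q => E.postCov q 0 0) G) (t : ℕ) :
    ((s.realizationLaw E μ t ⊗ₘ s.residualKernel E G t).prod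
        ((E.extLaw μ).map (periodNoise t))).map (fun a => s.errorStep E μ G t a.1 a.2) =
      s.realizationLaw E μ (t + 1) ⊗ₘ s.residualKernel E G (t + 1) := by
  have := Measure.isProbabilityMeasure_map (μ := E.extLaw μ)
    (measurable_periodNoise t).aemeasurable
  have hstep := s.measurable_errorStep E μ G t
  have hextend := s.measurable_extend E μ t
  refine Measure.ext_of_lintegral _ fun f hf => ?_
  have hfstep : Measurable fun a : ((Fin t → ℝ) × ℝ × EuclideanSpace ℝ (Fin K)) ×
    (Fin K → ℝ) × ℝ => f (s.errorStep E μ G t a.1 a.2) := hf.comp hstep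
  rw [lintegral_map hf hstep, lintegral_prod _ hfstep.aemeasurable,
    Measure.lintegral_compProd hfstep.lintegral_prod_right', Measure.lintegral_compProd hf,
    realizationLaw, lintegral_map hf.lintegral_kernel_prod_right' hextend,
    lintegral_prod _ (Measurable.aemeasurable ?_)]
  · simp only [residualKernel_apply, count_extend]
    exact lintegral_congr fun x => s.lintegral_errorStep μ hpos hG t x hf
  · exact hf.lintegral_kernel_prod_right'.comp hextend

theorem map_mimicError (hpos : E.PositiveMarginalValue)
    (hG : IsReduction (fun q => E.postCov q 0 0) G) (t : ℕ) :
    (E.extLaw μ).map (s.mimicError E μ G t) =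
      s.realizationLaw E μ t ⊗ₘ s.residualKernel E G t := by
  induction t with
  | zero => exact s.map_mimicError_zero E μ hG.map_zero
  | succ t ih =>
    have hnoise := measurable_periodNoise (K := K) t
    have := Measure.isProbabilityMeasure_map (μ := E.extLaw μ) hnoise.aemeasurable
    have herror := s.measurable_mimicError E μ G t
    have hstep := s.measurable_errorStep E μ G t
    have hindep := s.indepFun_mimicError_periodNoise E μ G t
    rw [indepFun_iff_map_prod_eq_prod_map_map herror.aemeasurable hnoise.aemeasurable, ih]
      at hindep
    have hsucc : s.mimicError E μ G (t + 1) = (fun a => s.errorStep E μ G t a.1 a.2) ∘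
        fun p => (s.mimicError E μ G t p, periodNoise t p) :=
      funext (s.mimicError_succ E μ G t)
    rw [hsucc, ← Measure.map_map hstep (herror.prodMk hnoise), hindep]
    exact s.map_errorStep μ hpos hG t

/-- As the right-hand side does not involve `G`, the joint law is the same as for the identity,
where the simulated realizations are the actual ones. -/
theorem lintegral_mimicState (hpos : E.PositiveMarginalValue)
    (hG : IsReduction (fun q => E.postCov q 0 0) G) (t : ℕ) {f : (Fin t → ℝ) × ℝ → ENNReal}
    (hf : Measurable f) :
    ∫⁻ p, f ((s.mimicState E μ G t p.1 p.2).1, p.1.1 0) ∂(E.extLaw μ) =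
      ∫⁻ x, ∫⁻ u, f (x, s.mean E μ t x 0 + u)
        ∂(gaussianReal 0 (E.postCov (s.count t x) 0 0).toNNReal) ∂(s.realizationLaw E μ t) := by
  have hcoord : Measurable fun m : EuclideanSpace ℝ (Fin K) => m 0 := by fun_prop
  have hmean := hcoord.comp (s.measurable_mean E μ t)
  let g (a : (Fin t → ℝ) × ℝ × EuclideanSpace ℝ (Fin K)) : ENNReal :=
    f (a.1, s.mean E μ t a.1 0 + (a.2.1 + a.2.2 0))
  have hg : Measurable g :=
    hf.comp (measurable_fst.prodMk ((hmean.comp measurable_fst).add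
      (measurable_snd.fst.add (hcoord.comp measurable_snd.snd))))
  have hfg (p : Sample K × (ℕ → ℝ)) :
      f ((s.mimicState E μ G t p.1 p.2).1, p.1.1 0) = g (s.mimicError E μ G t p) := by
    simp only [g, mimicError, errorOf, PiLp.sub_apply]
    congr 2
    ring
  simp only [hfg]
  rw [← lintegral_map hg (s.measurable_mimicError E μ G t), s.map_mimicError μ hpos hG t,
    Measure.lintegral_compProd hg]
  refine lintegral_congr fun x => ?_
  have hfx : Measurable fun u => f (x, s.mean E μ t x 0 + u) :=
    hf.comp (measurable_const.prodMk (measurable_const.add measurable_id))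
  exact (measurePreserving_residual hG (s.sum_count t x)).lintegral_comp hfx

end Strategy

/-! ### Payoffs of the mimicking strategy -/

namespace Strategy

open Environment

variable {K : ℕ} {𝒜 : ℕ → Type*} [∀ t, MeasurableSpace (𝒜 t)] (s : Strategy K 𝒜)

theorem expectedPayoff_eq_integral [NeZero K] {E : Environment K} (μ : EuclideanSpace ℝ (Fin K))
    {U : (∀ t, 𝒜 t) → ℝ → ℝ} (hint : Integrable (s.payoff E U) (E.law μ)) :
    s.expectedPayoff E μ U = ((∫ ω, s.payoff E U ω ∂(E.law μ) : ℝ) : EReal) := by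
  have hpos := hint.lintegral_lt_top.ne
  have hneg := hint.neg.lintegral_lt_top.ne
  simp only [Pi.neg_apply] at hneg
  rw [expectedPayoff, integral_eq_lintegral_pos_part_sub_lintegral_neg_part hint, EReal.coe_sub]
  generalize ∫⁻ ω, ENNReal.ofReal (s.payoff E U ω) ∂(E.law μ) = a at hpos ⊢
  generalize ∫⁻ ω, ENNReal.ofReal (-s.payoff E U ω) ∂(E.law μ) = b at hneg ⊢
  lift a to NNReal using hpos
  lift b to NNReal using hneg
  rfl

/-- The payoff, as a function of the realizations and the payoff-relevant state. -/
def pathPayoff (U : (∀ t, 𝒜 t) → ℝ → ℝ) (x : (ℕ → ℝ) × ℝ) : ℝ :=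
  U (fun t => s.action t (initialSegment (t + 1) x).1) x.2

theorem measurable_pathPayoff {U : (∀ t, 𝒜 t) → ℝ → ℝ} (hU : Measurable (Function.uncurry U)) :
    Measurable (s.pathPayoff U) :=
  hU.comp ((measurable_pi_lambda _ fun t => (s.measurable_action t).comp
    (measurable_initialSegment (t + 1)).fst).prodMk measurable_snd)

variable [NeZero K]

section Path

variable (E : Environment K) (μ : EuclideanSpace ℝ (Fin K)) (G : ℕ → (Fin K → ℕ) → Fin K → ℕ)

/-- The sequence of all simulated realizations, and the payoff-relevant state. -/
def mimicPath (p : Sample K × (ℕ → ℝ)) : (ℕ → ℝ) × ℝ :=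
  (fun n => (s.mimicState E μ G (n + 1) p.1 p.2).1 (Fin.last n), p.1.1 0)

theorem measurable_mimicPath : Measurable (s.mimicPath E μ G) :=
  (measurable_pi_lambda _ fun n => (measurable_pi_apply (Fin.last n)).comp
    (s.measurable_mimicState E μ G (n + 1)).fst).prodMk
    ((by fun_prop : Measurable fun x : EuclideanSpace ℝ (Fin K) => x 0).comp measurable_fst.fst)

theorem initialSegment_mimicPath (t : ℕ) (p : Sample K × (ℕ → ℝ)) :
    initialSegment t (s.mimicPath E μ G p) = ((s.mimicState E μ G t p.1 p.2).1, p.1.1 0) := by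
  refine Prod.ext ?_ rfl
  induction t with
  | zero => exact Subsingleton.elim _ _
  | succ t ih =>
    funext i
    induction i using Fin.lastCases with
    | last => rfl
    | cast i =>
      rw [mimicState_succ]
      simp only [mimicStep, extend, Fin.snoc_castSucc]
      rw [← ih]
      rfl

theorem payoff_mimicStrategy (U : (∀ t, 𝒜 t) → ℝ → ℝ) (p : Sample K × (ℕ → ℝ)) :
    (s.mimicStrategy E μ G p.2).payoff E U p.1 = s.pathPayoff U (s.mimicPath E μ G p) := by
  simp only [pathPayoff, initialSegment_mimicPath]
  rfl

end Path

variable {E : Environment K} (μ : EuclideanSpace ℝ (Fin K)) {G : ℕ → (Fin K → ℕ) → Fin K → ℕ}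

theorem payoff_eq_pathPayoff (hpos : E.PositiveMarginalValue) (U : (∀ t, 𝒜 t) → ℝ → ℝ)
    (p : Sample K × (ℕ → ℝ)) :
    s.payoff E U p.1 = s.pathPayoff U (s.mimicPath E μ (fun _ q => q) p) := by
  simp only [pathPayoff, initialSegment_mimicPath, s.mimicState_id μ hpos]
  rfl

theorem map_mimicPath_eq (hpos : E.PositiveMarginalValue)
    (hG : IsReduction (fun q => E.postCov q 0 0) G) :
    (E.extLaw μ).map (s.mimicPath E μ G) =
      (E.extLaw μ).map (s.mimicPath E μ fun _ q => q) := by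
  have hpath := s.measurable_mimicPath E μ G
  have hpath_id := s.measurable_mimicPath E μ fun _ q => q
  have := Measure.isProbabilityMeasure_map (μ := E.extLaw μ) hpath.aemeasurable
  have := Measure.isProbabilityMeasure_map (μ := E.extLaw μ) hpath_id.aemeasurable
  refine ext_of_map_initialSegment fun t => ?_
  refine Measure.ext_of_lintegral _ fun f hf => ?_
  have hsegment := measurable_initialSegment (α := ℝ) t
  have hfsegment : Measurable fun x => f (initialSegment t x) := hf.comp hsegment
  rw [lintegral_map hf hsegment, lintegral_map hfsegment hpath,
    lintegral_map hf hsegment, lintegral_map hfsegment hpath_id]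
  simp only [initialSegment_mimicPath]
  rw [s.lintegral_mimicState μ hpos hG t hf, s.lintegral_mimicState μ hpos (isReduction_id _) t hf]

section Optimal

variable {U : (∀ t, 𝒜 t) → ℝ → ℝ}

theorem integrable_payoff_mimicStrategy (hpos : E.PositiveMarginalValue)
    (hG : IsReduction (fun q => E.postCov q 0 0) G) (hU : Measurable (Function.uncurry U))
    (hint : Integrable (s.payoff E U) (E.law μ)) :
    Integrable (fun p => (s.mimicStrategy E μ G p.2).payoff E U p.1) (E.extLaw μ) := by
  have hint_id : Integrable (fun p => s.pathPayoff U (s.mimicPath E μ (fun _ q => q) p))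
      (E.extLaw μ) := by
    simp only [← s.payoff_eq_pathPayoff μ hpos]
    exact hint.comp_fst _
  simp only [payoff_mimicStrategy]
  refine Integrable.comp_measurable (g := s.pathPayoff U) ?_ (s.measurable_mimicPath E μ G)
  rw [s.map_mimicPath_eq μ hpos hG]
  exact (integrable_map_measure (s.measurable_pathPayoff hU).aestronglyMeasurable
    (s.measurable_mimicPath E μ _).aemeasurable).2 hint_id

theorem integral_payoff_mimicStrategy (hpos : E.PositiveMarginalValue)
    (hG : IsReduction (fun q => E.postCov q 0 0) G) (hU : Measurable (Function.uncurry U)) :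
    ∫ p, (s.mimicStrategy E μ G p.2).payoff E U p.1 ∂(E.extLaw μ) =
      ∫ ω, s.payoff E U ω ∂(E.law μ) := by
  have hpayoff := s.measurable_pathPayoff hU
  simp only [payoff_mimicStrategy]
  rw [← integral_map (s.measurable_mimicPath E μ G).aemeasurable hpayoff.aestronglyMeasurable,
    s.map_mimicPath_eq μ hpos hG,
    integral_map (s.measurable_mimicPath E μ _).aemeasurable hpayoff.aestronglyMeasurable]
  simp only [← s.payoff_eq_pathPayoff μ hpos]
  rw [extLaw, integral_fun_fst, probReal_univ, one_smul]

theorem exists_isOptimal_mimicStrategy (hpos : E.PositiveMarginalValue)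
    (hG : IsReduction (fun q => E.postCov q 0 0) G) (hU : Measurable (Function.uncurry U))
    (hs : s.IsOptimal E μ U) : ∃ w, (s.mimicStrategy E μ G w).IsOptimal E μ U := by
  let W : Measure (ℕ → ℝ) := Measure.infinitePi fun _ => gaussianReal 0 1
  let I (w : ℕ → ℝ) : ℝ := ∫ ω, (s.mimicStrategy E μ G w).payoff E U ω ∂(E.law μ)
  have hint := s.integrable_payoff_mimicStrategy μ hpos hG hU hs.1
  have hint_section : ∀ᵐ w ∂W, Integrable ((s.mimicStrategy E μ G w).payoff E U) (E.law μ) :=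
    hint.prod_left_ae
  have hle : ∀ᵐ w ∂W, I w ≤ ∫ ω, s.payoff E U ω ∂(E.law μ) := hint_section.mono fun w hw => by
    have hopt := hs.2 (s.mimicStrategy E μ G w)
    rwa [expectedPayoff_eq_integral _ μ hw, expectedPayoff_eq_integral _ μ hs.1,
      EReal.coe_le_coe_iff] at hopt
  have haverage : ∫ w, I w ∂W = ∫ _, ∫ ω, s.payoff E U ω ∂(E.law μ) ∂W := by
    rw [integral_const, probReal_univ, one_smul, ← s.integral_payoff_mimicStrategy μ hpos hG hU,
      extLaw, integral_prod_symm _ hint]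
  obtain ⟨w, hw, hw_eq⟩ := (hint_section.and <|
    (integral_eq_iff_of_ae_le hint.integral_prod_right (integrable_const _) hle).1 haverage).exists
  refine ⟨w, hw, fun s' => (hs.2 s').trans_eq ?_⟩
  rw [expectedPayoff_eq_integral _ μ hw, expectedPayoff_eq_integral _ μ hs.1]
  exact congrArg _ hw_eq.symm

end Optimal

end Strategy

end

theorem proposition2 {K : ℕ} [NeZero K] (E : Environment K)
    (hE : E.NonRedundant) (hpos : E.PositiveMarginalValue)
    (hirr : ∀ i j : Fin K, i ≠ j → Irrational (E.freq i / E.freq j)) :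
    ∃ (A : Set ℕ) (n : ℕ → Fin K → ℕ), HasNaturalDensity A 1 ∧
      (∀ t ∈ A, ∀ q : Fin K → ℕ, E.IsTOptimal t q ↔ q = n t) ∧
      ∀ (μ : EuclideanSpace ℝ (Fin K)) (𝒜 : ℕ → Type*) [∀ t, MeasurableSpace (𝒜 t)]
        (U : (∀ t, 𝒜 t) → ℝ → ℝ), Measurable (Function.uncurry U) →
        (∃ s : Strategy K 𝒜, s.IsOptimal E μ U) →
        ∃ s : Strategy K 𝒜, s.IsOptimal E μ U ∧
          ∀ t ∈ A, ∀ᵐ ω ∂(E.law μ), s.division E ω t = n t := by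
  obtain ⟨A, n, G, hA, hn, hG, hGA⟩ := hE.exists_isReduction hpos hirr
  refine ⟨A, n, hA, hn, fun μ 𝒜 _ U hU ⟨s, hs⟩ => ?_⟩
  obtain ⟨w, hw⟩ := s.exists_isOptimal_mimicStrategy μ hpos hG hU hs
  refine ⟨s.mimicStrategy E μ G w, hw, fun t ht => ae_of_all _ fun ω => ?_⟩
  rw [s.division_mimicStrategy μ hG, hGA t ht]
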